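/- Let $n \ge 0$ be an integer. All cell complexes are finite. **Definitions.** A regular cell complex $\mathcal L$ is a finite collection of subspaces (cells, or faces) of a Hausdorff space $X$, containing $\varnothing$, such that each nonempty cell is homeomorphic to a closed Euclidean unit ball, the relative interiors of the nonempty cells partition $X$, and the boundary of each cell is a union of cells. It is cubical if, for every nonempty cell $\sigma$, the poset of cells contained in $\sigma$ is isomorphic to the face poset of a cube of dimension $\dim\sigma$. If $\mathcal L$ is cubical of dimension $n$, $f_k$ is the number of its $k$-dimensional cells and $\widetilde\chi(\mathcal L) = -1+\sum_{k=0}^n(-1)^kf_k$, its (normalized) cubical $h$-vector $(h_0(\mathcal L),\dots,h_{n+1}(\mathcal L))$ is the sequence of coefficients of the polynomial $h(\mathcal L,x)$ defined by $$(1+x)\,h(\mathcal L,x) = 1+\sum_{k=0}^n f_k\,x^{k+1}\Big(\frac{1-x}{2}\Big)^{n-k}+(-1)^n\,\widetilde\chi(\mathcal L)\,x^{n+2}.$$ The boundary complex $\partial\tau$ of a cell $\tau$ is the complex of all cells properly contained in $\tau$. A complex is pure if all its facets (inclusion-maximal cells) have the same dimension. A pure complex is shellable if it is zero-dimensional (and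 then every linear ordering of its facets is a shelling) or its facets have a linear ordering $\tau_1,\dots,\tau_m$ (a shelling) such that (a) $\partial\tau_1$ is shellable and (b) for $2\le j\le m$ the complex of faces of $\partial\tau_j$ contained in $\tau_1\cup\cdots\cup\tau_{j-1}$ is pure of the same dimension as $\partial\tau_j$, and $\partial\tau_j$ has a shelling in which the facets of $\partial\tau_j$ contained in $\tau_1\cup\cdots\cup\tau_{j-1}$ form an initial segment. The barycentric subdivision $\mathrm{sd}(\mathcal L)$ is the abstract simplicial complex of chains of nonempty faces of $\mathcal L$; for a convex polytope $Q$, $\mathrm{sd}(Q)$ is the complex of chains of nonempty faces of $Q$ ($Q$ included). A polytope is cubical if its boundary complex is cubical. The $h$-polynomial of a $d$-dimensional simplicial complex $\Delta$ is $h(\Delta,x)=\sum_{F\in\Delta}x^{|F|}(1-x)^{d+1-|F|}$, the empty face included. $B_n(x)$ is the Eulerian polynomial of type $B$, $B_n(x)=\sum_w x^{\mathrm{des}_B(w)}$, over all signed permutations $w$ of $\{1,\dots,n\}$, where $\mathrm{des}_B(w)$ is the number of $0\le i\le n-1$ with $w(i)>w(i+1)$ and $w(0)=0$. A polynomial in $\mathbb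 R[x]$ is real-rooted if it is zero or all its complex roots are real. For real-rooted $p,q$, $p$ interlaces $q$ (equivalently, $q$ is interlaced by $p$) if the roots $\alpha_i$ of $p$ and $\beta_j$ of $q$, with multiplicity, can be listed as $\cdots\le\beta_3\le\alpha_2\le\beta_2\le\alpha_1\le\beta_1\le0$. **Statement.** 1. For every $n$-dimensional cubical complex $\mathcal L$ with $h_k(\mathcal L)\ge0$ for all $0\le k\le n+1$, the polynomial $h(\mathrm{sd}(\mathcal L),x)$ is real-rooted and interlaced by $B_n(x)$. 2. For every shellable $n$-dimensional cubical complex $\mathcal L$, the polynomial $h(\mathrm{sd}(\mathcal L),x)$ is real-rooted and interlaced by $B_n(x)$. 3. For every cubical convex polytope $Q$ of dimension $n+1$, the polynomial $h(\mathrm{sd}(Q),x)$ is real-rooted and interlaced by $B_n(x)$. -/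

import Mathlib

noncomputable section

namespace CubicalSubdivision

open Polynomial

/-! ### Simplicial complexes: `f`-numbers, `h`-polynomial, barycentric subdivision -/

/-- The number of faces with `i` vertices, i.e. of dimension `i - 1`; the empty face, which is not
recorded in Mathlib's `faces`, is counted for `i = 0`. -/
def faceCount {V : Type*} (Δ : PreAbstractSimplicialComplex V) : ℕ → ℕ
  | 0 => 1
  | i + 1 => {F : Finset V | F ∈ Δ.faces ∧ F.card = i + 1}.ncard

/-- The dimension of a (finite) simplicial complex plus one: the largest size of a face. -/
def dimSucc {V : Type*} (Δ : PreAbstractSimplicialComplex V) : ℕ :=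
  sSup (Finset.card '' Δ.faces)

/-- The `h`-polynomial `∑ᵢ f_{i-1} xⁱ (1 - x)^{d + 1 - i}`, `0 ≤ i ≤ d + 1`, of a (finite)
simplicial complex of dimension `d`. -/
def hPoly {V : Type*} (Δ : PreAbstractSimplicialComplex V) : ℝ[X] :=
  ∑ i ∈ Finset.range (dimSucc Δ + 1),
    (faceCount Δ i : ℝ[X]) * X ^ i * (1 - X) ^ (dimSucc Δ - i)

/-- The barycentric subdivision of a complex given by the collection `K` of its faces: its simplices
are the chains of nonempty faces. -/
def sd {X : Type*} (K : Set (Set X)) : PreAbstractSimplicialComplex (Set X) where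
  faces := {c | c.Nonempty ∧ (∀ σ ∈ c, σ ∈ K ∧ σ.Nonempty) ∧ IsChain (· ⊆ ·) (c : Set (Set X))}
  isRelLowerSet_faces := by
    rintro c ⟨hc, hK, hch⟩
    exact ⟨hc, fun b hb hne => ⟨hne, fun σ hσ => hK σ (hb hσ),
      hch.mono (Finset.coe_subset.2 hb)⟩⟩

/-! ### The combinatorics of complexes given by a collection of faces and a dimension function -/

/-- The poset of nonempty faces of the `k`-dimensional cube `[0, 1]ᵏ`, ordered by inclusion. Such a
face is a product of `k` nonempty faces `{0}`, `{1}`, `[0, 1]` of the unit interval, each recorded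
by its set of vertices (a nonempty subset of the two-element type `Bool`). -/
abbrev CubeFace (k : ℕ) : Type := Fin k → {s : Finset Bool // s.Nonempty}

/-- Every nonempty face `σ` is combinatorially isomorphic to a cube (of dimension `dim σ`). -/
def IsCubical {X : Type*} (K : Set (Set X)) (dim : Set X → ℕ) : Prop :=
  ∀ σ ∈ K, σ.Nonempty →
    Nonempty ({ρ : Set X // ρ ∈ K ∧ ρ.Nonempty ∧ ρ ⊆ σ} ≃o CubeFace (dim σ))

/-- The boundary complex of the face `σ`: all faces properly contained in `σ`. -/
def boundary {X : Type*} (K : Set (Set X)) (σ : Set X) : Set (Set X) :=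
  {ρ | ρ ∈ K ∧ ρ ⊂ σ}

/-- Pure of dimension `d ≥ 0`: some face is nonempty, and all facets have dimension `d`. -/
def IsPure {X : Type*} (K : Set (Set X)) (dim : Set X → ℕ) (d : ℕ) : Prop :=
  (∃ σ ∈ K, σ.Nonempty) ∧ ∀ σ, Maximal (· ∈ K) σ → dim σ = d

/-- `τ 0, …, τ (m - 1)` is a shelling of the complex `K`, which is pure of dimension `d`. In
dimension zero every ordering of the facets counts as a shelling. -/
def IsShelling {X : Type*} (dim : Set X → ℕ) :
    (d : ℕ) → (K : Set (Set X)) → (m : ℕ) → (τ : Fin m → Set X) → Prop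
  | 0, K, _, τ =>
      IsPure K dim 0 ∧ Function.Injective τ ∧ Set.range τ = {σ | Maximal (· ∈ K) σ}
  | d + 1, K, m, τ =>
      IsPure K dim (d + 1) ∧ Function.Injective τ ∧ Set.range τ = {σ | Maximal (· ∈ K) σ} ∧
      (∀ j : Fin m, (j : ℕ) = 0 →
        ∃ (l : ℕ) (ρ : Fin l → Set X), IsShelling dim d (boundary K (τ j)) l ρ) ∧
      (∀ j : Fin m, 0 < (j : ℕ) →
        IsPure {σ | σ ∈ boundary K (τ j) ∧ σ ⊆ ⋃ i : {i : Fin m // i < j}, τ i} dim d ∧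
        ∃ (l : ℕ) (ρ : Fin l → Set X), IsShelling dim d (boundary K (τ j)) l ρ ∧
          ∃ r : ℕ, ∀ s : Fin l, (ρ s ⊆ ⋃ i : {i : Fin m // i < j}, τ i) ↔ (s : ℕ) < r)

/-- Shellable (of some dimension). -/
def IsShellable {X : Type*} (K : Set (Set X)) (dim : Set X → ℕ) : Prop :=
  ∃ (d m : ℕ) (τ : Fin m → Set X), IsShelling dim d K m τ

/-- The number of `k`-dimensional faces. -/
def fNum {X : Type*} (K : Set (Set X)) (dim : Set X → ℕ) (k : ℕ) : ℕ :=
  {σ : Set X | σ ∈ K ∧ σ.Nonempty ∧ dim σ = k}.ncard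

/-! ### Regular cell complexes -/

/-- A finite regular cell complex on the (Hausdorff) space `X`. The empty set is one of the cells.
A nonempty cell `σ` comes with a homeomorphism from the closed unit ball of dimension `dim σ`; the
images of the open ball and of the sphere are the relative interior and the boundary of `σ`. The
value of `dim` is irrelevant on sets other than the nonempty cells. -/
structure RegularCellComplex (X : Type*) [TopologicalSpace X] where
  cells : Set (Set X)
  finite_cells : cells.Finite
  empty_mem : ∅ ∈ cells
  dim : Set X → ℕ
  homeo : ∀ σ : {σ : Set X // σ ∈ cells ∧ σ.Nonempty},
    Metric.closedBall (0 : EuclideanSpace ℝ (Fin (dim σ.1))) 1 ≃ₜ σ.1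
  /-- The relative interiors of the nonempty cells partition `X`. -/
  partition : ∀ x : X, ∃! σ : {σ : Set X // σ ∈ cells ∧ σ.Nonempty},
    ∃ p : Metric.closedBall (0 : EuclideanSpace ℝ (Fin (dim σ.1))) 1,
      ‖p.1‖ < 1 ∧ (homeo σ p : X) = x
  /-- The boundary of every cell is a union of cells. -/
  boundary_eq : ∀ σ : {σ : Set X // σ ∈ cells ∧ σ.Nonempty}, ∃ S ⊆ cells,
    {x : X | ∃ p : Metric.closedBall (0 : EuclideanSpace ℝ (Fin (dim σ.1))) 1,
      ‖p.1‖ = 1 ∧ (homeo σ p : X) = x} = ⋃₀ S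

/-- The complex has dimension `n`: this is the largest dimension of a nonempty cell. -/
def RegularCellComplex.HasDim {X : Type*} [TopologicalSpace X] (L : RegularCellComplex X)
    (n : ℕ) : Prop :=
  IsGreatest (L.dim '' {σ | σ ∈ L.cells ∧ σ.Nonempty}) n

/-! ### The cubical `h`-polynomial -/

/-- The reduced Euler characteristic `-1 + ∑ₖ (-1)ᵏ fₖ` of an `n`-dimensional complex. -/
def reducedEuler (n : ℕ) (f : ℕ → ℕ) : ℝ :=
  -1 + ∑ k ∈ Finset.range (n + 1), (-1) ^ k * (f k : ℝ)

/-- `1 + ∑ₖ fₖ x^{k+1} ((1 - x)/2)^{n-k} + (-1)ⁿ χ̃ x^{n+2}`. -/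
def cubicalNumerator (n : ℕ) (f : ℕ → ℕ) : ℝ[X] :=
  1 + ∑ k ∈ Finset.range (n + 1), (f k : ℝ[X]) * X ^ (k + 1) * (C (1 / 2) * (1 - X)) ^ (n - k)
    + C ((-1) ^ n * reducedEuler n f) * X ^ (n + 2)

/-- The (normalized) cubical `h`-polynomial of an `n`-dimensional complex with face numbers `f`:
the quotient of `cubicalNumerator n f` by `1 + x`. The division is exact, see
`one_add_X_mul_cubicalHPoly`. -/
def cubicalHPoly (n : ℕ) (f : ℕ → ℕ) : ℝ[X] :=
  cubicalNumerator n f /ₘ (X - C (-1))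

theorem one_add_X_mul_cubicalHPoly (n : ℕ) (f : ℕ → ℕ) :
    (1 + X) * cubicalHPoly n f = cubicalNumerator n f := by
  have hroot : (cubicalNumerator n f).IsRoot (-1) := by
    have h2 : ((1 : ℝ) / 2 * (1 - -1)) = 1 := by norm_num
    have h3 : ((-1 : ℝ)) ^ n * (-1) ^ (n + 2) = 1 := by
      rw [← pow_add, show n + (n + 2) = 2 * (n + 1) by ring, pow_mul]; norm_num
    have h4 : ∀ k : ℕ, (f k : ℝ) * (-1) ^ (k + 1) = -((-1) ^ k * (f k : ℝ)) := by
      intro k; ring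
    simp only [cubicalNumerator, reducedEuler, IsRoot, eval_add, eval_one, eval_finsetSum,
      eval_mul, eval_natCast, eval_pow, eval_X, eval_C, eval_sub, h2, one_pow, mul_one, h4,
      Finset.sum_neg_distrib]
    linear_combination (-1 + ∑ k ∈ Finset.range (n + 1), (-1) ^ k * (f k : ℝ)) * h3
  have h := mul_divByMonic_eq_iff_isRoot.2 hroot
  have hX : (1 + X : ℝ[X]) = X - C (-1) := by simp [add_comm]
  rw [hX]
  exact h

/-- The entry `h_k` of the (normalized) cubical `h`-vector of an `n`-dimensional complex. -/
def RegularCellComplex.cubicalH {X : Type*} [TopologicalSpace X] (L : RegularCellComplex X)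
    (n k : ℕ) : ℝ :=
  (cubicalHPoly n (fNum L.cells L.dim)).coeff k

/-! ### Convex polytopes -/

/-- A convex polytope: the convex hull of finitely many points. -/
def IsPolytope {E : Type*} [AddCommGroup E] [Module ℝ E] (Q : Set E) : Prop :=
  ∃ S : Finset E, Q = convexHull ℝ (S : Set E)

/-- The faces of a polytope `Q`, including `∅` and `Q`. -/
def polytopeFaces {E : Type*} [AddCommGroup E] [Module ℝ E] [TopologicalSpace E] (Q : Set E) :
    Set (Set E) :=
  {F | IsExposed ℝ Q F}

/-- The (affine) dimension of a nonempty convex set. -/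
def affineDim {E : Type*} [AddCommGroup E] [Module ℝ E] (F : Set E) : ℕ :=
  Module.finrank ℝ (vectorSpan ℝ F)

/-- A polytope is cubical if its boundary complex is cubical. -/
def IsCubicalPolytope {E : Type*} [AddCommGroup E] [Module ℝ E] [TopologicalSpace E]
    (Q : Set E) : Prop :=
  IsPolytope Q ∧ IsCubical (boundary (polytopeFaces Q) Q) affineDim

/-! ### The Eulerian polynomial of type `B` -/

/-- A signed permutation of `{1, …, n}`: a permutation together with a sign for each position. -/
abbrev SignedPerm (n : ℕ) : Type := Equiv.Perm (Fin n) × (Fin n → ℤˣ)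

/-- The value `w(i)` of the signed permutation `w` for `1 ≤ i ≤ n`, with `w(0) = 0`. (The value for
`i > n` is irrelevant.) -/
def SignedPerm.val {n : ℕ} (w : SignedPerm n) : ℕ → ℤ
  | 0 => 0
  | i + 1 => if h : i < n then (w.2 ⟨i, h⟩ : ℤ) * ((w.1 ⟨i, h⟩ : ℕ) + 1 : ℤ) else 0

/-- The number of type `B` descents: the indices `0 ≤ i ≤ n - 1` with `w(i) > w(i + 1)`. -/
def SignedPerm.des {n : ℕ} (w : SignedPerm n) : ℕ :=
  ((Finset.range n).filter fun i => w.val (i + 1) < w.val i).card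

/-- The Eulerian polynomial `B_n(x)` of type `B`. -/
def eulerianB (n : ℕ) : ℝ[X] :=
  ∑ w : SignedPerm n, X ^ w.des

/-! ### Real-rootedness and interlacing -/

/-- Zero, or without nonreal complex roots. -/
def RealRooted (p : ℝ[X]) : Prop :=
  p = 0 ∨ ∀ z : ℂ, aeval z p = 0 → z.im = 0

/-- `p` interlaces `q`: both are real-rooted, and the roots `α` of `p` and `β` of `q`, with
multiplicities, can be listed so that `⋯ ≤ β₃ ≤ α₂ ≤ β₂ ≤ α₁ ≤ β₁ ≤ 0`. As the list alternates, `q`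
has as many roots as `p` or one more. (Only used for nonzero polynomials.) -/
def Interlaces (p q : ℝ[X]) : Prop :=
  RealRooted p ∧ RealRooted q ∧
    ∃ (r s : ℕ) (α : Fin r → ℝ) (β : Fin s → ℝ),
      Multiset.map α Finset.univ.val = p.roots ∧
      Multiset.map β Finset.univ.val = q.roots ∧
      (s = r ∨ s = r + 1) ∧
      (∀ (i : Fin r) (j : Fin s), (j : ℕ) = i → α i ≤ β j) ∧
      (∀ (i : Fin r) (j : Fin s), (j : ℕ) = i + 1 → β j ≤ α i) ∧
      (∀ j : Fin s, β j ≤ 0)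

end CubicalSubdivision

end

open CubicalSubdivision

/-!
The `h`-polynomial of the barycentric subdivision of an `n`-dimensional cubical complex is
`∑ₖ hₖ pₖ`, where `h₀ = 1, h₁, …, h_{n+1}` is the cubical `h`-vector and the polynomials
`pₖ = cubeBasis n k` depend on `n` and `k` only (`hPoly_sd_eq_cubeComb`). The formula is found by
comparing power series: divided by `(1 - x) ^ (n + 1)`, both sides have explicit coefficients, on
the left because a face of dimension `k` is the top of chains counted, with the weight `x / (1 - x)`
for each member, by `∑ (2 m - 1) ^ k x ^ m`, on the right by the recursion that defines `pₖ`. The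
same comparison, together with the insertion recurrence for signed permutations, shows that `p₀` is
the Eulerian polynomial of type `B` (`eulerianB_eq_cubeBasis`).

That nonnegative combinations with `h₀ = 1` are interlaced by `p₀` (`interlaces_cubeComb`) rests on
the signs of the Wronskians of the family `p₀, …, p_{n+1}`, which the recursion preserves:
`W(p₀, pₖ)` is positive on the negative axis for `1 ≤ k ≤ n`. Wronskians are additive, so `∑ hₖ pₖ`
alternates in sign at the roots of `p₀` and the intermediate value theorem provides its roots. If
`h₁ = ⋯ = hₙ = 0`, then the combination is `(1 + h_{n+1} x) p₀`. This settles complexes with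
nonnegative cubical `h`-vector.

For the other two classes the `h`-vector is shown to be nonnegative, from one criterion
(`cubicalHPoly_nonneg`). The facets are ordered such that each one meets the earlier ones in a union
of its own facets, and such that the set of these, if closed under passing to the antipode in the
cube, consists of all of them. The faces that are new in a facet then contribute to `h` a product of
factors `x`, `(1 + x) / 2`, `1 / 2` and `1`. A shelling satisfies the criterion because an
antipodally closed nonempty initial segment of a shelling of the boundary of a cube is everything
(`mem_initial_segment`). For a cubical polytope the facets are ordered along a generic line through
an interior point, as in the theorem of Bruggesser and Mani (`cubicalHPoly_boundary_nonneg`); the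
condition on antipodes says that the set of facets of a combinatorial cube that are visible from a
point is antipodally closed only if it is empty (`eq_empty_of_visible`). Passing from the boundary
complex to the polytope adds a cone point to the barycentric subdivision, which leaves the
`h`-polynomial unchanged (`hPoly_sd_insert`).
-/

noncomputable section

namespace CubicalSubdivision

open Polynomial

/-! ### Interlacing families, expressed by Wronskians -/

/-- At the point `x`, the polynomials `f 0, …, f (N - 1)` have the pairwise Wronskian signs of an
interlacing sequence: each `f j` is ahead of `f i` and behind `X * f i` for `i ≤ j`. -/
def WronskianChain (f : ℕ → ℝ[X]) (N : ℕ) (x : ℝ) : Prop :=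
  ∀ i j, i ≤ j → j < N →
    0 ≤ (wronskian (f i) (f j)).eval x ∧ 0 ≤ (wronskian (f j) (X * f i)).eval x

/-- The sum of `f 0, …, f (N - 1)` in which the first `k` terms are multiplied by `X`. -/
def sweep (f : ℕ → ℝ[X]) (N k : ℕ) : ℝ[X] :=
  X * ∑ i ∈ Finset.range k, f i + ∑ i ∈ Finset.Ico k N, f i

theorem wronskian_sum_sum (f : ℕ → ℝ[X]) (s t : Finset ℕ) (g : ℝ[X]) :
    wronskian (∑ i ∈ s, f i) (g * ∑ j ∈ t, f j)
      = ∑ i ∈ s, ∑ j ∈ t, wronskian (f i) (g * f j) := by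
  rw [Finset.mul_sum]
  simp only [← wronskianBilin_apply, map_sum, LinearMap.sum_apply]
  rw [Finset.sum_comm]

theorem WronskianChain.sum_sum {f : ℕ → ℝ[X]} {N : ℕ} {x : ℝ} (h : WronskianChain f N x)
    {s t : Finset ℕ} (hst : ∀ i ∈ s, ∀ j ∈ t, i ≤ j) (ht : ∀ j ∈ t, j < N) :
    0 ≤ (wronskian (∑ i ∈ s, f i) (∑ j ∈ t, f j)).eval x ∧
      0 ≤ (wronskian (∑ j ∈ t, f j) (X * ∑ i ∈ s, f i)).eval x := by
  constructor
  · have := wronskian_sum_sum f s t 1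
    simp only [one_mul] at this
    rw [this, eval_finsetSum]
    refine Finset.sum_nonneg fun i hi => ?_
    rw [eval_finsetSum]
    exact Finset.sum_nonneg fun j hj => (h i j (hst i hi j hj) (ht j hj)).1
  · rw [wronskian_sum_sum, eval_finsetSum]
    refine Finset.sum_nonneg fun j hj => ?_
    rw [eval_finsetSum]
    exact Finset.sum_nonneg fun i hi => (h i j (hst i hi j hj) (ht j hj)).2

theorem sweep_split (f : ℕ → ℝ[X]) {N k l : ℕ} (hkl : k ≤ l) (hl : l ≤ N) :
    sweep f N k = X * ∑ i ∈ Finset.range k, f i + ∑ i ∈ Finset.Ico k l, f i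
        + ∑ i ∈ Finset.Ico l N, f i ∧
    sweep f N l = X * ∑ i ∈ Finset.range k, f i + X * ∑ i ∈ Finset.Ico k l, f i
        + ∑ i ∈ Finset.Ico l N, f i := by
  constructor
  · rw [sweep, add_assoc, Finset.sum_Ico_consecutive _ hkl hl]
  · rw [sweep, ← Finset.sum_range_add_sum_Ico _ hkl, mul_add]

/-- Sweeping preserves the Wronskian signs. With the sum split at `k` and `l` into `a + b + c`, the
new Wronskians are sums of squares and of old ones with nonnegative factors. -/
theorem wronskianChain_sweep {f : ℕ → ℝ[X]} {N : ℕ} {x : ℝ} (h : WronskianChain f N x) :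
    WronskianChain (sweep f N) (N + 1) x := by
  intro k l hkl hl
  obtain ⟨e1, e2⟩ := sweep_split f hkl (Nat.lt_succ_iff.1 hl)
  rw [e1, e2]
  obtain ⟨h1, h2⟩ := h.sum_sum (s := Finset.range k) (t := Finset.Ico k l)
    (by intro i hi j hj; simp at hi hj; omega) (by intro j hj; simp at hj; omega)
  obtain ⟨h3, h4⟩ := h.sum_sum (s := Finset.range k) (t := Finset.Ico l N)
    (by intro i hi j hj; simp at hi hj; omega) (by intro j hj; simp at hj; omega)
  obtain ⟨h5, h6⟩ := h.sum_sum (s := Finset.Ico k l) (t := Finset.Ico l N)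
    (by intro i hi j hj; simp at hi hj; omega) (by intro j hj; simp at hj; omega)
  generalize ∑ i ∈ Finset.range k, f i = a at *
  generalize ∑ i ∈ Finset.Ico k l, f i = b at *
  generalize ∑ i ∈ Finset.Ico l N, f i = c at *
  constructor
  · have key : wronskian (X * a + b + c) (X * a + X * b + c) = X ^ 2 * wronskian a b
        + wronskian b (X * a) + b ^ 2 + wronskian b c + wronskian c (X * b) := by
      simp only [wronskian, derivative_add, derivative_mul, derivative_X]; ring
    rw [key]
    simp only [eval_add, eval_mul, eval_pow, eval_X]
    have h7 := mul_nonneg (sq_nonneg x) h1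
    have h8 := sq_nonneg (eval x b)
    linarith
  · have key : wronskian (X * a + X * b + c) (X * (X * a + b + c)) = (X * a + c) ^ 2
        + X ^ 2 * (wronskian a b + wronskian b (X * a) + wronskian b c)
        + wronskian c (X * b) := by
      simp only [wronskian, derivative_add, derivative_mul, derivative_X]; ring
    rw [key]
    simp only [eval_add, eval_mul, eval_pow, eval_X]
    have h7 : 0 ≤ (x * eval x a + eval x c) ^ 2 := sq_nonneg _
    have h8 := mul_nonneg (sq_nonneg x) (add_nonneg (add_nonneg h1 h2) h5)
    linarith

/-- The basic polynomials, for `0 ≤ k ≤ n + 1`: the `h`-polynomial of the barycentric subdivision of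
an `n`-dimensional cubical complex is their combination with the entries of the cubical `h`-vector
as coefficients. The factor `2` at the interior indices matches the normalisation of the cubical
`h`-vector. -/
def cubeBasis : ℕ → ℕ → ℝ[X]
  | 0, k => X ^ k
  | n + 1, k => C (if k = 0 ∨ k = n + 2 then 1 else 2) * sweep (cubeBasis n) (n + 2) k

theorem cubeBasis_zero (n : ℕ) :
    cubeBasis (n + 1) 0 = ∑ i ∈ Finset.range (n + 2), cubeBasis n i := by
  simp [cubeBasis, sweep]

theorem cubeBasis_last (n : ℕ) : cubeBasis n (n + 1) = X * cubeBasis n 0 := by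
  cases n with
  | zero => simp [cubeBasis]
  | succ n => rw [cubeBasis_zero]; simp [cubeBasis, sweep]

theorem wronskian_C_mul_C_mul (a b : ℝ) (f g : ℝ[X]) :
    wronskian (C a * f) (C b * g) = C (a * b) * wronskian f g := by
  simp only [wronskian, derivative_mul, derivative_C, C_mul]; ring

theorem wronskianChain_cubeBasis (n : ℕ) (x : ℝ) : WronskianChain (cubeBasis n) (n + 2) x := by
  induction n with
  | zero =>
    intro i j hij hj
    obtain ⟨rfl, rfl⟩ | ⟨rfl, rfl⟩ | ⟨rfl, rfl⟩ :
        (i = 0 ∧ j = 0) ∨ (i = 0 ∧ j = 1) ∨ (i = 1 ∧ j = 1) := by omega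
    · simp [cubeBasis, wronskian]
    · simp [cubeBasis, wronskian]
    · simp [cubeBasis, wronskian]; nlinarith [sq_nonneg x]
  | succ n ih =>
    intro i j hij hj
    have hw : ∀ k, (0 : ℝ) ≤ if k = 0 ∨ k = n + 2 then 1 else 2 := by
      intro k; split_ifs <;> norm_num
    obtain ⟨h1, h2⟩ := wronskianChain_sweep ih i j hij hj
    have hX : ∀ (a : ℝ) (f : ℝ[X]), X * (C a * f) = C a * (X * f) := by intros; ring
    simp only [cubeBasis, hX, wronskian_C_mul_C_mul, eval_mul, eval_C]
    exact ⟨mul_nonneg (mul_nonneg (hw _) (hw _)) h1, mul_nonneg (mul_nonneg (hw _) (hw _)) h2⟩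

/-- Strict version of `wronskianChain_sweep` for the first polynomial of an interlacing family
`f 0, …, f (n + 1)` with `f (n + 1) = X * f 0`. -/
theorem wronskian_sweep_pos {f : ℕ → ℝ[X]} {n : ℕ} {x : ℝ} (h : WronskianChain f (n + 2) x)
    (hx : x < 0) (hn : n ≠ 0) (hlast : f (n + 1) = X * f 0)
    (hpos : ∀ k, 1 ≤ k → k ≤ n → 0 < (wronskian (f 0) (f k)).eval x)
    {l : ℕ} (hl : 1 ≤ l) (hln : l ≤ n + 1) :
    0 < (wronskian (sweep f (n + 2) 0) (sweep f (n + 2) l)).eval x := by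
  obtain ⟨e1, e2⟩ := sweep_split f (Nat.zero_le l) (show l ≤ n + 2 by omega)
  rw [e1, e2]
  obtain ⟨h5, h6⟩ := h.sum_sum (s := Finset.Ico 0 l) (t := Finset.Ico l (n + 2))
    (by intro i hi j hj; simp at hi hj; omega) (by intro j hj; simp at hj; omega)
  obtain ⟨h7, -⟩ := h.sum_sum (s := Finset.Ico 1 l) (t := Finset.Ico l (n + 1))
    (by intro i hi j hj; simp at hi hj; omega) (by intro j hj; simp at hj; omega)
  have hsum : ∀ s : Finset ℕ, (∀ i ∈ s, 1 ≤ i ∧ i ≤ n) → s.Nonempty →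
      0 < (wronskian (f 0) (∑ i ∈ s, f i)).eval x := by
    intro s hs hne
    have := wronskian_sum_sum f {0} s 1
    simp only [one_mul, Finset.sum_singleton] at this
    rw [this, eval_finsetSum]
    exact Finset.sum_pos (fun i hi => hpos i (hs i hi).1 (hs i hi).2) hne
  have hb1 : 2 ≤ l → 0 < (wronskian (f 0) (∑ i ∈ Finset.Ico 1 l, f i)).eval x := fun h2 =>
    hsum _ (by intro i hi; simp at hi; omega) (Finset.nonempty_Ico.2 (by omega))
  have hc1 : l ≤ n → 0 < (wronskian (f 0) (∑ i ∈ Finset.Ico l (n + 1), f i)).eval x := fun h2 =>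
    hsum _ (by intro i hi; simp at hi; omega) (Finset.nonempty_Ico.2 (by omega))
  have hc1' : 0 ≤ (wronskian (f 0) (∑ i ∈ Finset.Ico l (n + 1), f i)).eval x := by
    rcases Nat.lt_or_ge n l with h | h
    · have : l = n + 1 := by omega
      simp [this]
    · exact (hc1 h).le
  have hb : ∑ i ∈ Finset.Ico 0 l, f i = f 0 + ∑ i ∈ Finset.Ico 1 l, f i := by
    rw [Finset.sum_eq_sum_Ico_succ_bot (by omega)]
  have hc : ∑ i ∈ Finset.Ico l (n + 2), f i = ∑ i ∈ Finset.Ico l (n + 1), f i + X * f 0 := by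
    rw [Finset.sum_Ico_succ_top (by omega), hlast]
  have hb1z : l = 1 → (∑ i ∈ Finset.Ico 1 l, f i).eval x = 0 ∧
      (derivative (∑ i ∈ Finset.Ico 1 l, f i)).eval x = 0 := by rintro rfl; simp
  generalize ∑ i ∈ Finset.Ico 1 l, f i = b₁ at *
  generalize ∑ i ∈ Finset.Ico l (n + 1), f i = c₁ at *
  generalize ∑ i ∈ Finset.Ico 0 l, f i = b at *
  generalize ∑ i ∈ Finset.Ico l (n + 2), f i = c at *
  have key : wronskian (X * ∑ i ∈ Finset.range 0, f i + b + c)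
      (X * ∑ i ∈ Finset.range 0, f i + X * b + c)
      = b ^ 2 + wronskian b c + wronskian c (X * b) := by
    simp only [wronskian, derivative_add, derivative_mul, derivative_X, Finset.range_zero,
      Finset.sum_empty, mul_zero, zero_add]; ring
  rw [key]
  simp only [eval_add, eval_pow]
  by_cases hb0 : b.eval x = 0
  swap
  · have : 0 < eval x b ^ 2 := by positivity
    linarith
  subst hb hc
  simp only [wronskian, derivative_add, derivative_mul, derivative_X, eval_sub, eval_mul,
    eval_add, eval_X, eval_one] at *
  generalize eval x (derivative (f 0)) = p' at *
  generalize eval x (f 0) = p at *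
  generalize eval x (derivative b₁) = b' at *
  generalize eval x (derivative c₁) = c' at *
  -- The claim is that neither `c` nor the derivative of `b` vanishes at the zero `x` of `b`.
  suffices hne : (p' + b') * (eval x c₁ + x * p) ≠ 0 by
    have e : (p + eval x b₁) ^ 2 + ((p + eval x b₁) * (c' + (1 * p + x * p')) -
        (p' + b') * (eval x c₁ + x * p)) + ((eval x c₁ + x * p) * (1 * (p + eval x b₁) +
        x * (p' + b')) - (c' + (1 * p + x * p')) * (x * (p + eval x b₁)))
        = (1 - x) * (-((p' + b') * (eval x c₁ + x * p))) := by
      rw [hb0]; ring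
    rw [e]
    rw [hb0] at h5
    refine mul_pos (by linarith) (lt_of_le_of_ne (by linarith) ?_)
    intro h0; exact hne (by linarith)
  rcases Nat.lt_or_ge 1 l with hl2 | hl2
  · have hb1 := hb1 hl2
    have hb1v : eval x b₁ = -p := by linarith
    rw [hb1v] at hb1 h7
    have hp : p * (p' + b') > 0 := by linarith
    refine mul_ne_zero (fun h0 => by rw [h0] at hp; simp at hp) fun h0 => ?_
    have hc1v : eval x c₁ = -(x * p) := by linarith
    rw [hc1v] at h7 hc1'
    nlinarith
  · have : l = 1 := by omega
    obtain ⟨hbz, hbz'⟩ := hb1z this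
    have h0 : p = 0 := by linarith
    have hc := hc1 (by omega)
    rw [h0] at hc ⊢
    rw [hbz']
    intro h1
    rcases mul_eq_zero.1 h1 with h2 | h2
    · have : p' = 0 := by linarith
      rw [this] at hc; linarith
    · have : eval x c₁ = 0 := by linarith
      rw [this] at hc; linarith

theorem wronskian_cubeBasis_pos (n : ℕ) {x : ℝ} (hx : x < 0) {k : ℕ} (hk : 1 ≤ k) (hkn : k ≤ n) :
    0 < (wronskian (cubeBasis n 0) (cubeBasis n k)).eval x := by
  induction n generalizing k with
  | zero => omega
  | succ n ih =>
    have hw : ∀ k, (0 : ℝ) < if k = 0 ∨ k = n + 2 then 1 else 2 := by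
      intro k; split_ifs <;> norm_num
    rw [cubeBasis, cubeBasis, wronskian_C_mul_C_mul, eval_mul, eval_C]
    refine mul_pos (mul_pos (hw _) (hw _)) ?_
    rcases Nat.eq_zero_or_pos n with rfl | hn
    · have : k = 1 := by omega
      subst this
      simp [sweep, cubeBasis, wronskian, Finset.sum_range_succ]
      linarith
    · exact wronskian_sweep_pos (wronskianChain_cubeBasis n x) hx hn.ne' (cubeBasis_last n)
        (fun k h1 h2 => ih h1 h2) hk hkn

theorem natDegree_cubeBasis_le (n k : ℕ) (hk : k ≤ n) : (cubeBasis n k).natDegree ≤ n := by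
  induction n generalizing k with
  | zero => obtain rfl : k = 0 := by omega
            simp [cubeBasis]
  | succ n ih =>
    rw [cubeBasis]
    refine (natDegree_C_mul_le _ _).trans (natDegree_add_le_of_degree_le ?_ ?_)
    · refine natDegree_mul_le.trans ?_
      have : (∑ i ∈ Finset.range k, cubeBasis n i).natDegree ≤ n :=
        natDegree_sum_le_of_forall_le _ _ fun i hi => ih i (by simp at hi; omega)
      simp only [natDegree_X]; omega
    · refine natDegree_sum_le_of_forall_le _ _ fun i hi => ?_
      simp only [Finset.mem_Ico] at hi
      rcases Nat.lt_or_ge n i with h | h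
      · obtain rfl : i = n + 1 := by omega
        rw [cubeBasis_last]
        refine natDegree_mul_le.trans ?_
        have := ih 0 (Nat.zero_le _)
        simp only [natDegree_X]; omega
      · exact (ih i h).trans (Nat.le_succ n)

theorem coeff_cubeBasis_nonneg (n k j : ℕ) : 0 ≤ (cubeBasis n k).coeff j := by
  induction n generalizing k j with
  | zero => simp [cubeBasis, coeff_X_pow]; split_ifs <;> norm_num
  | succ n ih =>
    rw [cubeBasis, coeff_C_mul]
    refine mul_nonneg (by split_ifs <;> norm_num) ?_
    rw [sweep, coeff_add, finsetSum_coeff]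
    refine add_nonneg ?_ (Finset.sum_nonneg fun i _ => ih i j)
    cases j with
    | zero => simp
    | succ j =>
      rw [coeff_X_mul, finsetSum_coeff]
      exact Finset.sum_nonneg fun i _ => ih i j

theorem coeff_zero_cubeBasis (n k : ℕ) (hk : k ≤ n + 1) :
    (cubeBasis n k).coeff 0 = if k = 0 then 1 else 0 := by
  induction n generalizing k with
  | zero => simp [cubeBasis, coeff_X_pow, eq_comm]
  | succ n ih =>
    rw [cubeBasis, coeff_C_mul, sweep, coeff_add, coeff_X_mul_zero, finsetSum_coeff, zero_add,
      Finset.sum_congr rfl fun i hi => ih i (by simp at hi; omega)]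
    simp only [Finset.sum_ite_eq', Finset.mem_Ico]
    split_ifs <;> first | omega | simp_all

theorem coeff_cubeBasis_self (n : ℕ) : (cubeBasis n 0).coeff n = 1 := by
  induction n with
  | zero => simp [cubeBasis]
  | succ n ih =>
    rw [cubeBasis_zero, Finset.sum_range_succ, cubeBasis_last, coeff_add, coeff_X_mul, ih,
      finsetSum_coeff, Finset.sum_eq_zero, zero_add]
    intro i hi
    exact coeff_eq_zero_of_natDegree_lt
      ((natDegree_cubeBasis_le n i (by simp at hi; omega)).trans_lt (Nat.lt_succ_self n))

/-! ### Interlacing from sign changes -/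

/-- The polynomial `p` has degree `n` and positive leading coefficient, and its roots are the
negative numbers `α 0 > α 1 > … > α (n - 1)`. -/
structure HasNegRoots (p : ℝ[X]) (n : ℕ) (α : ℕ → ℝ) : Prop where
  natDegree_eq : p.natDegree = n
  leadingCoeff_pos : 0 < p.leadingCoeff
  roots_eq : p.roots = Multiset.map (fun i : Fin n => α i) Finset.univ.val
  lt : ∀ i, i + 1 < n → α (i + 1) < α i
  neg : ∀ i, i < n → α i < 0

theorem realRooted_of_card_roots {p : ℝ[X]} (h : p.roots.card = p.natDegree) : RealRooted p := by
  by_cases hp : p = 0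
  · exact Or.inl hp
  right
  intro z hz
  rw [← C_leadingCoeff_mul_prod_multiset_X_sub_C h, map_mul, map_multiset_prod, mul_eq_zero,
    Multiset.prod_eq_zero_iff] at hz
  rcases hz with hz | hz
  · simp [hp] at hz
  · simp only [Multiset.map_map, Multiset.mem_map, Function.comp_apply] at hz
    obtain ⟨a, -, ha⟩ := hz
    have : z = (a : ℂ) := by
      rw [map_sub, aeval_X, aeval_C, sub_eq_zero] at ha
      exact ha
    rw [this]; exact Complex.ofReal_im a

theorem roots_eq_of_injective {p : ℝ[X]} (hp : p ≠ 0) {n : ℕ} (hn : p.natDegree = n)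
    (α : Fin n → ℝ) (hα : Function.Injective α) (hr : ∀ i, p.eval (α i) = 0) :
    p.roots = Multiset.map α Finset.univ.val := by
  symm
  refine Multiset.eq_of_le_of_card_le ?_ ?_
  · rw [Multiset.le_iff_subset (Multiset.Nodup.map hα Finset.univ.nodup)]
    intro x hx
    obtain ⟨i, -, rfl⟩ := Multiset.mem_map.1 hx
    exact (mem_roots hp).2 (hr i)
  · simpa [hn] using card_roots' p

theorem HasNegRoots.card_roots {p : ℝ[X]} {n : ℕ} {α : ℕ → ℝ} (h : HasNegRoots p n α) :
    p.roots.card = p.natDegree := by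
  rw [h.roots_eq, h.natDegree_eq]; simp

theorem HasNegRoots.eq_prod {p : ℝ[X]} {n : ℕ} {α : ℕ → ℝ} (h : HasNegRoots p n α) :
    p = C p.leadingCoeff * ∏ i ∈ Finset.range n, (X - C (α i)) := by
  conv_lhs => rw [← C_leadingCoeff_mul_prod_multiset_X_sub_C h.card_roots, h.roots_eq]
  rw [Multiset.map_map, Finset.prod_range]
  rfl

theorem HasNegRoots.eval_eq_zero {p : ℝ[X]} {n : ℕ} {α : ℕ → ℝ} (h : HasNegRoots p n α) {i : ℕ}
    (hi : i < n) : p.eval (α i) = 0 := by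
  rw [h.eq_prod, eval_mul, eval_prod, Finset.prod_eq_zero (Finset.mem_range.2 hi) (by simp),
    mul_zero]

theorem HasNegRoots.lt_of_lt {p : ℝ[X]} {n : ℕ} {α : ℕ → ℝ} (h : HasNegRoots p n α) {i j : ℕ}
    (hij : i < j) (hj : j < n) : α j < α i := by
  induction j, hij using Nat.le_induction with
  | base => exact h.lt i hj
  | succ j hij ih => exact (h.lt j hj).trans (ih (by omega))

theorem HasNegRoots.sign_derivative {p : ℝ[X]} {n : ℕ} {α : ℕ → ℝ} (h : HasNegRoots p n α) {i : ℕ}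
    (hi : i < n) : 0 < (-1) ^ i * (derivative p).eval (α i) := by
  have e : p = (X - C (α i)) * (C p.leadingCoeff * ((∏ j ∈ Finset.range i, (X - C (α j))) *
      ∏ j ∈ Finset.Ico (i + 1) n, (X - C (α j)))) := by
    conv_lhs => rw [h.eq_prod, ← Finset.prod_range_mul_prod_Ico _ hi, Finset.prod_range_succ]
    ring
  rw [e]
  simp only [derivative_mul, derivative_sub, derivative_X, derivative_C, eval_add, eval_mul,
    eval_sub, eval_X, eval_C, eval_zero, sub_zero, one_mul, sub_self, zero_mul, add_zero, eval_prod]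
  have h1 : ∏ j ∈ Finset.range i, (α i - α j) = (-1) ^ i * ∏ j ∈ Finset.range i, (α j - α i) := by
    have := Finset.prod_const (s := Finset.range i) (-1 : ℝ)
    rw [Finset.card_range] at this
    rw [← this, ← Finset.prod_mul_distrib]
    exact Finset.prod_congr rfl fun _ _ => by ring
  have h2 : 0 < ∏ j ∈ Finset.range i, (α j - α i) := Finset.prod_pos fun j hj =>
    sub_pos.2 (h.lt_of_lt (Finset.mem_range.1 hj) hi)
  have h3 : 0 < ∏ j ∈ Finset.Ico (i + 1) n, (α i - α j) := Finset.prod_pos fun j hj => by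
    rw [Finset.mem_Ico] at hj
    exact sub_pos.2 (h.lt_of_lt hj.1 hj.2)
  have h4 : ((-1 : ℝ) ^ i) * (-1) ^ i = 1 := by rw [← mul_pow]; norm_num
  rw [h1]
  have h5 := mul_pos h.leadingCoeff_pos (mul_pos h2 h3)
  generalize ((-1 : ℝ)) ^ i = e at *
  refine h5.trans_eq ?_
  linear_combination (-(p.leadingCoeff * ((∏ j ∈ Finset.range i, (α j - α i)) *
        ∏ j ∈ Finset.Ico (i + 1) n, (α i - α j)))) * h4

/-- A polynomial whose sign at `y` differs from its sign at `-∞` has a root below `y`. -/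
theorem exists_root_lt {q : ℝ[X]} {s : ℕ} (hs : q.natDegree = s) (hs0 : s ≠ 0)
    (hq : 0 < q.leadingCoeff) {y : ℝ} (hy : (-1) ^ s * q.eval y < 0) :
    ∃ r < y, q.eval r = 0 := by
  have ht : Filter.Tendsto (fun x => ((-1) ^ s * q.comp (-X)).eval x) Filter.atTop
      Filter.atTop := by
    have hdeg : (q.comp (-X)).natDegree = s := by rw [natDegree_comp]; simp [hs]
    have hlc : (q.comp (-X)).leadingCoeff = q.leadingCoeff * (-1) ^ s := by
      rw [leadingCoeff_comp (by simp)]; simp [hs]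
    have h1 : ((-1 : ℝ[X]) ^ s * q.comp (-X)) = C ((-1) ^ s) * q.comp (-X) := by simp
    have h4 : ((-1 : ℝ) ^ s) * (-1) ^ s = 1 := by rw [← mul_pow]; norm_num
    rw [h1]
    refine tendsto_atTop_of_leadingCoeff_nonneg _ ?_ ?_
    · rw [degree_C_mul (by simp), ← natDegree_pos_iff_degree_pos, hdeg]; omega
    · rw [leadingCoeff_mul, leadingCoeff_C, hlc]
      nlinarith
  obtain ⟨w, hw1, hw2⟩ := ((Filter.tendsto_atTop.1 ht 1).and
    (Filter.eventually_gt_atTop (-y))).exists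
  have hw3 : 0 < (-1) ^ s * q.eval (-w) := by
    have : (1 : ℝ) ≤ (-1) ^ s * q.eval (-w) := by simpa using hw1
    linarith
  obtain ⟨r, hr, hr0⟩ := intermediate_value_Ioo' (f := fun x => (-1) ^ s * q.eval x)
    (show -w ≤ y by linarith) (by fun_prop) ⟨hy, hw3⟩
  exact ⟨r, hr.2, by simpa using hr0⟩

/-- A polynomial that alternates in sign at `0` and at the roots of `p` has a root in each of the
intervals between these points. -/
theorem HasNegRoots.exists_interlacing {p q : ℝ[X]} {n s : ℕ} {α : ℕ → ℝ}
    (h : HasNegRoots p n α) (hs : q.natDegree = s) (hsn : s = n ∨ s = n + 1)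
    (hlc : 0 < q.leadingCoeff) (h0 : 0 < q.eval 0)
    (hsign : ∀ i < n, (-1) ^ i * q.eval (α i) < 0) :
    ∃ β : ℕ → ℝ, HasNegRoots q s β ∧ (∀ i < n, α i ≤ β i) ∧
      ∀ i < n, i + 1 < s → β (i + 1) ≤ α i := by
  set γ : ℕ → ℝ := fun i => match i with
    | 0 => 0
    | i + 1 => α i with hγ
  have hγs : ∀ i ≤ n, 0 < (-1) ^ i * q.eval (γ i) := by
    intro i hi
    cases i with
    | zero => simpa [hγ] using h0
    | succ i =>
      have := hsign i hi
      simp only [hγ, pow_succ]; linarith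
  have hγlt : ∀ i < n, γ (i + 1) < γ i := by
    intro i hi
    cases i with
    | zero => exact h.neg 0 hi
    | succ i => exact h.lt i hi
  have hex : ∀ i, ∃ r, i < s → q.eval r = 0 ∧ r < γ i ∧ (i < n → γ (i + 1) < r) := by
    intro i
    by_cases his : i < s
    swap
    · exact ⟨0, fun h => absurd h his⟩
    rcases Nat.lt_or_ge i n with hi | hi
    · have h1 := hγs i hi.le
      have h2 := hγs (i + 1) hi
      obtain ⟨r, hr, hr0⟩ := intermediate_value_Ioo (f := fun x => (-1) ^ i * q.eval x)
        (hγlt i hi).le (by fun_prop)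
        (show (0 : ℝ) ∈ Set.Ioo ((-1) ^ i * q.eval (γ (i + 1))) ((-1) ^ i * q.eval (γ i)) from
          ⟨by rw [pow_succ] at h2; linarith, h1⟩)
      exact ⟨r, fun _ => ⟨by simpa using hr0, hr.2, fun _ => hr.1⟩⟩
    · have hin : i = n := by omega
      have hsn : s = n + 1 := by omega
      subst hin hsn
      have h1 := hγs i le_rfl
      obtain ⟨r, hr, hr0⟩ := exists_root_lt hs (by omega) hlc (y := γ i)
        (by rw [pow_succ]; linarith)
      exact ⟨r, fun _ => ⟨hr0, hr, fun h => by omega⟩⟩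
  choose β hβ using hex
  have hlt : ∀ i, i + 1 < s → β (i + 1) < β i := fun i hi =>
    (hβ (i + 1) hi).2.1.trans ((hβ i (by omega)).2.2 (by omega))
  have hanti : ∀ i j, i < j → j < s → β j < β i := by
    intro i j hij hj
    induction j, hij using Nat.le_induction with
    | base => exact hlt i hj
    | succ j hij ih => exact (hlt j hj).trans (ih (by omega))
  have hq : q ≠ 0 := by rintro rfl; simp at hlc
  refine ⟨β, ⟨hs, hlc, ?_, hlt, ?_⟩, ?_, ?_⟩
  · refine roots_eq_of_injective hq hs _ ?_ fun i => (hβ i i.2).1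
    intro i j hij
    rcases lt_trichotomy i j with h | h | h
    · exact absurd hij (hanti i j h j.2).ne'
    · exact h
    · exact absurd hij (hanti j i h i.2).ne
  · intro i hi
    cases i with
    | zero => exact (hβ 0 hi).2.1
    | succ i =>
      exact (hβ (i + 1) hi).2.1.trans (h.neg i (by omega))
  · intro i hi
    exact ((hβ i (by omega)).2.2 hi).le
  · intro i hi hi'
    exact (hβ (i + 1) hi').2.1.le

theorem HasNegRoots.interlaces {p q : ℝ[X]} {n s : ℕ} {α : ℕ → ℝ}
    (h : HasNegRoots p n α) (hs : q.natDegree = s) (hsn : s = n ∨ s = n + 1)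
    (hlc : 0 < q.leadingCoeff) (h0 : 0 < q.eval 0)
    (hsign : ∀ i < n, (-1) ^ i * q.eval (α i) < 0) : Interlaces p q := by
  obtain ⟨β, hβ, h1, h2⟩ := h.exists_interlacing hs hsn hlc h0 hsign
  refine ⟨realRooted_of_card_roots h.card_roots, realRooted_of_card_roots hβ.card_roots, n, s,
    fun i => α i, fun i => β i, h.roots_eq.symm, hβ.roots_eq.symm, hsn, ?_, ?_, ?_⟩
  · intro i j hij; simp only [hij]; exact h1 i i.2
  · intro i j hij; simp only [hij]; exact h2 i i.2 (hij ▸ j.2)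
  · intro j; exact (hβ.neg j j.2).le

theorem HasNegRoots.interlaces_self {p : ℝ[X]} {n : ℕ} {α : ℕ → ℝ} (h : HasNegRoots p n α) :
    Interlaces p p := by
  have hr := realRooted_of_card_roots h.card_roots
  refine ⟨hr, hr, n, n, fun i => α i, fun i => α i, h.roots_eq.symm, h.roots_eq.symm, Or.inl rfl,
    ?_, ?_, ?_⟩
  · intro i j hij; simp only [hij, le_refl]
  · intro i j hij; exact (h.lt_of_lt (by omega) j.2).le
  · intro j; exact (h.neg j j.2).le

/-- Inserting a further negative root `r` into `p` gives a polynomial interlaced by `p`. -/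
theorem HasNegRoots.interlaces_mul {p : ℝ[X]} {n : ℕ} {α : ℕ → ℝ} (h : HasNegRoots p n α)
    {r c : ℝ} (hr : r < 0) (hc : c ≠ 0) : Interlaces p (C c * (X - C r) * p) := by
  have hp : p ≠ 0 := by rintro rfl; simpa using h.leadingCoeff_pos
  have hX : C c * (X - C r) ≠ 0 := mul_ne_zero (by simpa using hc) (X_sub_C_ne_zero r)
  have hroots : (C c * (X - C r) * p).roots = r ::ₘ p.roots := by
    rw [roots_mul (mul_ne_zero hX hp), roots_C_mul _ hc, roots_X_sub_C]; rfl
  have hdeg : (C c * (X - C r) * p).natDegree = n + 1 := by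
    rw [natDegree_mul hX hp, natDegree_C_mul hc, natDegree_X_sub_C, h.natDegree_eq, add_comm]
  -- `t` is the position of `r` in the list of the roots of `p`.
  have hex : ∃ t, t = n ∨ α t ≤ r := ⟨n, Or.inl rfl⟩
  classical
  obtain ⟨t, htn, ht, htmin⟩ : ∃ t, t ≤ n ∧ (t = n ∨ α t ≤ r) ∧ ∀ i < t, r < α i :=
    ⟨Nat.find hex, Nat.find_min' hex (Or.inl rfl), Nat.find_spec hex, fun i hi => by
      have := Nat.find_min hex hi
      push Not at this
      exact this.2⟩
  let β : Fin (n + 1) → ℝ := fun j =>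
    if (j : ℕ) < t then α j else if (j : ℕ) = t then r else α (j - 1)
  have hβt : β ⟨t, by omega⟩ = r := by simp [β]
  have hβs : ∀ i : Fin n, β (Fin.succAbove ⟨t, by omega⟩ i) = α i := by
    intro i
    rcases Nat.lt_or_ge i t with hi | hi
    · rw [Fin.succAbove_of_castSucc_lt _ _ (by simpa [Fin.lt_def] using hi)]
      simp [β, hi]
    · rw [Fin.succAbove_of_le_castSucc _ _ (by simpa [Fin.le_def] using hi)]
      simp only [β, Fin.val_succ]
      rw [if_neg (by omega), if_neg (by omega)]; simp
  have hmap : Multiset.map β Finset.univ.val = (C c * (X - C r) * p).roots := by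
    rw [hroots, h.roots_eq, Fin.univ_succAbove n ⟨t, by omega⟩, Finset.cons_val, Multiset.map_cons,
      Finset.map_val, Multiset.map_map, hβt]
    congr 1
    exact Multiset.map_congr rfl fun i _ => hβs i
  refine ⟨realRooted_of_card_roots h.card_roots, realRooted_of_card_roots ?_, n, n + 1,
    fun i => α i, β, h.roots_eq.symm, hmap, Or.inr rfl, ?_, ?_, ?_⟩
  · rw [hdeg, ← hmap]; simp
  · intro i j hij
    simp only [β, hij]
    split_ifs with h1 h2
    · exact le_rfl
    · rw [h2]; exact ht.resolve_left (by omega)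
    · exact (h.lt_of_lt (by omega) i.2).le
  · intro i j hij
    simp only [β, hij]
    split_ifs with h1 h2
    · exact (h.lt_of_lt (by omega) (by omega)).le
    · exact (htmin i (by omega)).le
    · simp
  · intro j
    simp only [β]
    split_ifs with h1 h2
    · exact (h.neg j (by omega)).le
    · exact hr.le
    · exact (h.neg (j - 1) (by omega)).le

/-! ### Nonnegative combinations of the basic polynomials -/

/-- The combination of the polynomials `cubeBasis n k` with the coefficients `h k`. -/
def cubeComb (n : ℕ) (h : ℕ → ℝ) : ℝ[X] :=
  ∑ k ∈ Finset.range (n + 2), C (h k) * cubeBasis n k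

theorem cubeComb_eq_add (n : ℕ) (h : ℕ → ℝ) :
    cubeComb n h = ∑ k ∈ Finset.range (n + 1), C (h k) * cubeBasis n k
      + C (h (n + 1)) * (X * cubeBasis n 0) := by
  rw [cubeComb, Finset.sum_range_succ, cubeBasis_last]

theorem natDegree_cubeComb {n : ℕ} {h : ℕ → ℝ} (h0 : h 0 = 1) (hnn : ∀ k ≤ n + 1, 0 ≤ h k) :
    0 < (cubeComb n h).leadingCoeff ∧
      ((cubeComb n h).natDegree = n ∨ (cubeComb n h).natDegree = n + 1) := by
  have hdeg1 : (∑ k ∈ Finset.range (n + 1), C (h k) * cubeBasis n k).natDegree ≤ n :=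
    natDegree_sum_le_of_forall_le _ _ fun k hk => (natDegree_C_mul_le _ _).trans
      (natDegree_cubeBasis_le n k (by simp at hk; omega))
  have hcn : 0 < (∑ k ∈ Finset.range (n + 1), C (h k) * cubeBasis n k).coeff n := by
    rw [finsetSum_coeff]
    refine Finset.sum_pos' (fun k hk => ?_) ⟨0, by simp, ?_⟩
    · rw [coeff_C_mul]
      exact mul_nonneg (hnn k (by simp at hk; omega)) (coeff_cubeBasis_nonneg n k n)
    · simp [h0, coeff_cubeBasis_self]
  have hc1 : (cubeComb n h).coeff (n + 1) = h (n + 1) := by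
    rw [cubeComb_eq_add, coeff_add, coeff_eq_zero_of_natDegree_lt (by omega), coeff_C_mul,
      coeff_X_mul, coeff_cubeBasis_self]; simp
  rcases (hnn (n + 1) le_rfl).eq_or_lt with hz | hpos
  · have e : cubeComb n h = ∑ k ∈ Finset.range (n + 1), C (h k) * cubeBasis n k := by
      rw [cubeComb_eq_add, ← hz]; simp
    rw [← e] at hdeg1 hcn
    have hd : (cubeComb n h).natDegree = n :=
      le_antisymm hdeg1 (le_natDegree_of_ne_zero hcn.ne')
    exact ⟨by rwa [leadingCoeff, hd], Or.inl hd⟩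
  · have hd : (cubeComb n h).natDegree = n + 1 := by
      refine le_antisymm ?_ (le_natDegree_of_ne_zero (by rw [hc1]; exact hpos.ne'))
      rw [cubeComb_eq_add]
      refine natDegree_add_le_of_degree_le (by omega) ((natDegree_C_mul_le _ _).trans
        (natDegree_mul_le.trans ?_))
      have := natDegree_cubeBasis_le n 0 (Nat.zero_le _)
      simp only [natDegree_X]; omega
    exact ⟨by rwa [leadingCoeff, hd, hc1], Or.inr hd⟩

theorem eval_zero_cubeComb {n : ℕ} {h : ℕ → ℝ} (h0 : h 0 = 1) : (cubeComb n h).eval 0 = 1 := by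
  rw [← coeff_zero_eq_eval_zero, cubeComb, finsetSum_coeff,
    Finset.sum_congr rfl fun k hk => by
      rw [coeff_C_mul, coeff_zero_cubeBasis n k (by simp at hk; omega)]]
  simp [h0]

/-- At a root of `p = cubeBasis n 0` the Wronskian of `p` and `q` is `-p' * q`. As it is positive, the
sign of `q` is opposite to that of `p'`, which alternates. -/
theorem sign_cubeComb {n : ℕ} {α : ℕ → ℝ} (hα : HasNegRoots (cubeBasis n 0) n α) {h : ℕ → ℝ}
    (hnn : ∀ k ≤ n + 1, 0 ≤ h k) (hpos : ∃ k, 1 ≤ k ∧ k ≤ n ∧ 0 < h k) {i : ℕ}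
    (hi : i < n) : (-1) ^ i * (cubeComb n h).eval (α i) < 0 := by
  have hW : 0 < (wronskian (cubeBasis n 0) (cubeComb n h)).eval (α i) := by
    rw [cubeComb, ← wronskianBilin_apply, map_sum, eval_finsetSum]
    have hval : ∀ k, (wronskianBilin ℝ (cubeBasis n 0) (C (h k) * cubeBasis n k)).eval (α i)
        = h k * (wronskian (cubeBasis n 0) (cubeBasis n k)).eval (α i) := by
      intro k
      rw [← smul_eq_C_mul, map_smul, eval_smul, wronskianBilin_apply, smul_eq_mul]
    obtain ⟨k, hk1, hkn, hk⟩ := hpos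
    refine Finset.sum_pos' (fun k hk => ?_) ⟨k, by simp; omega, ?_⟩
    · rw [hval]
      simp only [Finset.mem_range] at hk
      exact mul_nonneg (hnn k (by omega))
        (wronskianChain_cubeBasis n (α i) 0 k (Nat.zero_le _) hk).1
    · rw [hval]
      exact mul_pos hk (wronskian_cubeBasis_pos n (hα.neg i hi) hk1 hkn)
  rw [wronskian, eval_sub, eval_mul, eval_mul, hα.eval_eq_zero hi, zero_mul, zero_sub] at hW
  have hd := hα.sign_derivative hi
  have h4 : ((-1 : ℝ) ^ i) * (-1) ^ i = 1 := by rw [← mul_pow]; norm_num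
  generalize ((-1 : ℝ)) ^ i = e at *
  generalize eval (α i) (cubeComb n h) = u at *
  generalize eval (α i) (derivative (cubeBasis n 0)) = v at *
  have h5 : (e * v) * (e * u) < 0 := by
    have : (e * v) * (e * u) = (e * e) * (v * u) := by ring
    rw [this, h4]; linarith
  by_contra hcon
  push Not at hcon
  have := mul_nonneg hd.le hcon
  linarith

/-- By induction: `cubeBasis (n + 1) 0` is the sum of all `cubeBasis n k`, which is interlaced by
`cubeBasis n 0`. -/
theorem exists_hasNegRoots_cubeBasis (n : ℕ) : ∃ α, HasNegRoots (cubeBasis n 0) n α := by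
  induction n with
  | zero => exact ⟨fun _ => 0, by simp [cubeBasis], by simp [cubeBasis], by simp [cubeBasis],
      by simp, by simp⟩
  | succ n ih =>
    obtain ⟨α, hα⟩ := ih
    have e : cubeBasis (n + 1) 0 = cubeComb n fun _ => 1 := by
      rw [cubeBasis_zero, cubeComb]; simp
    have hnd : (cubeComb n fun _ => 1).natDegree = n + 1 := by
      rw [← e]
      refine le_antisymm (natDegree_cubeBasis_le _ _ (Nat.zero_le _))
        (le_natDegree_of_ne_zero ?_)
      rw [coeff_cubeBasis_self]; norm_num
    rw [e]
    obtain ⟨β, hβ, -⟩ := hα.exists_interlacing hnd (Or.inr rfl)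
      (natDegree_cubeComb rfl fun _ _ => zero_le_one).1
      (by rw [eval_zero_cubeComb rfl]; norm_num)
      fun i hi => sign_cubeComb hα (fun _ _ => zero_le_one)
        ⟨1, le_rfl, by omega, one_pos⟩ hi
    exact ⟨β, hβ⟩

/-- Nonnegative combinations of the `cubeBasis n k` in which the coefficient of `cubeBasis n 0` is
`1` are interlaced by `cubeBasis n 0`. -/
theorem interlaces_cubeComb {n : ℕ} {h : ℕ → ℝ} (h0 : h 0 = 1) (hnn : ∀ k ≤ n + 1, 0 ≤ h k) :
    Interlaces (cubeBasis n 0) (cubeComb n h) := by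
  obtain ⟨α, hα⟩ := exists_hasNegRoots_cubeBasis n
  by_cases hpos : ∃ k, 1 ≤ k ∧ k ≤ n ∧ 0 < h k
  · obtain ⟨h1, h2⟩ := natDegree_cubeComb h0 hnn
    exact hα.interlaces rfl h2 h1 (by rw [eval_zero_cubeComb h0]; norm_num)
      fun i hi => sign_cubeComb hα hnn hpos hi
  · push Not at hpos
    have e : cubeComb n h = cubeBasis n 0 + C (h (n + 1)) * (X * cubeBasis n 0) := by
      rw [cubeComb_eq_add, Finset.sum_eq_single 0]
      · simp [h0]
      · intro k hk hk0
        simp only [Finset.mem_range] at hk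
        have : h k = 0 := le_antisymm (hpos k (by omega) (by omega)) (hnn k (by omega))
        simp [this]
      · simp
    rcases (hnn (n + 1) le_rfl).eq_or_lt with hz | hc
    · rw [e, ← hz]; simpa using hα.interlaces_self
    · have e2 : cubeComb n h = C (h (n + 1)) * (X - C (-(h (n + 1))⁻¹)) * cubeBasis n 0 := by
        rw [e]
        have : C (h (n + 1)) * C (h (n + 1))⁻¹ = (1 : ℝ[X]) := by
          rw [← C_mul, mul_inv_cancel₀ hc.ne', C_1]
        rw [C_neg]
        linear_combination (-cubeBasis n 0) * this
      rw [e2]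
      exact hα.interlaces_mul (by simpa using hc) hc.ne'

/-! ### The power series of the basic polynomials -/

/-- The coefficients of the power series `cubeBasis n k / (1 - x) ^ (n + 1)`. -/
def cubeSeries (n k m : ℕ) : ℝ :=
  if k = 0 then (2 * m + 1) ^ n
  else if k = n + 1 then (if m = 0 then 0 else (2 * m - 1) ^ n)
  else 4 * m * (2 * m - 1) ^ (k - 1) * (2 * m + 1) ^ (n - k)

theorem coeff_one_sub_X_mul (f : ℕ → ℝ) (m : ℕ) :
    PowerSeries.coeff m ((1 - PowerSeries.X) * PowerSeries.mk f)
      = f m - if m = 0 then 0 else f (m - 1) := by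
  rw [sub_mul, one_mul, map_sub, PowerSeries.coeff_mk]
  cases m with
  | zero => simp
  | succ m => simp [PowerSeries.coeff_succ_X_mul]

/-- The coefficients of the sum of all basic series telescope in `m`. -/
theorem sum_cubeSeries (n m : ℕ) : ∑ k ∈ Finset.range (n + 2), cubeSeries n k m =
    (2 * m + 1) ^ (n + 1) - if m = 0 then 0 else (2 * m - 1 : ℝ) ^ (n + 1) := by
  rw [Finset.sum_range_succ, Finset.sum_range_succ']
  have h1 : ∑ k ∈ Finset.range n, cubeSeries n (k + 1) m
      = 4 * m * ∑ k ∈ Finset.range n, (2 * m - 1 : ℝ) ^ k * (2 * m + 1) ^ (n - 1 - k) := by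
    rw [Finset.mul_sum]
    refine Finset.sum_congr rfl fun k hk => ?_
    simp only [Finset.mem_range] at hk
    rw [cubeSeries, if_neg (by omega), if_neg (by omega), Nat.add_sub_cancel, Nat.sub_sub,
      Nat.add_comm 1 k]
    ring
  rw [h1]
  have h2 := (Commute.all (2 * m - 1 : ℝ) (2 * m + 1)).geom_sum₂_mul n
  simp only [cubeSeries, if_true, if_neg (Nat.succ_ne_zero n)]
  split_ifs with h
  · subst h; simp
  · rw [pow_succ, pow_succ]
    linear_combination (-2 * (m : ℝ)) * h2

/-- For fixed `m` the sums over `k` telescope, by `(2 m + 1) - (2 m - 1) = 2`. -/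
theorem sum_cubeSeries_range (n m k : ℕ) (hk : k ≤ n) :
    ∑ i ∈ Finset.range (k + 1), 2 * cubeSeries n i m
      = 2 * (2 * m + 1) ^ (n + 1) - cubeSeries (n + 1) (k + 1) m := by
  induction k with
  | zero =>
    simp only [zero_add, Finset.sum_range_one, cubeSeries, if_true, one_ne_zero, if_false,
      show (1 : ℕ) ≠ n + 2 by omega]
    simp only [Nat.sub_self, Nat.add_sub_cancel]
    ring
  | succ k ih =>
    rw [Finset.sum_range_succ, ih (by omega)]
    simp only [cubeSeries]
    rw [if_neg (by omega), if_neg (by omega), if_neg (by omega), if_neg (by omega),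
      if_neg (by omega), if_neg (by omega)]
    obtain ⟨j, rfl⟩ : ∃ j, n = k + 1 + j := ⟨n - (k + 1), by omega⟩
    rw [show k + 1 + j + 1 - (k + 1) = j + 1 by omega, show k + 1 + j - (k + 1) = j by omega,
      show k + 1 + j + 1 - (k + 1 + 1) = j by omega]
    simp only [Nat.add_sub_cancel]
    ring

theorem coe_sum (s : Finset ℕ) (f : ℕ → ℝ[X]) :
    ((∑ i ∈ s, f i : ℝ[X]) : PowerSeries ℝ) = ∑ i ∈ s, (f i : PowerSeries ℝ) :=
  map_sum (Polynomial.coeToPowerSeries.ringHom (R := ℝ)) f s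

theorem sum_mul_mk (s : Finset ℕ) (c : PowerSeries ℝ) (f : ℕ → ℕ → ℝ) :
    ∑ i ∈ s, c * PowerSeries.mk (f i) = c * PowerSeries.mk (fun m => ∑ i ∈ s, f i m) := by
  rw [← Finset.mul_sum]
  congr 1
  ext m
  simp

theorem sweep_eq (f : ℕ → ℝ[X]) {N k : ℕ} (hk : k ≤ N) :
    sweep f N k = ∑ i ∈ Finset.range N, f i - (1 - X) * ∑ i ∈ Finset.range k, f i := by
  rw [sweep, ← Finset.sum_range_add_sum_Ico _ hk]; ring

theorem coe_cubeBasis (n k : ℕ) (hk : k ≤ n + 1) : (cubeBasis n k : PowerSeries ℝ)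
    = (1 - PowerSeries.X) ^ (n + 1) * PowerSeries.mk (cubeSeries n k) := by
  induction n generalizing k with
  | zero =>
    obtain rfl | rfl : k = 0 ∨ k = 1 := by omega
    · ext m
      rw [zero_add, pow_one, coeff_one_sub_X_mul]
      cases m <;> simp [cubeBasis, cubeSeries, PowerSeries.coeff_one]
    · ext m
      rw [zero_add, pow_one, coeff_one_sub_X_mul]
      rcases m with _ | _ | m <;> simp [cubeBasis, cubeSeries, PowerSeries.coeff_X]
  | succ n ih =>
    have hS : ((∑ i ∈ Finset.range (n + 2), cubeBasis n i : ℝ[X]) : PowerSeries ℝ)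
        = (1 - PowerSeries.X) ^ (n + 2) * PowerSeries.mk (cubeSeries (n + 1) 0) := by
      rw [coe_sum, Finset.sum_congr rfl fun i hi => ih i (by simp at hi; omega), sum_mul_mk,
        pow_succ _ (n + 1), mul_assoc]
      congr 1
      ext m
      rw [PowerSeries.coeff_mk, coeff_one_sub_X_mul, sum_cubeSeries]
      cases m <;> simp [cubeSeries]
      ring
    rcases Nat.eq_zero_or_pos k with rfl | hk0
    · rw [cubeBasis_zero, hS]
    rcases hk.eq_or_lt with rfl | hk1
    · rw [cubeBasis_last, cubeBasis_zero, Polynomial.coe_mul, hS, Polynomial.coe_X,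
        mul_left_comm]
      congr 1
      ext m
      cases m with
      | zero => simp [cubeSeries]
      | succ m =>
        rw [PowerSeries.coeff_succ_X_mul]
        simp [cubeSeries]
        ring
    · obtain ⟨k, rfl⟩ : ∃ j, k = j + 1 := ⟨k - 1, by omega⟩
      rw [cubeBasis, if_neg (by omega), sweep_eq _ (by omega)]
      have h1 : ((∑ i ∈ Finset.range (k + 1), cubeBasis n i : ℝ[X]) : PowerSeries ℝ)
          = (1 - PowerSeries.X) ^ (n + 1)
            * PowerSeries.mk (fun m => ∑ i ∈ Finset.range (k + 1), cubeSeries n i m) := by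
        rw [coe_sum, Finset.sum_congr rfl fun i hi => ih i (by simp at hi; omega), sum_mul_mk]
      rw [Polynomial.coe_mul, Polynomial.coe_sub, hS, Polynomial.coe_mul, h1, Polynomial.coe_sub,
        Polynomial.coe_one, Polynomial.coe_X, Polynomial.coe_C]
      have h2 : (1 - PowerSeries.X) * ((1 - PowerSeries.X) ^ (n + 1)
          * PowerSeries.mk (fun m => ∑ i ∈ Finset.range (k + 1), cubeSeries n i m))
          = (1 - PowerSeries.X) ^ (n + 2)
          * PowerSeries.mk (fun m => ∑ i ∈ Finset.range (k + 1), cubeSeries n i m) := by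
        ring
      rw [h2, ← mul_sub, mul_left_comm]
      congr 1
      ext m
      rw [PowerSeries.coeff_C_mul, map_sub, PowerSeries.coeff_mk, PowerSeries.coeff_mk,
        PowerSeries.coeff_mk]
      have h3 := sum_cubeSeries_range n m k (by omega)
      rw [← Finset.mul_sum] at h3
      have h4 : cubeSeries (n + 1) 0 m = (2 * m + 1) ^ (n + 1) := by simp [cubeSeries]
      rw [h4]
      linarith

/-! ### The Eulerian polynomial of type `B` -/

/-- The signed permutation of `{1, …, n + 1}` obtained from `w` by inserting the value
`± (n + 1)` at position `i`. -/
def insertMax {n : ℕ} (i : Fin (n + 1)) (s : ℤˣ) (w : SignedPerm n) : SignedPerm (n + 1) :=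
  ((finSuccEquiv' i).trans ((Equiv.optionCongr w.1).trans (finSuccEquiv' (Fin.last n)).symm),
    Fin.insertNth i s w.2)

theorem insertMax_fst_self {n : ℕ} (i : Fin (n + 1)) (s : ℤˣ) (w : SignedPerm n) :
    (insertMax i s w).1 i = Fin.last n := by
  simp [insertMax]

theorem insertMax_fst_succAbove {n : ℕ} (i : Fin (n + 1)) (s : ℤˣ) (w : SignedPerm n)
    (j : Fin n) : (insertMax i s w).1 (i.succAbove j) = (w.1 j).castSucc := by
  simp [insertMax]

theorem bijective_insertMax (n : ℕ) : Function.Bijective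
    fun x : (Fin (n + 1) × ℤˣ) × SignedPerm n => insertMax x.1.1 x.1.2 x.2 := by
  rw [Fintype.bijective_iff_injective_and_card]
  constructor
  · rintro ⟨⟨i, s⟩, w⟩ ⟨⟨i', s'⟩, w'⟩ h
    simp only at h
    have hi : i = i' := by
      have h1 := insertMax_fst_self i s w
      rw [h, ← insertMax_fst_self i' s' w'] at h1
      exact (insertMax i' s' w').1.injective h1
    subst hi
    have hw : w.1 = w'.1 := by
      ext j
      have h1 := insertMax_fst_succAbove i s w j
      rw [h, insertMax_fst_succAbove] at h1
      simpa using congrArg Fin.val h1.symm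
    have h2 := congrArg Prod.snd h
    simp only [insertMax] at h2
    have hs : s = s' := by simpa using congrFun h2 i
    have hw2 : w.2 = w'.2 := by
      funext j
      simpa using congrFun h2 (i.succAbove j)
    rw [hs, Prod.ext hw hw2]
  · simp only [SignedPerm, Fintype.card_prod, Fintype.card_fin, Fintype.card_perm, Fintype.card_fun,
      Nat.factorial_succ, pow_succ]
    ring

theorem val_insertMax_of_le {n : ℕ} (i : Fin (n + 1)) (s : ℤˣ) (w : SignedPerm n) {a : ℕ}
    (ha : a ≤ i) : (insertMax i s w).val a = w.val a := by
  cases a with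
  | zero => rfl
  | succ a =>
    have han : a < n := by omega
    have hlt : (⟨a, by omega⟩ : Fin (n + 1)) = i.succAbove ⟨a, han⟩ := by
      rw [Fin.succAbove_of_castSucc_lt _ _ (by rw [Fin.lt_def]; simpa using ha)]
      rfl
    rw [SignedPerm.val, SignedPerm.val, dif_pos (by omega), dif_pos han, hlt,
      insertMax_fst_succAbove]
    simp [insertMax]

theorem val_insertMax_succ_self {n : ℕ} (i : Fin (n + 1)) (s : ℤˣ) (w : SignedPerm n) :
    (insertMax i s w).val (i + 1) = s * (n + 1) := by
  rw [SignedPerm.val, dif_pos i.2]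
  simp [insertMax_fst_self]
  simp [insertMax]

theorem val_insertMax_of_gt {n : ℕ} (i : Fin (n + 1)) (s : ℤˣ) (w : SignedPerm n) {a : ℕ}
    (ha : i < a) (han : a ≤ n) : (insertMax i s w).val (a + 1) = w.val a := by
  obtain ⟨a, rfl⟩ : ∃ b, a = b + 1 := ⟨a - 1, by omega⟩
  have hlt : (⟨a + 1, by omega⟩ : Fin (n + 1)) = i.succAbove ⟨a, by omega⟩ := by
    rw [Fin.succAbove_of_le_castSucc _ _ (by rw [Fin.le_def]; simpa using Nat.lt_succ_iff.1 ha)]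
    rfl
  rw [SignedPerm.val, SignedPerm.val, dif_pos (by omega), dif_pos (by omega), hlt,
    insertMax_fst_succAbove]
  simp [insertMax]

theorem abs_val_lt {n : ℕ} (w : SignedPerm n) (a : ℕ) : |w.val a| < n + 1 := by
  cases a with
  | zero => simp [SignedPerm.val]
  | succ a =>
    rw [SignedPerm.val]
    split_ifs with h
    · rw [abs_mul]
      have : |((w.2 ⟨a, h⟩ : ℤˣ) : ℤ)| = 1 := by
        rcases Int.units_eq_one_or (w.2 ⟨a, h⟩) with h | h <;> simp [h]
      rw [this, one_mul, abs_of_nonneg (by positivity)]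
      have := (w.1 ⟨a, h⟩).2
      omega
    · simp

/-- Whether `a` is a descent of `w`, as a number. -/
def descent {n : ℕ} (w : SignedPerm n) (a : ℕ) : ℕ := if w.val (a + 1) < w.val a then 1 else 0

theorem des_eq_sum {n : ℕ} (w : SignedPerm n) : w.des = ∑ a ∈ Finset.range n, descent w a := by
  rw [SignedPerm.des, Finset.card_filter]; rfl

/-- Where `± (n + 1)` is inserted between two adjacent entries of `0, w(1), …, w(n)`, there is exactly
one descent afterwards. -/
theorem des_insertMax_castSucc {n : ℕ} (i : Fin n) (s : ℤˣ) (w : SignedPerm n) :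
    (insertMax i.castSucc s w).des = w.des + (1 - descent w i) := by
  have hi := i.2
  have hval := fun a => val_insertMax_of_le i.castSucc s w (a := a)
  have hval1 := val_insertMax_succ_self i.castSucc s w
  have hval2 := fun a => val_insertMax_of_gt i.castSucc s w (a := a)
  simp only [Fin.val_castSucc] at hval hval1 hval2
  rw [des_eq_sum, des_eq_sum, ← Finset.sum_range_add_sum_Ico _ (show (i : ℕ) ≤ n + 1 by omega),
    ← Finset.sum_range_add_sum_Ico _ (show (i : ℕ) ≤ n by omega),
    Finset.sum_eq_sum_Ico_succ_bot (show (i : ℕ) < n + 1 by omega),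
    Finset.sum_eq_sum_Ico_succ_bot (show (i : ℕ) + 1 < n + 1 by omega),
    Finset.sum_eq_sum_Ico_succ_bot (show (i : ℕ) < n by omega)]
  have h1 : ∑ a ∈ Finset.range i, descent (insertMax i.castSucc s w) a
      = ∑ a ∈ Finset.range i, descent w a := by
    refine Finset.sum_congr rfl fun a ha => ?_
    simp only [Finset.mem_range] at ha
    rw [descent, descent, hval _ (by omega), hval _ (by omega)]
  have h2 : ∑ a ∈ Finset.Ico (i + 1 + 1 : ℕ) (n + 1), descent (insertMax i.castSucc s w) a
      = ∑ a ∈ Finset.Ico (i + 1 : ℕ) n, descent w a := by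
    rw [← Finset.sum_Ico_add' (fun a => descent (insertMax i.castSucc s w) a) (i + 1) n 1]
    refine Finset.sum_congr rfl fun a ha => ?_
    simp only [Finset.mem_Ico] at ha
    rw [descent, descent, hval2 _ (by omega) (by omega), hval2 a (by omega) (by omega)]
  rw [h1, h2]
  have h3 : descent (insertMax i.castSucc s w) i
      + descent (insertMax i.castSucc s w) (i + 1) = 1 := by
    have a1 := abs_lt.1 (abs_val_lt w i)
    have a2 := abs_lt.1 (abs_val_lt w (i + 1))
    rw [descent, descent, hval1, hval _ le_rfl, hval2 _ (by omega) (by omega)]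
    rcases Int.units_eq_one_or s with rfl | rfl
    · rw [if_neg (by push_cast; omega), if_pos (by push_cast; omega)]
    · rw [if_pos (by push_cast; omega), if_neg (by push_cast; omega)]
  have h4 : descent w i ≤ 1 := by rw [descent]; split_ifs <;> omega
  omega

/-- Appending `n + 1` creates no descent, appending `-(n + 1)` creates one. -/
theorem des_insertMax_last {n : ℕ} (s : ℤˣ) (w : SignedPerm n) :
    (insertMax (Fin.last n) s w).des = w.des + if s = 1 then 0 else 1 := by
  rw [des_eq_sum, des_eq_sum, Finset.sum_range_succ]
  congr 1
  · refine Finset.sum_congr rfl fun a ha => ?_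
    simp only [Finset.mem_range] at ha
    rw [descent, descent, val_insertMax_of_le _ _ _ (by simp; omega),
      val_insertMax_of_le _ _ _ (by simp; omega)]
  · have hval1 := val_insertMax_succ_self (Fin.last n) s w
    have a1 := abs_lt.1 (abs_val_lt w n)
    simp only [Fin.val_last] at hval1
    rw [descent, hval1, val_insertMax_of_le _ _ _ (by simp)]
    rcases Int.units_eq_one_or s with rfl | rfl
    · rw [if_neg (by push_cast; omega), if_pos rfl]
    · rw [if_pos (by push_cast; omega), if_neg (by decide)]

theorem sum_X_pow_des_insertMax {n : ℕ} (w : SignedPerm n) :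
    ∑ x : Fin (n + 1) × ℤˣ, (X : ℝ[X]) ^ (insertMax x.1 x.2 w).des
      = (2 * w.des + 1 : ℝ[X]) * X ^ w.des + (2 * (n - w.des) + 1 : ℝ[X]) * X ^ (w.des + 1) := by
  rw [Fintype.sum_prod_type, Fin.sum_univ_castSucc]
  simp only [des_insertMax_castSucc, des_insertMax_last]
  have h1 : ∀ i : Fin n, ∑ _s : ℤˣ, (X : ℝ[X]) ^ (w.des + (1 - descent w i))
      = 2 * (X ^ (w.des + 1) + (descent w i : ℝ[X]) * (X ^ w.des - X ^ (w.des + 1))) := by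
    intro i
    rw [Finset.sum_const, Finset.card_univ, Fintype.card_units_int]
    rw [descent]
    split_ifs <;> simp
  have h2 : ∑ i : Fin n, (descent w i : ℝ[X]) = w.des := by
    rw [des_eq_sum, Nat.cast_sum, Finset.sum_range]
  have h3 : ∑ s : ℤˣ, (X : ℝ[X]) ^ (w.des + if s = 1 then 0 else 1)
      = X ^ w.des + X ^ (w.des + 1) := by
    have : (Finset.univ : Finset ℤˣ) = {1, -1} := rfl
    rw [this, Finset.sum_pair (by decide), if_pos rfl, if_neg (by decide)]; rfl
  rw [Finset.sum_congr rfl fun i _ => h1 i, h3, ← Finset.mul_sum, Finset.sum_add_distrib,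
    ← Finset.sum_mul, h2]
  simp
  ring

theorem eulerianB_succ (n : ℕ) : eulerianB (n + 1)
    = 2 * X * (1 - X) * derivative (eulerianB n) + (1 + (2 * (n : ℝ[X]) + 1) * X) * eulerianB n := by
  have h := Equiv.sum_comp (Equiv.ofBijective _ (bijective_insertMax n))
    (fun w => (X : ℝ[X]) ^ w.des)
  rw [eulerianB, ← h, Fintype.sum_prod_type_right]
  simp only [Equiv.ofBijective_apply, sum_X_pow_des_insertMax]
  rw [eulerianB, derivative_sum, Finset.mul_sum, Finset.mul_sum, ← Finset.sum_add_distrib]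
  refine Finset.sum_congr rfl fun w _ => ?_
  rw [derivative_X_pow]
  cases w.des with
  | zero => simp
  | succ d => simp; ring

/-- `B_n(x) / (1 - x) ^ (n + 1) = ∑ (2 m + 1) ^ n x ^ m`. -/
theorem coe_eulerianB (n : ℕ) : (eulerianB n : PowerSeries ℝ)
    = (1 - PowerSeries.X) ^ (n + 1) * PowerSeries.mk fun m => ((2 * m + 1) ^ n : ℝ) := by
  induction n with
  | zero =>
    ext m
    rw [zero_add, pow_one, coeff_one_sub_X_mul]
    cases m <;> simp [eulerianB, SignedPerm.des, PowerSeries.coeff_one]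
  | succ n ih =>
    set G : PowerSeries ℝ := PowerSeries.mk fun m => ((2 * m + 1) ^ n : ℝ) with hG
    have hd : ((derivative (eulerianB n) : ℝ[X]) : PowerSeries ℝ)
        = (1 - PowerSeries.X) ^ (n + 1) * PowerSeries.derivative ℝ G
          - (n + 1 : PowerSeries ℝ) * (1 - PowerSeries.X) ^ n * G := by
      rw [← PowerSeries.derivative_coe, ih]
      rw [Derivation.leibniz, Derivation.leibniz_pow, map_sub]
      simp
      ring
    have hG1 : PowerSeries.mk (fun m => ((2 * m + 1) ^ (n + 1) : ℝ))
        = 2 * PowerSeries.X * PowerSeries.derivative ℝ G + G := by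
      ext m
      rw [map_add, mul_assoc, show (2 : PowerSeries ℝ) = PowerSeries.C 2 from rfl,
        PowerSeries.coeff_C_mul, PowerSeries.coeff_mk, hG, PowerSeries.coeff_mk]
      cases m with
      | zero => simp
      | succ m =>
        rw [PowerSeries.coeff_succ_X_mul, PowerSeries.coeff_derivative, PowerSeries.coeff_mk]
        push_cast
        ring
    have e := congrArg (fun p : ℝ[X] => (p : PowerSeries ℝ)) (eulerianB_succ n)
    simp only [Polynomial.coe_add, Polynomial.coe_mul, Polynomial.coe_sub, Polynomial.coe_one,
      Polynomial.coe_X, hd, ih] at e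
    rw [e, hG1]
    have h2 : ((2 : ℝ[X]) : PowerSeries ℝ) = 2 := map_ofNat (Polynomial.coeToPowerSeries.ringHom) 2
    have hn : ((n : ℝ[X]) : PowerSeries ℝ) = n := map_natCast (Polynomial.coeToPowerSeries.ringHom) n
    rw [h2, hn]
    ring

theorem eulerianB_eq_cubeBasis (n : ℕ) : eulerianB n = cubeBasis n 0 := by
  apply Polynomial.coe_injective ℝ
  rw [coe_eulerianB, coe_cubeBasis n 0 (Nat.zero_le _)]
  congr 2

/-! ### Faces of cubes -/

/-- The dimension of a face of a cube: the number of factors that are the whole unit interval. -/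
def CubeFace.dim {k : ℕ} (F : CubeFace k) : ℕ :=
  (Finset.univ.filter fun i => (F i).1 = Finset.univ).card

theorem sum_intervalFace {M : Type*} [AddCommMonoid M] (g : {s : Finset Bool // s.Nonempty} → M) :
    ∑ s, g s = g ⟨{false}, by simp⟩ + g ⟨{true}, by simp⟩ + g ⟨Finset.univ, by simp⟩ := by
  have : (Finset.univ : Finset {s : Finset Bool // s.Nonempty})
      = {⟨{false}, by simp⟩, ⟨{true}, by simp⟩, ⟨Finset.univ, by simp⟩} := by decide
  rw [this, Finset.sum_insert (by decide), Finset.sum_pair (by decide), add_assoc]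

theorem intervalFace_cases (s : {s : Finset Bool // s.Nonempty}) :
    s.1 = Finset.univ ∨ ∃ b, s.1 = {b} := by
  revert s; decide

theorem sum_cubeFace_prod {k : ℕ} {M : Type*} [CommSemiring M]
    (g : Fin k → {s : Finset Bool // s.Nonempty} → M) :
    ∑ F : CubeFace k, ∏ i, g i (F i) = ∏ i, ∑ s, g i s := by
  rw [Finset.prod_univ_sum, Fintype.piFinset_univ]

theorem CubeFace.pow_dim {k : ℕ} {M : Type*} [CommSemiring M] (F : CubeFace k) (t : M) :
    t ^ F.dim = ∏ i, if (F i).1 = Finset.univ then t else 1 := by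
  rw [Finset.prod_ite, Finset.prod_const, Finset.prod_const_one, mul_one]; rfl

theorem sum_pow_cubeFace_dim {M : Type*} [CommSemiring M] (k : ℕ) (t : M) :
    ∑ F : CubeFace k, t ^ F.dim = (t + 2) ^ k := by
  simp only [CubeFace.pow_dim]
  rw [sum_cubeFace_prod fun _ s => if s.1 = Finset.univ then t else 1]
  simp only [sum_intervalFace, if_true, Finset.prod_const, Finset.card_univ, Fintype.card_fin]
  congr 1
  rw [if_neg (by decide), if_neg (by decide)]
  ring

theorem card_cubeFace (k : ℕ) : Fintype.card (CubeFace k) = 3 ^ k := by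
  have := sum_pow_cubeFace_dim k 1
  simpa using this

open Classical in
theorem card_cubeFace_le {k : ℕ} (F : CubeFace k) :
    (Finset.univ.filter fun G : CubeFace k => G ≤ F).card = 3 ^ F.dim := by
  have h : (Finset.univ.filter fun G : CubeFace k => G ≤ F)
      = Fintype.piFinset fun i => Finset.univ.filter fun s => s.1 ⊆ (F i).1 := by
    ext G
    simp only [Finset.mem_filter, Finset.mem_univ, true_and, Fintype.mem_piFinset]
    rfl
  rw [h, Fintype.card_piFinset, CubeFace.pow_dim]
  refine Finset.prod_congr rfl fun i _ => ?_
  generalize F i = s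
  have : ∀ s : {s : Finset Bool // s.Nonempty},
      (Finset.univ.filter fun s' : {s : Finset Bool // s.Nonempty} => s'.1 ⊆ s.1).card
        = if s.1 = Finset.univ then 3 else 1 := by decide
  convert this s

/-! ### The faces of a cubical complex -/

section Cubical

variable {X : Type*} {K : Set (Set X)} {dim : Set X → ℕ}

open Classical in
/-- The nonempty faces of a finite complex. -/
def faceFinset (hK : K.Finite) : Finset (Set X) := hK.toFinset.filter Set.Nonempty

theorem mem_faceFinset {hK : K.Finite} {σ : Set X} :
    σ ∈ faceFinset hK ↔ σ ∈ K ∧ σ.Nonempty := by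
  simp [faceFinset]

/-- The nonempty faces of `K` contained in `σ`. -/
abbrev FaceBelow (K : Set (Set X)) (σ : Set X) : Type _ :=
  {ρ : Set X // ρ ∈ K ∧ ρ.Nonempty ∧ ρ ⊆ σ}

open Classical in
theorem sum_faceBelow (hK : K.Finite) {σ : Set X} {k : ℕ} (e : FaceBelow K σ ≃o CubeFace k)
    {M : Type*} [AddCommMonoid M] (φ : Set X → M) :
    ∑ ρ ∈ (faceFinset hK).filter (· ⊆ σ), φ ρ = ∑ F : CubeFace k, φ (e.symm F).1 := by
  symm
  refine Finset.sum_bij (fun F _ => (e.symm F).1) ?_ ?_ ?_ ?_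
  · intro F _
    have := (e.symm F).2
    simp [mem_faceFinset, this.1, this.2.1, this.2.2]
  · intro F _ G _ h
    exact e.symm.injective (Subtype.ext h)
  · intro ρ hρ
    simp only [Finset.mem_filter, mem_faceFinset] at hρ
    exact ⟨e ⟨ρ, hρ.1.1, hρ.1.2, hρ.2⟩, Finset.mem_univ _, by simp⟩
  · intro F _; rfl

open Classical in
theorem card_faceBelow (hK : K.Finite) (hc : IsCubical K dim) {σ : Set X} (hσ : σ ∈ K)
    (hne : σ.Nonempty) : ((faceFinset hK).filter (· ⊆ σ)).card = 3 ^ dim σ := by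
  obtain ⟨e⟩ := hc σ hσ hne
  have := sum_faceBelow hK e (fun _ => 1)
  rw [Finset.card_eq_sum_ones, this, ← card_cubeFace]; simp

/-- The dimension function is determined by the face poset. -/
theorem dim_eq_cubeFace_dim (hK : K.Finite) (hc : IsCubical K dim) {σ : Set X} {k : ℕ}
    (e : FaceBelow K σ ≃o CubeFace k) (ρ : FaceBelow K σ) : dim ρ.1 = (e ρ).dim := by
  classical
  have h1 := card_faceBelow hK hc ρ.2.1 ρ.2.2.1
  have h2 := sum_faceBelow hK e (fun ρ' => if ρ' ⊆ ρ.1 then 1 else 0)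
  rw [← Finset.card_filter, Finset.filter_filter] at h2
  have h3 : ((faceFinset hK).filter fun a => a ⊆ σ ∧ a ⊆ ρ.1)
      = (faceFinset hK).filter (· ⊆ ρ.1) := by
    refine Finset.filter_congr fun a _ => ⟨fun h => h.2, fun h => ⟨h.trans ρ.2.2.2, h⟩⟩
  have h4 : (Finset.univ.filter fun G : CubeFace k => (e.symm G).1 ⊆ ρ.1)
      = Finset.univ.filter fun G : CubeFace k => G ≤ e ρ := by
    refine Finset.filter_congr fun G _ => ?_
    rw [← e.symm_apply_le]; rfl
  rw [h3, h1, ← Finset.card_filter, h4, card_cubeFace_le] at h2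
  exact (Nat.pow_right_injective (show 2 ≤ 3 by norm_num)) h2

theorem dim_lt_of_ssubset (hK : K.Finite) (hc : IsCubical K dim) {ρ σ : Set X} (hρ : ρ ∈ K)
    (hne : ρ.Nonempty) (hσ : σ ∈ K) (h : ρ ⊂ σ) : dim ρ < dim σ := by
  classical
  have h1 := card_faceBelow hK hc hρ hne
  have h2 := card_faceBelow hK hc hσ (hne.mono h.1)
  rw [← Nat.pow_lt_pow_iff_right (show 1 < 3 by norm_num), ← h1, ← h2]
  refine Finset.card_lt_card (Finset.ssubset_iff_of_subset ?_ |>.2 ⟨σ, ?_, ?_⟩)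
  · exact Finset.monotone_filter_right _ fun a _ ha => ha.trans h.1
  · simp [mem_faceFinset, hσ, hne.mono h.1]
  · simp [mem_faceFinset, h.2]

theorem dim_le_of_subset (hK : K.Finite) (hc : IsCubical K dim) {ρ σ : Set X} (hρ : ρ ∈ K)
    (hne : ρ.Nonempty) (hσ : σ ∈ K) (h : ρ ⊆ σ) : dim ρ ≤ dim σ := by
  rcases h.eq_or_ssubset with rfl | h
  · exact le_rfl
  · exact (dim_lt_of_ssubset hK hc hρ hne hσ h).le

theorem eq_of_subset_of_dim_le (hK : K.Finite) (hc : IsCubical K dim) {ρ σ : Set X} (hρ : ρ ∈ K)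
    (hne : ρ.Nonempty) (hσ : σ ∈ K) (h : ρ ⊆ σ) (hd : dim σ ≤ dim ρ) : ρ = σ := by
  rcases h.eq_or_ssubset with rfl | h
  · rfl
  · exact absurd (dim_lt_of_ssubset hK hc hρ hne hσ h) (not_lt.2 hd)

open Classical in
/-- `∑ t ^ dim ρ = (t + 2) ^ dim σ`, the sum over the nonempty faces `ρ` of `σ`. -/
theorem sum_pow_dim (hK : K.Finite) (hc : IsCubical K dim) {σ : Set X} (hσ : σ ∈ K)
    (hne : σ.Nonempty) {M : Type*} [CommSemiring M] (t : M) :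
    ∑ ρ ∈ (faceFinset hK).filter (· ⊆ σ), t ^ dim ρ = (t + 2) ^ dim σ := by
  obtain ⟨e⟩ := hc σ hσ hne
  rw [sum_faceBelow hK e, ← sum_pow_cubeFace_dim]
  refine Finset.sum_congr rfl fun F _ => ?_
  rw [dim_eq_cubeFace_dim hK hc e]; simp

/-! ### Counting chains of faces -/

open Classical in
/-- The chains in a finite collection of sets, the empty chain included. -/
def chainFinset (D : Finset (Set X)) : Finset (Finset (Set X)) :=
  D.powerset.filter fun c => IsChain (· ⊆ ·) (c : Set (Set X))

open Classical in
/-- The chains in `D` with largest element `τ`. -/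
def topChainFinset (D : Finset (Set X)) (τ : Set X) : Finset (Finset (Set X)) :=
  (chainFinset D).filter fun c => τ ∈ c ∧ ∀ σ ∈ c, σ ⊆ τ

theorem mem_chainFinset {D : Finset (Set X)} {c : Finset (Set X)} :
    c ∈ chainFinset D ↔ c ⊆ D ∧ IsChain (· ⊆ ·) (c : Set (Set X)) := by
  simp [chainFinset]

theorem mem_topChainFinset {D : Finset (Set X)} {c : Finset (Set X)} {τ : Set X} :
    c ∈ topChainFinset D τ ↔ (c ⊆ D ∧ IsChain (· ⊆ ·) (c : Set (Set X))) ∧ τ ∈ c ∧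
      ∀ σ ∈ c, σ ⊆ τ := by
  simp [topChainFinset, mem_chainFinset]

theorem exists_top_of_isChain {c : Finset (Set X)} (hc : IsChain (· ⊆ ·) (c : Set (Set X)))
    (hne : c.Nonempty) : ∃ τ ∈ c, ∀ σ ∈ c, σ ⊆ τ := by
  obtain ⟨τ, hτ⟩ := c.exists_maximal hne
  refine ⟨τ, hτ.1, fun σ hσ => ?_⟩
  rcases eq_or_ne σ τ with rfl | hne
  · exact subset_rfl
  · rcases hc hσ hτ.1 hne with h | h
    · exact h
    · exact hτ.2 hσ h

theorem sum_chainFinset (D : Finset (Set X)) {M : Type*} [AddCommMonoid M] (w : ℕ → M) :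
    ∑ c ∈ chainFinset D, w c.card
      = w 0 + ∑ τ ∈ D, ∑ c ∈ topChainFinset D τ, w c.card := by
  classical
  have h : chainFinset D = insert ∅ (D.biUnion (topChainFinset D)) := by
    ext c
    simp only [mem_chainFinset, Finset.mem_insert, Finset.mem_biUnion, mem_topChainFinset]
    constructor
    · rintro ⟨h1, h2⟩
      rcases c.eq_empty_or_nonempty with h | h
      · exact Or.inl h
      · obtain ⟨τ, hτ, hm⟩ := exists_top_of_isChain h2 h
        exact Or.inr ⟨τ, h1 hτ, ⟨h1, h2⟩, hτ, hm⟩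
    · rintro (rfl | ⟨τ, -, h, -⟩)
      · simp
      · exact h
  rw [h, Finset.sum_insert, Finset.sum_biUnion, Finset.card_empty]
  · intro τ _ τ' _ hne
    refine Finset.disjoint_left.2 fun c hc hc' => hne ?_
    rw [mem_topChainFinset] at hc hc'
    exact (hc'.2.2 _ hc.2.1).antisymm (hc.2.2 _ hc'.2.1)
  · simp only [Finset.mem_biUnion, mem_topChainFinset]
    rintro ⟨τ, -, -, h, -⟩
    simp at h

open Classical in
theorem sum_topChainFinset {D : Finset (Set X)} {τ : Set X} (hτ : τ ∈ D) {M : Type*}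
    [AddCommMonoid M] (w : ℕ → M) : ∑ c ∈ topChainFinset D τ, w c.card
      = ∑ c ∈ chainFinset (D.filter (· ⊂ τ)), w (c.card + 1) := by
  refine Finset.sum_bij' (fun c _ => c.erase τ) (fun c _ => insert τ c) ?_ ?_ ?_ ?_ ?_
  · intro c hc
    rw [mem_topChainFinset] at hc
    rw [mem_chainFinset]
    refine ⟨fun σ hσ => ?_, hc.1.2.mono (by simp)⟩
    rw [Finset.mem_erase] at hσ
    exact Finset.mem_filter.2 ⟨hc.1.1 hσ.2, (hc.2.2 σ hσ.2).ssubset_of_ne hσ.1⟩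
  · intro c hc
    rw [mem_chainFinset] at hc
    rw [mem_topChainFinset]
    have hlt : ∀ σ ∈ c, σ ⊂ τ := fun σ hσ => (Finset.mem_filter.1 (hc.1 hσ)).2
    refine ⟨⟨Finset.insert_subset hτ fun σ hσ => (Finset.mem_filter.1 (hc.1 hσ)).1, ?_⟩,
      by simp, ?_⟩
    · rw [Finset.coe_insert]
      exact hc.2.insert fun σ hσ _ => Or.inr (hlt σ hσ).1
    · intro σ hσ
      rcases Finset.mem_insert.1 hσ with rfl | h
      · exact subset_rfl
      · exact (hlt σ h).1
  · intro c hc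
    rw [mem_topChainFinset] at hc
    exact Finset.insert_erase hc.2.1
  · intro c hc
    rw [mem_chainFinset] at hc
    exact Finset.erase_insert fun h => (Finset.mem_filter.1 (hc.1 h)).2.2 subset_rfl
  · intro c hc
    rw [mem_topChainFinset] at hc
    rw [Finset.card_erase_add_one hc.2.1]

open Classical in
theorem topChainFinset_filter {D : Finset (Set X)} {τ ρ : Set X} (hρ : ρ ⊂ τ) :
    topChainFinset (D.filter (· ⊂ τ)) ρ = topChainFinset D ρ := by
  ext c
  simp only [mem_topChainFinset]
  constructor
  · rintro ⟨⟨h1, h2⟩, h3⟩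
    exact ⟨⟨fun σ hσ => (Finset.mem_filter.1 (h1 hσ)).1, h2⟩, h3⟩
  · rintro ⟨⟨h1, h2⟩, h3⟩
    exact ⟨⟨fun σ hσ => Finset.mem_filter.2 ⟨h1 hσ, (h3.2 σ hσ).trans_ssubset hρ⟩, h2⟩, h3⟩

/-- The power series `∑ (2 m - 1) ^ k x ^ m`, the sum over `m ≥ 1`. -/
def oddPowSeries (k : ℕ) : PowerSeries ℝ :=
  PowerSeries.mk fun m => if m = 0 then 0 else (2 * m - 1) ^ k

theorem one_sub_X_mul_oddPowSeries_zero :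
    (1 - PowerSeries.X) * oddPowSeries 0 = PowerSeries.X := by
  ext m
  rw [oddPowSeries, coeff_one_sub_X_mul]
  rcases m with _ | _ | m <;> simp [PowerSeries.coeff_X]

theorem one_sub_X_ne_zero : (1 - PowerSeries.X : PowerSeries ℝ) ≠ 0 := by
  intro h
  have := congrArg (PowerSeries.coeff 0) h
  simp at this

/-- The chains with largest element `τ`, counted with the weight `x / (1 - x)` for each member. -/
theorem sum_topChainFinset_pow (hK : K.Finite) (hc : IsCubical K dim) {τ : Set X} (hτ : τ ∈ K)
    (hne : τ.Nonempty) :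
    ∑ c ∈ topChainFinset (faceFinset hK) τ, oddPowSeries 0 ^ c.card = oddPowSeries (dim τ) := by
  classical
  induction hd : dim τ using Nat.strong_induction_on generalizing τ with
  | _ d ih =>
    subst hd
    have hmem : τ ∈ faceFinset hK := mem_faceFinset.2 ⟨hτ, hne⟩
    rw [sum_topChainFinset hmem fun i => oddPowSeries 0 ^ i]
    simp only [pow_succ]
    rw [← Finset.sum_mul, sum_chainFinset _ fun i => oddPowSeries 0 ^ i]
    have h1 : ∀ ρ ∈ (faceFinset hK).filter (· ⊂ τ),
        ∑ c ∈ topChainFinset ((faceFinset hK).filter (· ⊂ τ)) ρ, oddPowSeries 0 ^ c.card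
          = oddPowSeries (dim ρ) := by
      intro ρ hρ
      rw [Finset.mem_filter, mem_faceFinset] at hρ
      rw [topChainFinset_filter hρ.2]
      exact ih _ (dim_lt_of_ssubset hK hc hρ.1.1 hρ.1.2 hτ hρ.2) hρ.1.1 hρ.1.2 rfl
    rw [Finset.sum_congr rfl h1]
    apply mul_left_cancel₀ one_sub_X_ne_zero
    rw [mul_left_comm, one_sub_X_mul_oddPowSeries_zero, pow_zero]
    have h2 : (faceFinset hK).filter (· ⊆ τ) = insert τ ((faceFinset hK).filter (· ⊂ τ)) := by
      ext ρ
      simp only [Finset.mem_filter, Finset.mem_insert]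
      constructor
      · rintro ⟨h, h'⟩
        rcases h'.eq_or_ssubset with h'' | h''
        · exact Or.inl h''
        · exact Or.inr ⟨h, h''⟩
      · rintro (rfl | h)
        · exact ⟨hmem, subset_rfl⟩
        · exact ⟨h.1, h.2.1⟩
    have h3 : ∀ t : ℝ, ∑ ρ ∈ (faceFinset hK).filter (· ⊂ τ), t ^ dim ρ
        = (t + 2) ^ dim τ - t ^ dim τ := by
      intro t
      rw [← sum_pow_dim hK hc hτ hne, h2, Finset.sum_insert (by simp)]
      ring
    ext m
    rw [oddPowSeries, coeff_one_sub_X_mul, mul_comm]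
    rcases m with _ | _ | m
    · simp
    · simp [PowerSeries.coeff_succ_X_mul, oddPowSeries]
      norm_num
    · have h4 := h3 (2 * (m + 1 : ℕ) - 1)
      simp only [PowerSeries.coeff_succ_X_mul, map_add, map_sum, oddPowSeries,
        PowerSeries.coeff_mk, PowerSeries.coeff_one, if_neg (Nat.succ_ne_zero m), h4,
        Nat.add_sub_cancel, if_neg (Nat.succ_ne_zero (m + 1))]
      push_cast
      ring

theorem sum_chainFinset_pow (hK : K.Finite) (hc : IsCubical K dim) :
    ∑ c ∈ chainFinset (faceFinset hK), oddPowSeries 0 ^ c.card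
      = 1 + ∑ τ ∈ faceFinset hK, oddPowSeries (dim τ) := by
  rw [sum_chainFinset _ fun i => oddPowSeries 0 ^ i, pow_zero]
  congr 1
  refine Finset.sum_congr rfl fun τ hτ => ?_
  rw [mem_faceFinset] at hτ
  exact sum_topChainFinset_pow hK hc hτ.1 hτ.2

theorem mem_sd_faces {hK : K.Finite} {c : Finset (Set X)} :
    c ∈ (sd K).faces ↔ c ∈ chainFinset (faceFinset hK) ∧ c.Nonempty := by
  rw [mem_chainFinset]
  constructor
  · rintro ⟨h1, h2, h3⟩
    exact ⟨⟨fun σ hσ => mem_faceFinset.2 (h2 σ hσ), h3⟩, h1⟩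
  · rintro ⟨⟨h1, h2⟩, h3⟩
    exact ⟨h3, fun σ hσ => mem_faceFinset.1 (h1 hσ), h2⟩

open Classical in
theorem faceCount_sd (hK : K.Finite) (i : ℕ) :
    faceCount (sd K) i = ((chainFinset (faceFinset hK)).filter fun c => c.card = i).card := by
  cases i with
  | zero =>
    have : ((chainFinset (faceFinset hK)).filter fun c => c.card = 0) = {∅} := by
      ext c
      simp only [Finset.mem_filter, Finset.card_eq_zero, Finset.mem_singleton, mem_chainFinset]
      constructor
      · exact fun h => h.2
      · rintro rfl; simp
    rw [this]; rfl
  | succ i =>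
    rw [faceCount, ← Set.ncard_coe_finset]
    congr 1
    ext c
    simp only [Set.mem_ofPred_eq, mem_sd_faces (hK := hK), Finset.coe_filter]
    constructor
    · rintro ⟨⟨h1, -⟩, h2⟩; exact ⟨h1, h2⟩
    · rintro ⟨h1, h2⟩
      exact ⟨⟨h1, Finset.card_pos.1 (by omega)⟩, h2⟩

theorem card_le_dimSucc (hK : K.Finite) {c : Finset (Set X)}
    (hc : c ∈ chainFinset (faceFinset hK)) : c.card ≤ dimSucc (sd K) := by
  rcases c.eq_empty_or_nonempty with rfl | hne
  · simp
  · refine le_csSup ⟨(faceFinset hK).card, ?_⟩ ⟨c, mem_sd_faces.2 ⟨hc, hne⟩, rfl⟩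
    rintro _ ⟨c, hc, rfl⟩
    exact Finset.card_le_card (mem_chainFinset.1 (mem_sd_faces (hK := hK).1 hc).1).1

theorem hPoly_sd (hK : K.Finite) : hPoly (sd K)
    = ∑ c ∈ chainFinset (faceFinset hK),
      Polynomial.X ^ c.card * (1 - Polynomial.X) ^ (dimSucc (sd K) - c.card) := by
  classical
  rw [hPoly, ← Finset.sum_fiberwise_of_maps_to (s := chainFinset (faceFinset hK))
    (t := Finset.range (dimSucc (sd K) + 1)) (g := Finset.card)
    fun c hc => Finset.mem_range.2 (Nat.lt_succ_iff.2 (card_le_dimSucc hK hc))]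
  refine Finset.sum_congr rfl fun i _ => ?_
  rw [Finset.sum_congr rfl (g := fun _ => Polynomial.X ^ i *
    (1 - Polynomial.X) ^ (dimSucc (sd K) - i)) fun c hc => by
    rw [(Finset.mem_filter.1 hc).2], Finset.sum_const, faceCount_sd hK, nsmul_eq_mul, mul_assoc]

theorem coe_hPoly_sd (hK : K.Finite) (hc : IsCubical K dim) :
    (hPoly (sd K) : PowerSeries ℝ) = (1 - PowerSeries.X) ^ dimSucc (sd K)
      * (1 + ∑ τ ∈ faceFinset hK, oddPowSeries (dim τ)) := by
  rw [← sum_chainFinset_pow hK hc, hPoly_sd hK, Finset.mul_sum]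
  rw [← Polynomial.coeToPowerSeries.ringHom_apply, map_sum]
  refine Finset.sum_congr rfl fun c hc' => ?_
  obtain ⟨j, hj⟩ := Nat.exists_eq_add_of_le (card_le_dimSucc hK hc')
  rw [hj, Nat.add_sub_cancel_left, pow_add, mul_right_comm, ← mul_pow,
    one_sub_X_mul_oddPowSeries_zero]
  simp

/-! ### The dimension of the barycentric subdivision -/

theorem exists_chain_card (hK : K.Finite) {σ : Set X} {k : ℕ}
    (e : FaceBelow K σ ≃o CubeFace k) : ∃ c ∈ chainFinset (faceFinset hK), c.card = k + 1 := by
  classical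
  let F : ℕ → CubeFace k := fun j i =>
    if (i : ℕ) < j then ⟨Finset.univ, by simp⟩ else ⟨{false}, by simp⟩
  have hmono : Monotone F := by
    intro a b hab i
    simp only [F]
    split_ifs
    · exact le_rfl
    · omega
    · exact Finset.subset_univ _
    · exact le_rfl
  have hinj : ∀ a b, a < b → b ≤ k → F a ≠ F b := by
    intro a b hab hb h
    have := congrArg Subtype.val (congrFun h ⟨a, by omega⟩)
    simp only [F, lt_irrefl, if_false, if_pos hab] at this
    exact absurd this (by decide)
  have hmono' : ∀ a b, a ≤ b → (e.symm (F a)).1 ⊆ (e.symm (F b)).1 := fun a b hab =>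
    e.symm.monotone (hmono hab)
  refine ⟨(Finset.range (k + 1)).image fun j => (e.symm (F j)).1, ?_, ?_⟩
  · rw [mem_chainFinset]
    constructor
    · intro ρ hρ
      obtain ⟨j, -, rfl⟩ := Finset.mem_image.1 hρ
      have := (e.symm (F j)).2
      exact mem_faceFinset.2 ⟨this.1, this.2.1⟩
    · rintro _ h1 _ h2 -
      simp only [Finset.coe_image, Set.mem_image] at h1 h2
      obtain ⟨a, -, rfl⟩ := h1
      obtain ⟨b, -, rfl⟩ := h2
      rcases le_total a b with h | h
      · exact Or.inl (hmono' a b h)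
      · exact Or.inr (hmono' b a h)
  · rw [Finset.card_image_of_injOn, Finset.card_range]
    intro a ha b hb h
    simp only [Finset.coe_range, Set.mem_Iio] at ha hb
    have h' : F a = F b := e.symm.injective (Subtype.ext h)
    rcases lt_trichotomy a b with hab | hab | hab
    · exact absurd h' (hinj a b hab (by omega))
    · exact hab
    · exact absurd h'.symm (hinj b a hab (by omega))

/-- Dimensions increase strictly along chains, and a cube has a complete flag of faces. -/
theorem dimSucc_sd (hK : K.Finite) (hc : IsCubical K dim) {n : ℕ}
    (hn : IsGreatest (dim '' {σ | σ ∈ K ∧ σ.Nonempty}) n) : dimSucc (sd K) = n + 1 := by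
  classical
  apply le_antisymm
  · obtain ⟨σ, hσ, -⟩ := hn.1
    refine csSup_le ⟨_, {σ}, ⟨by simp, by simpa using hσ, by simp⟩, rfl⟩ ?_
    rintro _ ⟨c, hcc, rfl⟩
    obtain ⟨h1, -⟩ := mem_sd_faces (hK := hK).1 hcc
    rw [mem_chainFinset] at h1
    have hinj : Set.InjOn dim (c : Set (Set X)) := by
      intro ρ hρ ρ' hρ' h
      by_contra hne
      obtain ⟨a1, a2⟩ := mem_faceFinset.1 (h1.1 hρ)
      obtain ⟨b1, b2⟩ := mem_faceFinset.1 (h1.1 hρ')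
      rcases h1.2 hρ hρ' hne with h' | h'
      · exact hne (eq_of_subset_of_dim_le hK hc a1 a2 b1 h' h.ge)
      · exact hne (eq_of_subset_of_dim_le hK hc b1 b2 a1 h' h.le).symm
    rw [← Finset.card_image_of_injOn hinj, ← Finset.card_range (n + 1)]
    refine Finset.card_le_card fun j hj => ?_
    obtain ⟨ρ, hρ, rfl⟩ := Finset.mem_image.1 hj
    exact Finset.mem_range.2 (Nat.lt_succ_iff.2
      (hn.2 ⟨ρ, mem_faceFinset.1 (h1.1 hρ), rfl⟩))
  · obtain ⟨σ, hσ, rfl⟩ := hn.1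
    obtain ⟨e⟩ := hc σ hσ.1 hσ.2
    obtain ⟨c, hc1, hc2⟩ := exists_chain_card hK e
    rw [← hc2]
    exact card_le_dimSucc hK hc1

end Cubical

/-! ### The cubical `h`-vector -/

theorem coeff_zero_cubicalHPoly (n : ℕ) (f : ℕ → ℕ) : (cubicalHPoly n f).coeff 0 = 1 := by
  have h := congrArg (eval 0) (one_add_X_mul_cubicalHPoly n f)
  rw [coeff_zero_eq_eval_zero]
  simpa [cubicalNumerator, eval_finsetSum] using h

theorem natDegree_cubicalNumerator_aux (n : ℕ) (f : ℕ → ℕ) :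
    (1 + ∑ k ∈ Finset.range (n + 1), (f k : ℝ[X]) * X ^ (k + 1) *
      (C (1 / 2) * (1 - X)) ^ (n - k)).natDegree ≤ n + 1 := by
  refine natDegree_add_le_of_degree_le (by simp) (natDegree_sum_le_of_forall_le _ _ fun k hk => ?_)
  simp only [Finset.mem_range] at hk
  have h1 : (C (1 / 2) * (1 - X) : ℝ[X]).natDegree ≤ 1 := by compute_degree
  have h2 := natDegree_pow_le_of_le (n - k) h1
  have h3 : ((f k : ℝ[X]) * X ^ (k + 1)).natDegree ≤ k + 1 := by compute_degree
  exact natDegree_mul_le.trans (by omega)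

theorem natDegree_cubicalHPoly (n : ℕ) (f : ℕ → ℕ) : (cubicalHPoly n f).natDegree ≤ n + 1 := by
  have h := natDegree_divByMonic (cubicalNumerator n f) (monic_X_sub_C (-1))
  rw [natDegree_X_sub_C] at h
  have h2 : (cubicalNumerator n f).natDegree ≤ n + 2 := by
    refine natDegree_add_le_of_degree_le ((natDegree_cubicalNumerator_aux n f).trans (by omega)) ?_
    exact natDegree_C_mul_X_pow_le _ _
  rw [cubicalHPoly, h]; omega

theorem coeff_last_cubicalHPoly (n : ℕ) (f : ℕ → ℕ) :
    (cubicalHPoly n f).coeff (n + 1) = (-1) ^ n * reducedEuler n f := by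
  have h := congrArg (fun p => coeff p (n + 2)) (one_add_X_mul_cubicalHPoly n f)
  have h0 : (cubicalHPoly n f).coeff (n + 2) = 0 :=
    coeff_eq_zero_of_natDegree_lt (Nat.lt_succ_of_le (natDegree_cubicalHPoly n f))
  simp only [add_mul, one_mul, coeff_add, coeff_X_mul, h0, zero_add] at h
  rw [h, cubicalNumerator, coeff_add, coeff_eq_zero_of_natDegree_lt
    (Nat.lt_succ_of_le (natDegree_cubicalNumerator_aux n f)), zero_add, coeff_C_mul, coeff_X_pow,
    if_pos rfl, mul_one]

/-- The substitution `x = (2 m - 1) / (2 m + 1)` turns the definition of the cubical `h`-vector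
into a formula for `∑ f_k (2 m - 1) ^ k`. -/
theorem sum_cubicalHPoly_mul_cubeSeries (n : ℕ) (f : ℕ → ℕ) {m : ℕ} (hm : m ≠ 0) :
    ∑ k ∈ Finset.range (n + 2), (cubicalHPoly n f).coeff k * cubeSeries n k m
      = ∑ k ∈ Finset.range (n + 1), (f k : ℝ) * (2 * m - 1) ^ k := by
  have hm1 : (1 : ℝ) ≤ m := by exact_mod_cast Nat.one_le_iff_ne_zero.2 hm
  have ha : (2 * m - 1 : ℝ) ≠ 0 := by intro h; linarith
  have hb : (2 * m + 1 : ℝ) ≠ 0 := by positivity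
  have h := congrArg (eval ((2 * m - 1) / (2 * m + 1) : ℝ)) (one_add_X_mul_cubicalHPoly n f)
  rw [cubicalNumerator, ← coeff_last_cubicalHPoly, eval_mul,
    eval_eq_sum_range' (Nat.lt_succ_of_le (natDegree_cubicalHPoly n f))] at h
  have h0 := coeff_zero_cubicalHPoly n f
  generalize hH : (cubicalHPoly n f).coeff = H at *
  simp only [eval_add, eval_one, eval_X, eval_finsetSum, eval_mul, eval_natCast, eval_pow, eval_C,
    eval_sub] at h
  set a : ℝ := 2 * m - 1 with ha'
  set b : ℝ := 2 * m + 1 with hb'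
  have e1 : 1 / 2 * (1 - a / b) = 1 / b := by rw [ha', hb'] at *; field_simp; ring
  have e2 : 1 + a / b = 4 * m / b := by rw [ha', hb'] at *; field_simp; ring
  rw [e1, e2] at h
  have h2 : a * ∑ k ∈ Finset.range (n + 1), (f k : ℝ) * a ^ k = b ^ (n + 1) *
      ∑ k ∈ Finset.range (n + 1), (f k : ℝ) * (a / b) ^ (k + 1) * (1 / b) ^ (n - k) := by
    rw [Finset.mul_sum, Finset.mul_sum]
    refine Finset.sum_congr rfl fun k hk => ?_
    simp only [Finset.mem_range] at hk
    obtain ⟨j, rfl⟩ : ∃ j, n = k + j := ⟨n - k, by omega⟩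
    rw [Nat.add_sub_cancel_left, div_pow, div_pow, one_pow]
    field_simp
    ring
  have h3 : a * ∑ k ∈ Finset.range (n + 2), H k * cubeSeries n k m = b ^ (n + 1) *
      (4 * m / b * ∑ k ∈ Finset.range (n + 2), H k * (a / b) ^ k - 1
        - H (n + 1) * (a / b) ^ (n + 2)) := by
    rw [Finset.sum_range_succ, Finset.sum_range_succ', Finset.sum_range_succ _ (n + 1),
      Finset.sum_range_succ' _ n, h0]
    have h4 : ∀ k ∈ Finset.range n, H (k + 1) * cubeSeries n (k + 1) m * a
        = H (k + 1) * (a / b) ^ (k + 1) * (4 * m * b ^ n) := by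
      intro k hk
      simp only [Finset.mem_range] at hk
      rw [cubeSeries, if_neg (by omega), if_neg (by omega), Nat.add_sub_cancel, ← ha', ← hb']
      obtain ⟨j, rfl⟩ : ∃ j, n = k + 1 + j := ⟨n - (k + 1), by omega⟩
      rw [Nat.add_sub_cancel_left, div_pow]
      field_simp
      ring
    have h5 := Finset.sum_congr rfl h4
    rw [← Finset.sum_mul, ← Finset.sum_mul] at h5
    have h6 : cubeSeries n 0 m = b ^ n := by simp [cubeSeries, hb']
    have h7 : cubeSeries n (n + 1) m = a ^ n := by simp [cubeSeries, ha', hm]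
    rw [h6, h7]
    have h8 : b ^ (n + 1) * (a / b) ^ (n + 2) = a ^ (n + 2) / b := by
      rw [div_pow, pow_succ b (n + 1)]; field_simp
    have h9 : b ^ (n + 1) * (4 * m / b) = 4 * m * b ^ n := by
      rw [pow_succ]; field_simp
    have h10 : b ^ n * (a / b) ^ (n + 1) = a ^ (n + 1) / b := by
      rw [div_pow, pow_succ b n]; field_simp
    have h11 : 4 * m * (a ^ (n + 1) / b) - a ^ (n + 2) / b = a ^ (n + 1) := by
      have : a ^ (n + 2) = a * a ^ (n + 1) := by ring
      rw [this, ← mul_div_assoc, ← sub_div, ← sub_mul]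
      have : 4 * m - a = b := by rw [ha', hb']; ring
      rw [this]; field_simp
    have h12 : 4 * m * b ^ n - b ^ (n + 1) = a * b ^ n := by rw [ha', hb']; ring
    calc a * (∑ k ∈ Finset.range n, H (k + 1) * cubeSeries n (k + 1) m + 1 * b ^ n
          + H (n + 1) * a ^ n)
        = (∑ k ∈ Finset.range n, H (k + 1) * cubeSeries n (k + 1) m) * a
          + a * b ^ n + H (n + 1) * a ^ (n + 1) := by ring
      _ = (∑ k ∈ Finset.range n, H (k + 1) * (a / b) ^ (k + 1)) * (4 * m * b ^ n)
          + (4 * m * b ^ n - b ^ (n + 1))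
          + H (n + 1) * (4 * m * (b ^ n * (a / b) ^ (n + 1)) - b ^ (n + 1) * (a / b) ^ (n + 2)) := by
          rw [h5, h12, h10, h8, h11]
      _ = (∑ k ∈ Finset.range n, H (k + 1) * (a / b) ^ (k + 1)) * (4 * m * b ^ n)
          + (4 * m * b ^ n - b ^ (n + 1))
          + H (n + 1) * ((4 * m * b ^ n) * (a / b) ^ (n + 1) - b ^ (n + 1) * (a / b) ^ (n + 2)) := by
          ring
      _ = _ := by rw [← h9]; ring
  apply mul_left_cancel₀ ha
  rw [h2, h3, h]
  ring

section Cubical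

variable {X : Type*} {K : Set (Set X)} {dim : Set X → ℕ}

theorem sum_faceFinset_dim (hK : K.Finite) {n : ℕ} (hn : ∀ σ ∈ K, σ.Nonempty → dim σ ≤ n)
    {M : Type*} [Semiring M] (φ : ℕ → M) :
    ∑ τ ∈ faceFinset hK, φ (dim τ) = ∑ k ∈ Finset.range (n + 1), (fNum K dim k : M) * φ k := by
  classical
  rw [← Finset.sum_fiberwise_of_maps_to (t := Finset.range (n + 1)) (g := dim) fun σ hσ => by
    rw [mem_faceFinset] at hσ
    exact Finset.mem_range.2 (Nat.lt_succ_of_le (hn σ hσ.1 hσ.2))]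
  refine Finset.sum_congr rfl fun k _ => ?_
  rw [Finset.sum_congr rfl (g := fun _ => φ k) fun σ hσ => by rw [(Finset.mem_filter.1 hσ).2],
    Finset.sum_const, nsmul_eq_mul]
  congr 2
  rw [fNum, ← Set.ncard_coe_finset]
  congr 1
  ext σ
  simp [mem_faceFinset, and_assoc]

/-- The `h`-polynomial of the barycentric subdivision of a cubical complex in terms of its cubical
`h`-vector. -/
theorem hPoly_sd_eq_cubeComb (hK : K.Finite) (hc : IsCubical K dim) {n : ℕ}
    (hn : IsGreatest (dim '' {σ | σ ∈ K ∧ σ.Nonempty}) n) :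
    hPoly (sd K) = cubeComb n fun k => (cubicalHPoly n (fNum K dim)).coeff k := by
  apply Polynomial.coe_injective ℝ
  rw [coe_hPoly_sd hK hc, dimSucc_sd hK hc hn, cubeComb, coe_sum]
  have h1 : ∀ k ∈ Finset.range (n + 2),
      ((C ((cubicalHPoly n (fNum K dim)).coeff k) * cubeBasis n k : ℝ[X]) : PowerSeries ℝ)
      = (1 - PowerSeries.X) ^ (n + 1) * PowerSeries.mk fun m =>
        (cubicalHPoly n (fNum K dim)).coeff k * cubeSeries n k m := by
    intro k hk
    simp only [Finset.mem_range] at hk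
    rw [Polynomial.coe_mul, coe_cubeBasis n k (by omega), Polynomial.coe_C, mul_left_comm]
    congr 1
    ext m
    simp
  rw [Finset.sum_congr rfl h1, sum_mul_mk]
  congr 1
  ext m
  simp only [map_add, map_sum, oddPowSeries, PowerSeries.coeff_mk, PowerSeries.coeff_one]
  by_cases hm : m = 0
  · subst hm
    simp only [if_true, Finset.sum_const_zero, add_zero]
    rw [Finset.sum_range_succ, Finset.sum_range_succ', Finset.sum_eq_zero]
    · simp [cubeSeries, coeff_zero_cubicalHPoly]
    · intro k hk
      simp only [Finset.mem_range] at hk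
      rw [cubeSeries, if_neg (by omega), if_neg (by omega)]
      simp
  · rw [sum_cubicalHPoly_mul_cubeSeries n _ hm, if_neg hm, zero_add,
      ← sum_faceFinset_dim hK (fun σ hσ hne => hn.2 ⟨σ, ⟨hσ, hne⟩, rfl⟩)
        fun k => (2 * m - 1 : ℝ) ^ k]
    simp [hm]

theorem interlaces_hPoly_sd (hK : K.Finite) (hc : IsCubical K dim) {n : ℕ}
    (hn : IsGreatest (dim '' {σ | σ ∈ K ∧ σ.Nonempty}) n)
    (hnn : ∀ k ≤ n + 1, 0 ≤ (cubicalHPoly n (fNum K dim)).coeff k) :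
    RealRooted (hPoly (sd K)) ∧ Interlaces (eulerianB n) (hPoly (sd K)) := by
  have h := interlaces_cubeComb (coeff_zero_cubicalHPoly n (fNum K dim)) hnn
  rw [hPoly_sd_eq_cubeComb hK hc hn, eulerianB_eq_cubeBasis]
  exact ⟨h.2.1, h⟩

end Cubical

/-! ### Facets of cubes -/

namespace CubeFace

/-- The whole unit interval, as a face of itself. -/
def full : {s : Finset Bool // s.Nonempty} := ⟨Finset.univ, by simp⟩

/-- The endpoint `b` of the unit interval. -/
def single (b : Bool) : {s : Finset Bool // s.Nonempty} := ⟨{b}, by simp⟩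

/-- The facet of the cube on which the coordinate `i` is fixed to the endpoint `b`. -/
def facet {k : ℕ} (i : Fin k) (b : Bool) : CubeFace k := Function.update (fun _ => full) i (single b)

theorem eq_full_or_single (s : {s : Finset Bool // s.Nonempty}) :
    s = full ∨ ∃ b, s = single b := by
  rcases intervalFace_cases s with h | ⟨b, h⟩
  · exact Or.inl (Subtype.ext h)
  · exact Or.inr ⟨b, Subtype.ext h⟩

theorem full_ne_single (b : Bool) : full ≠ single b := by revert b; decide

theorem single_ne_univ (b : Bool) : (single b).1 ≠ Finset.univ := by revert b; decide

theorem single_injective : Function.Injective single := by decide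

theorem le_single_iff (s : {s : Finset Bool // s.Nonempty}) (b : Bool) :
    s ≤ single b ↔ s = single b := by
  constructor
  · intro h
    have h' : s.1 ⊆ {b} := h
    exact Subtype.ext (((Finset.subset_singleton_iff.1 h').resolve_left s.2.ne_empty))
  · rintro rfl; exact le_rfl

theorem le_facet_iff {k : ℕ} (F : CubeFace k) (i : Fin k) (b : Bool) :
    F ≤ facet i b ↔ F i = single b := by
  rw [← le_single_iff]
  constructor
  · intro h
    have := h i
    rwa [facet, Function.update_self] at this
  · intro h j
    rcases eq_or_ne j i with rfl | hj
    · rwa [facet, Function.update_self]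
    · rw [facet, Function.update_of_ne hj]
      exact Finset.subset_univ _

theorem facet_injective {k : ℕ} {i j : Fin k} {b c : Bool} (h : facet i b = facet j c) :
    i = j ∧ b = c := by
  have h1 := (le_facet_iff (facet i b) j c).1 h.le
  rcases eq_or_ne j i with rfl | hj
  · rw [facet, Function.update_self] at h1
    exact ⟨rfl, single_injective h1⟩
  · rw [facet, Function.update_of_ne hj] at h1
    exact absurd h1 (full_ne_single c)

theorem dim_update {k : ℕ} (F : CubeFace k) (i : Fin k) (b : Bool) (hF : F i = full) :
    dim (Function.update F i (single b)) + 1 = dim F := by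
  have h : (Finset.univ.filter fun j => (Function.update F i (single b) j).1 = Finset.univ)
      = (Finset.univ.filter fun j => (F j).1 = Finset.univ).erase i := by
    ext j
    simp only [Finset.mem_filter, Finset.mem_univ, true_and, Finset.mem_erase]
    rcases eq_or_ne j i with rfl | hj
    · rw [Function.update_self]
      exact ⟨fun h => absurd h (single_ne_univ b), fun h => absurd rfl h.1⟩
    · rw [Function.update_of_ne hj]
      exact ⟨fun h => ⟨hj, h⟩, fun h => h.2⟩
  rw [dim, h, Finset.card_erase_add_one (Finset.mem_filter.2 ⟨Finset.mem_univ _, by rw [hF]; rfl⟩)]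
  rfl

theorem dim_facet {k : ℕ} (i : Fin k) (b : Bool) : dim (facet i b) + 1 = k := by
  rw [facet, dim_update (fun _ => full) i b rfl]
  simp [dim, full]

theorem exists_eq_facet {k : ℕ} (F : CubeFace k) (hF : dim F + 1 = k) : ∃ i b, F = facet i b := by
  have h := Finset.card_filter_add_card_filter_not (s := (Finset.univ : Finset (Fin k)))
    (fun i => (F i).1 = Finset.univ)
  have h1 : (Finset.univ.filter fun i => ¬(F i).1 = Finset.univ).card = 1 := by
    have : dim F + (Finset.univ.filter fun i => ¬(F i).1 = Finset.univ).card = k := by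
      simpa [dim] using h
    omega
  obtain ⟨i, hi⟩ := Finset.card_eq_one.1 h1
  have hi' : ¬(F i).1 = Finset.univ := by
    have : i ∈ Finset.univ.filter fun i => ¬(F i).1 = Finset.univ := by rw [hi]; simp
    exact (Finset.mem_filter.1 this).2
  obtain ⟨b, hb⟩ := (eq_full_or_single (F i)).resolve_left fun h => hi' (by rw [h]; rfl)
  refine ⟨i, b, funext fun j => ?_⟩
  rcases eq_or_ne j i with rfl | hj
  · rw [facet, Function.update_self, hb]
  · rw [facet, Function.update_of_ne hj]
    by_contra hne
    have : j ∈ Finset.univ.filter fun i => ¬(F i).1 = Finset.univ := by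
      simp only [Finset.mem_filter, Finset.mem_univ, true_and]
      exact fun h => hne (Subtype.ext h)
    rw [hi] at this
    exact hj (Finset.mem_singleton.1 this)

theorem exists_eq_update_facet {k : ℕ} (F : CubeFace k) (hF : dim F + 2 = k) {i : Fin k} {b : Bool}
    (h : F ≤ facet i b) : ∃ j c, j ≠ i ∧ F = Function.update (facet j c) i (single b) := by
  have hFi := (le_facet_iff F i b).1 h
  have e : F = Function.update (Function.update F i full) i (single b) := by
    rw [Function.update_idem, ← hFi, Function.update_eq_self]
  have hd := dim_update (Function.update F i full) i b (by simp)
  rw [← e] at hd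
  obtain ⟨j, c, hjc⟩ := exists_eq_facet (Function.update F i full) (by omega)
  refine ⟨j, c, ?_, by rw [← hjc]; exact e⟩
  rintro rfl
  have := congrFun hjc j
  rw [Function.update_self, facet, Function.update_self] at this
  exact full_ne_single c this

theorem update_facet_le {k : ℕ} {i j : Fin k} (hij : j ≠ i) (b c : Bool) :
    Function.update (facet j c) i (single b) ≤ facet i b ∧
      Function.update (facet j c) i (single b) ≤ facet j c := by
  rw [le_facet_iff, le_facet_iff]
  refine ⟨by simp, ?_⟩
  rw [Function.update_of_ne hij, facet, Function.update_self]

theorem dim_update_facet {k : ℕ} {i j : Fin k} (hij : j ≠ i) (b c : Bool) :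
    dim (Function.update (facet j c) i (single b)) + 2 = k := by
  have h1 := dim_update (facet j c) i b (by rw [facet, Function.update_of_ne hij.symm])
  have h2 := dim_facet j c
  omega

/-- Three facets of a cube have a common face unless two of them are opposite. -/
theorem exists_le_facets {k : ℕ} {i j l : Fin k} {b c d : Bool} (hij : i = j → b = c)
    (hil : i = l → b = d) (hjl : j = l → c = d) :
    ∃ F : CubeFace k, F ≤ facet i b ∧ F ≤ facet j c ∧ F ≤ facet l d := by
  refine ⟨Function.update (Function.update (facet l d) j (single c)) i (single b), ?_⟩
  simp only [le_facet_iff]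
  refine ⟨by simp, ?_, ?_⟩
  · rcases eq_or_ne i j with h | h
    · subst h; simp [hij rfl]
    · rw [Function.update_of_ne h.symm]; simp
  · rcases eq_or_ne i l with h | h
    · subst h; simp [hil rfl]
    · rw [Function.update_of_ne h.symm]
      rcases eq_or_ne j l with h | h
      · subst h; simp [hjl rfl]
      · rw [Function.update_of_ne h.symm, facet, Function.update_self]

end CubeFace

/-! ### Antipodal facets of the faces of a cubical complex -/

section Cubical

variable {V : Type*} {K : Set (Set V)} {dim : Set V → ℕ}

/-- `R` is a facet of the face `τ`: a nonempty face of codimension one. -/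
def IsFacetOf (K : Set (Set V)) (dim : Set V → ℕ) (τ R : Set V) : Prop :=
  R ∈ K ∧ R.Nonempty ∧ R ⊆ τ ∧ dim R + 1 = dim τ

/-- The faces `R` and `R'` have no nonempty face in common. For two facets of a cube this means that
they are antipodal. -/
def NoCommonFace (K : Set (Set V)) (R R' : Set V) : Prop :=
  ∀ ρ ∈ K, ρ.Nonempty → ρ ⊆ R → ¬ρ ⊆ R'

/-- A collection `A` of facets of `τ` that contains the antipode of each of its members. -/
def AntipodallyClosed (K : Set (Set V)) (dim : Set V → ℕ) (τ : Set V) (A : Set (Set V)) : Prop :=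
  ∀ R ∈ A, ∀ R', IsFacetOf K dim τ R' → NoCommonFace K R R' → R' ∈ A

/-- The facets of `R` that lie in a member of `A` other than `R`. -/
def restrictFacets (K : Set (Set V)) (dim : Set V → ℕ) (R : Set V) (A : Set (Set V)) :
    Set (Set V) :=
  {G | IsFacetOf K dim R G ∧ ∃ R' ∈ A, R' ≠ R ∧ G ⊆ R'}

theorem exists_eq_facet_of_isFacetOf (hK : K.Finite) (hc : IsCubical K dim) {τ R : Set V}
    (e : FaceBelow K τ ≃o CubeFace (dim τ)) (hR : IsFacetOf K dim τ R) :
    ∃ i b, R = (e.symm (CubeFace.facet i b)).1 := by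
  have h := dim_eq_cubeFace_dim hK hc e ⟨R, hR.1, hR.2.1, hR.2.2.1⟩
  obtain ⟨i, b, hib⟩ := CubeFace.exists_eq_facet (e ⟨R, hR.1, hR.2.1, hR.2.2.1⟩)
    (by rw [← h]; exact hR.2.2.2)
  exact ⟨i, b, by rw [← hib]; simp⟩

theorem isFacetOf_facet (hK : K.Finite) (hc : IsCubical K dim) {τ : Set V}
    (e : FaceBelow K τ ≃o CubeFace (dim τ)) (i : Fin (dim τ)) (b : Bool) :
    IsFacetOf K dim τ (e.symm (CubeFace.facet i b)).1 := by
  have h := (e.symm (CubeFace.facet i b)).2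
  refine ⟨h.1, h.2.1, h.2.2, ?_⟩
  rw [dim_eq_cubeFace_dim hK hc e]
  simpa using CubeFace.dim_facet i b

theorem subset_facet_iff {τ : Set V} {k : ℕ} (e : FaceBelow K τ ≃o CubeFace k) (ρ : FaceBelow K τ)
    (F : CubeFace k) : ρ.1 ⊆ (e.symm F).1 ↔ e ρ ≤ F :=
  ⟨fun h => by rw [← e.le_symm_apply]; exact h, fun h => by rw [← e.le_symm_apply] at h; exact h⟩

theorem noCommonFace_facet_iff {τ : Set V} {k : ℕ} (e : FaceBelow K τ ≃o CubeFace k) {i j : Fin k}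
    {b c : Bool} : NoCommonFace K (e.symm (CubeFace.facet i b)).1
      (e.symm (CubeFace.facet j c)).1 ↔ i = j ∧ b ≠ c := by
  constructor
  · intro h
    by_contra hcon
    have hij : i = j → b = c := by
      intro hij
      by_contra hbc
      exact hcon ⟨hij, hbc⟩
    obtain ⟨F, h1, h2, -⟩ := CubeFace.exists_le_facets hij (l := i) (d := b) (fun _ => rfl)
      fun h => (hij h.symm).symm
    have hF := (e.symm F).2
    exact h _ hF.1 hF.2.1 (e.symm.monotone h1) (e.symm.monotone h2)
  · rintro ⟨rfl, hbc⟩ ρ hρ hne h1 h2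
    have hρτ : ρ ⊆ τ := h1.trans (e.symm _).2.2.2
    have h3 := (subset_facet_iff e ⟨ρ, hρ, hne, hρτ⟩ _).1 h1
    have h4 := (subset_facet_iff e ⟨ρ, hρ, hne, hρτ⟩ _).1 h2
    rw [CubeFace.le_facet_iff] at h3 h4
    exact hbc (CubeFace.single_injective (h3.symm.trans h4))

/-- A facet `G` of a facet `R` of `τ` lies in exactly one further facet of `τ`; it is the common
face of the two. -/
theorem exists_facet_coordinates (hK : K.Finite) (hc : IsCubical K dim) {τ G : Set V}
    (e : FaceBelow K τ ≃o CubeFace (dim τ)) {i : Fin (dim τ)} {b : Bool}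
    (hG : IsFacetOf K dim (e.symm (CubeFace.facet i b)).1 G) :
    ∃ j c, j ≠ i ∧ G ⊆ (e.symm (CubeFace.facet j c)).1 ∧
      (∀ ρ ∈ K, ρ.Nonempty → ρ ⊆ (e.symm (CubeFace.facet i b)).1 →
        ρ ⊆ (e.symm (CubeFace.facet j c)).1 → ρ ⊆ G) ∧
      ∀ R', IsFacetOf K dim τ R' → R' ≠ (e.symm (CubeFace.facet i b)).1 → G ⊆ R' →
        R' = (e.symm (CubeFace.facet j c)).1 := by
  have hGτ : G ⊆ τ := hG.2.2.1.trans (e.symm _).2.2.2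
  have hle := (subset_facet_iff e ⟨G, hG.1, hG.2.1, hGτ⟩ _).1 hG.2.2.1
  have hd := dim_eq_cubeFace_dim hK hc e ⟨G, hG.1, hG.2.1, hGτ⟩
  have hdR := (isFacetOf_facet hK hc e i b).2.2.2
  have hdG := hG.2.2.2
  obtain ⟨j, c, hji, hjc⟩ := CubeFace.exists_eq_update_facet (e ⟨G, hG.1, hG.2.1, hGτ⟩)
    (by rw [← hd]; simp only; omega) hle
  refine ⟨j, c, hji, ?_, ?_, ?_⟩
  · rw [subset_facet_iff e ⟨G, hG.1, hG.2.1, hGτ⟩, hjc]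
    exact (CubeFace.update_facet_le hji b c).2
  · intro ρ hρ hne h1 h2
    have hρτ : ρ ⊆ τ := h1.trans (e.symm _).2.2.2
    rw [subset_facet_iff e ⟨ρ, hρ, hne, hρτ⟩, CubeFace.le_facet_iff] at h1
    rw [subset_facet_iff e ⟨ρ, hρ, hne, hρτ⟩] at h2
    have : e ⟨ρ, hρ, hne, hρτ⟩ ≤ e ⟨G, hG.1, hG.2.1, hGτ⟩ := by
      rw [hjc]
      intro l
      rcases eq_or_ne l i with rfl | hl
      · rw [Function.update_self, h1]
      · rw [Function.update_of_ne hl]; exact h2 l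
    exact e.le_iff_le.1 this
  · intro R' hR' hne hGR'
    obtain ⟨l, d, rfl⟩ := exists_eq_facet_of_isFacetOf hK hc e hR'
    rw [subset_facet_iff e ⟨G, hG.1, hG.2.1, hGτ⟩, hjc, CubeFace.le_facet_iff] at hGR'
    rcases eq_or_ne l i with rfl | hl
    · rw [Function.update_self] at hGR'
      exact absurd (by rw [CubeFace.single_injective hGR']) hne
    · rw [Function.update_of_ne hl, ← CubeFace.le_facet_iff] at hGR'
      have : CubeFace.facet j c = CubeFace.facet l d := by
        rw [CubeFace.le_facet_iff] at hGR'
        rcases eq_or_ne l j with rfl | hlj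
        · rw [CubeFace.facet, Function.update_self] at hGR'
          rw [CubeFace.single_injective hGR']
        · rw [CubeFace.facet, Function.update_of_ne hlj] at hGR'
          exact absurd hGR' (CubeFace.full_ne_single d)
      rw [this]

/-- A facet of a facet of a cube lies in a second facet. -/
theorem exists_second_facet (hK : K.Finite) (hc : IsCubical K dim) {τ R G : Set V} (hτ : τ ∈ K)
    (hR : IsFacetOf K dim τ R) (hG : IsFacetOf K dim R G) :
    ∃ R', IsFacetOf K dim τ R' ∧ R' ≠ R ∧ G ⊆ R' := by
  obtain ⟨e⟩ := hc τ hτ (hR.2.1.mono hR.2.2.1)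
  obtain ⟨i, b, rfl⟩ := exists_eq_facet_of_isFacetOf hK hc e hR
  obtain ⟨j, c, hji, hGj, -, -⟩ := exists_facet_coordinates hK hc e hG
  refine ⟨_, isFacetOf_facet hK hc e j c, fun h => hji ?_, hGj⟩
  exact (CubeFace.facet_injective (e.symm.injective (Subtype.ext h))).1

theorem exists_isFacetOf_of_facets (hK : K.Finite) (hc : IsCubical K dim) {τ R R' : Set V}
    (hτ : τ ∈ K) (hR : IsFacetOf K dim τ R) (hR' : IsFacetOf K dim τ R') (hne : R' ≠ R)
    (hcom : ¬NoCommonFace K R R') : ∃ G, IsFacetOf K dim R G ∧ G ⊆ R' := by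
  obtain ⟨e⟩ := hc τ hτ (hR.2.1.mono hR.2.2.1)
  obtain ⟨i, b, rfl⟩ := exists_eq_facet_of_isFacetOf hK hc e hR
  obtain ⟨j, c, rfl⟩ := exists_eq_facet_of_isFacetOf hK hc e hR'
  rw [noCommonFace_facet_iff] at hcom
  have hij : j ≠ i := by
    rintro rfl
    have : b = c := by
      by_contra h
      exact hcom ⟨rfl, h⟩
    exact hne (by rw [this])
  obtain ⟨h1, h2⟩ := CubeFace.update_facet_le hij b c
  have hG := (e.symm (Function.update (CubeFace.facet j c) i (CubeFace.single b))).2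
  refine ⟨_, ⟨hG.1, hG.2.1, e.symm.monotone h1, ?_⟩, e.symm.monotone h2⟩
  have hd := dim_eq_cubeFace_dim hK hc e
    (e.symm (Function.update (CubeFace.facet j c) i (CubeFace.single b)))
  rw [OrderIso.apply_symm_apply] at hd
  have := CubeFace.dim_update_facet hij b c
  have := hR.2.2.2
  omega

/-- In coordinates: the facets of `R` are cut out by the facets of `τ` other than `R` and its antipode,
and this correspondence preserves antipodes. -/
theorem antipodallyClosed_restrictFacets (hK : K.Finite) (hc : IsCubical K dim) {τ R : Set V}
    {A : Set (Set V)} (hτ : τ ∈ K) (hR : IsFacetOf K dim τ R)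
    (hAf : ∀ R' ∈ A, IsFacetOf K dim τ R') (hA : AntipodallyClosed K dim τ A) :
    AntipodallyClosed K dim R (restrictFacets K dim R A) := by
  obtain ⟨e⟩ := hc τ hτ (hR.2.1.mono hR.2.2.1)
  obtain ⟨i, b, rfl⟩ := exists_eq_facet_of_isFacetOf hK hc e hR
  rintro G ⟨hG, R', hR'A, hR'ne, hGR'⟩ G' hG' hGG'
  refine ⟨hG', ?_⟩
  obtain ⟨j, c, hji, hGj, hGmax, hGuniq⟩ := exists_facet_coordinates hK hc e hG
  obtain ⟨l, d, hli, hGl, hGmax', -⟩ := exists_facet_coordinates hK hc e hG'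
  obtain rfl := hGuniq R' (hAf R' hR'A) hR'ne hGR'
  refine ⟨_, hA _ hR'A _ (isFacetOf_facet hK hc e l d) ?_, ?_, hGl⟩
  · rw [noCommonFace_facet_iff]
    by_contra hcon
    have hjl : j = l → c = d := fun h => by
      by_contra hcd
      exact hcon ⟨h, hcd⟩
    obtain ⟨F, h1, h2, h3⟩ := CubeFace.exists_le_facets (i := i) (b := b)
      (fun h => absurd h.symm hji) (fun h => absurd h.symm hli) hjl
    have hF := (e.symm F).2
    exact hGG' _ hF.1 hF.2.1 (hGmax _ hF.1 hF.2.1 (e.symm.monotone h1) (e.symm.monotone h2))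
      (hGmax' _ hF.1 hF.2.1 (e.symm.monotone h1) (e.symm.monotone h3))
  · intro h
    exact hli (CubeFace.facet_injective (e.symm.injective (Subtype.ext h))).1

/-- If all facets of a member `R` of `A` are cut out by further members of `A`, then `A` contains all
facets: the antipode of `R` by assumption on `A`, and any other facet because it is the only one
besides `R` that contains its intersection with `R`. -/
theorem mem_of_restrictFacets_eq_all (hK : K.Finite) (hc : IsCubical K dim) {τ R : Set V}
    {A : Set (Set V)} (hτ : τ ∈ K) (hRA : R ∈ A)
    (hAf : ∀ R' ∈ A, IsFacetOf K dim τ R') (hA : AntipodallyClosed K dim τ A)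
    (hall : ∀ G, IsFacetOf K dim R G → G ∈ restrictFacets K dim R A) {R' : Set V}
    (hR' : IsFacetOf K dim τ R') : R' ∈ A := by
  rcases eq_or_ne R' R with rfl | hne
  · exact hRA
  by_cases hcom : NoCommonFace K R R'
  · exact hA R hRA R' hR' hcom
  obtain ⟨G, hG, hGR'⟩ := exists_isFacetOf_of_facets hK hc hτ (hAf R hRA) hR' hne hcom
  obtain ⟨-, R'', hR''A, hR''ne, hGR''⟩ := hall G hG
  have hR := hAf R hRA
  obtain ⟨e⟩ := hc τ hτ (hR.2.1.mono hR.2.2.1)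
  obtain ⟨i, b, rfl⟩ := exists_eq_facet_of_isFacetOf hK hc e hR
  obtain ⟨j, c, -, -, -, huniq⟩ := exists_facet_coordinates hK hc e hG
  rw [huniq R' hR' hne hGR', ← huniq R'' (hAf R'' hR''A) hR''ne hGR'']
  exact hR''A

/-- Every facet has an antipode. -/
theorem exists_antipode (hK : K.Finite) (hc : IsCubical K dim) {τ R : Set V}
    (hτ : τ ∈ K) (hR : IsFacetOf K dim τ R) :
    ∃ R', IsFacetOf K dim τ R' ∧ NoCommonFace K R R' := by
  obtain ⟨e⟩ := hc τ hτ (hR.2.1.mono hR.2.2.1)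
  obtain ⟨i, b, rfl⟩ := exists_eq_facet_of_isFacetOf hK hc e hR
  refine ⟨_, isFacetOf_facet hK hc e i (!b), ?_⟩
  rw [noCommonFace_facet_iff]
  simp

/-! ### Decompositions into shelling components -/

open Classical in
/-- Removing from the face poset of a cube the faces contained in a given set `A` of facets: the
coordinate `i` contributes the number `m i` of endpoints not fixed by a member of `A`. -/
theorem exists_block_factorization (hK : K.Finite) (hc : IsCubical K dim) {τ : Set V} (hτ : τ ∈ K)
    (hne : τ.Nonempty) (A : Set (Set V)) (hA : ∀ R ∈ A, IsFacetOf K dim τ R) :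
    ∃ m : Fin (dim τ) → ℕ, (∀ i, m i ≤ 2) ∧
      (∀ t u : ℝ[X], ∑ ρ ∈ (faceFinset hK).filter (fun ρ => ρ ⊆ τ ∧ ∀ R ∈ A, ¬ρ ⊆ R),
        t ^ dim ρ * u ^ (dim τ - dim ρ) = ∏ i, (t + m i * u)) ∧
      (A = ∅ → ∀ i, m i = 2) ∧
      ((∀ i, m i ≠ 1) → AntipodallyClosed K dim τ A) ∧
      ((∀ R, IsFacetOf K dim τ R → R ∈ A) → ∀ i, m i = 0) := by
  obtain ⟨e⟩ := hc τ hτ hne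
  let free : Fin (dim τ) → Bool → ℕ := fun i b => if (e.symm (CubeFace.facet i b)).1 ∈ A then 0 else 1
  have hfree : ∀ i b, free i b ≤ 1 := by intro i b; simp only [free]; split_ifs <;> omega
  refine ⟨fun i => free i false + free i true, ?_, ?_, ?_, ?_, ?_⟩
  · intro i
    have := hfree i false
    have := hfree i true
    show _ + _ ≤ 2
    omega
  · intro t u
    let w : Fin (dim τ) → {s : Finset Bool // s.Nonempty} → ℝ[X] := fun i s =>
      if s.1 = Finset.univ then t else
        u * if ∃ b, s = CubeFace.single b ∧ (e.symm (CubeFace.facet i b)).1 ∈ A then 0 else 1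
    have hw : ∀ i, t + ((free i false + free i true : ℕ) : ℝ[X]) * u = ∑ s, w i s := by
      intro i
      have hb : ∀ b, w i (CubeFace.single b) = u * free i b := by
        intro b
        have h1 := CubeFace.single_ne_univ b
        have h2 : (∃ b', CubeFace.single b = CubeFace.single b' ∧
            (e.symm (CubeFace.facet i b')).1 ∈ A) ↔ (e.symm (CubeFace.facet i b)).1 ∈ A := by
          constructor
          · rintro ⟨b', h, h'⟩
            rwa [CubeFace.single_injective h]
          · exact fun h => ⟨b, rfl, h⟩
        simp only [w, if_neg h1, h2, free]
        split_ifs <;> simp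
      have hf : w i CubeFace.full = t := by simp [w, CubeFace.full]
      have := sum_intervalFace (w i)
      rw [this]
      change _ = w i (CubeFace.single false) + w i (CubeFace.single true) + w i CubeFace.full
      rw [hb, hb, hf]
      push_cast
      ring
    rw [Finset.prod_congr rfl fun i _ => hw i, ← sum_cubeFace_prod, ← Finset.filter_filter,
      Finset.sum_filter, sum_faceBelow hK e]
    refine Finset.sum_congr rfl fun F _ => ?_
    have hd := dim_eq_cubeFace_dim hK hc e (e.symm F)
    rw [OrderIso.apply_symm_apply] at hd
    split_ifs with h
    · have hwF : ∀ i, w i (F i) = if (F i).1 = Finset.univ then t else u := by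
        intro i
        simp only [w]
        split_ifs with h1 h2
        · rfl
        · obtain ⟨b, hb, hbA⟩ := h2
          refine absurd ?_ (h _ hbA)
          rw [subset_facet_iff, OrderIso.apply_symm_apply, CubeFace.le_facet_iff, hb]
        · rw [mul_one]
      rw [Finset.prod_congr rfl fun i _ => hwF i, Finset.prod_ite, Finset.prod_const,
        Finset.prod_const, hd]
      congr 2
      have h1 := Finset.card_filter_add_card_filter_not (s := (Finset.univ : Finset (Fin (dim τ))))
        (fun i => (F i).1 = Finset.univ)
      have h2 : CubeFace.dim F
          + (Finset.univ.filter fun i => ¬(F i).1 = Finset.univ).card = dim τ := by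
        simpa [CubeFace.dim] using h1
      omega
    · push Not at h
      obtain ⟨R, hRA, hR⟩ := h
      obtain ⟨i, b, rfl⟩ := exists_eq_facet_of_isFacetOf hK hc e (hA R hRA)
      rw [subset_facet_iff, OrderIso.apply_symm_apply, CubeFace.le_facet_iff] at hR
      symm
      apply Finset.prod_eq_zero (Finset.mem_univ i)
      have h1 : ¬(F i).1 = Finset.univ := by rw [hR]; exact CubeFace.single_ne_univ b
      simp only [w, if_neg h1]
      rw [if_pos ⟨b, hR, hRA⟩, mul_zero]
  · rintro rfl i
    simp [free]
  · intro h R hR R' hR' hRR'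
    obtain ⟨i, b, rfl⟩ := exists_eq_facet_of_isFacetOf hK hc e (hA R hR)
    obtain ⟨j, c, rfl⟩ := exists_eq_facet_of_isFacetOf hK hc e hR'
    obtain ⟨rfl, hbc⟩ := (noCommonFace_facet_iff e).1 hRR'
    by_contra hcon
    have h1 : free i b = 0 := by simp only [free]; rw [if_pos hR]
    have h2 : free i c = 1 := by simp only [free]; rw [if_neg hcon]
    have h3 : free i false + free i true ≠ 1 := h i
    cases b <;> cases c <;> simp_all
  · intro h i
    have : ∀ b, free i b = 0 := fun b => by
      simp only [free]
      rw [if_pos (h _ (isFacetOf_facet hK hc e i b))]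
    show free i false + free i true = 0
    rw [this, this]

/-- All coefficients are nonnegative. -/
def NonnegCoeffs (p : ℝ[X]) : Prop := ∀ j, 0 ≤ p.coeff j

theorem NonnegCoeffs.add {p q : ℝ[X]} (hp : NonnegCoeffs p) (hq : NonnegCoeffs q) :
    NonnegCoeffs (p + q) := fun j => by rw [coeff_add]; exact add_nonneg (hp j) (hq j)

theorem NonnegCoeffs.mul {p q : ℝ[X]} (hp : NonnegCoeffs p) (hq : NonnegCoeffs q) :
    NonnegCoeffs (p * q) := fun j => by
  rw [coeff_mul]; exact Finset.sum_nonneg fun x _ => mul_nonneg (hp x.1) (hq x.2)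

theorem nonnegCoeffs_one : NonnegCoeffs 1 := fun j => by
  rw [coeff_one]; split_ifs <;> norm_num

theorem nonnegCoeffs_X_pow (k : ℕ) : NonnegCoeffs (X ^ k) := fun j => by
  rw [coeff_X_pow]; split_ifs <;> norm_num

theorem nonnegCoeffs_C {a : ℝ} (ha : 0 ≤ a) : NonnegCoeffs (C a) := fun j => by
  rw [coeff_C]; split_ifs <;> simp [ha]

theorem NonnegCoeffs.prod {ι : Type*} (s : Finset ι) {p : ι → ℝ[X]}
    (h : ∀ i ∈ s, NonnegCoeffs (p i)) : NonnegCoeffs (∏ i ∈ s, p i) :=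
  Finset.prod_induction p NonnegCoeffs (fun _ _ => NonnegCoeffs.mul) nonnegCoeffs_one h

theorem NonnegCoeffs.sum {ι : Type*} (s : Finset ι) {p : ι → ℝ[X]}
    (h : ∀ i ∈ s, NonnegCoeffs (p i)) : NonnegCoeffs (∑ i ∈ s, p i) :=
  Finset.sum_induction p NonnegCoeffs (fun _ _ => NonnegCoeffs.add)
    (fun j => by simp) h

/-- The contribution of a block of faces to the numerator of the cubical `h`-polynomial. A coordinate
with one free endpoint makes the contribution to the Euler characteristic vanish and provides the
factor `1 + x`; if there is no free endpoint at all, then the two terms are `x ^ (n + 1)` and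
`x ^ (n + 2)`. -/
theorem exists_block_contribution {n : ℕ} (m : Fin n → ℕ) (hm : ∀ i, m i ≤ 2)
    (h : (∃ i, m i = 1) ∨ ∀ i, m i = 0) :
    ∃ g, NonnegCoeffs g ∧ X * ∏ i, (X + (m i : ℝ[X]) * (C (1 / 2) * (1 - X)))
      + C ((-1) ^ n) * X ^ (n + 2) * ∏ i, (-1 + (m i : ℝ[X]) * 1) = (1 + X) * g := by
  have hhalf : (X : ℝ[X]) + C (1 / 2) * (1 - X) = C (1 / 2) * (1 + X) := by
    have : (C (1 / 2) : ℝ[X]) * 2 = 1 := by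
      rw [show (2 : ℝ[X]) = C 2 from rfl, ← C_mul]; norm_num
    linear_combination (-X : ℝ[X]) * this
  have hone : (X : ℝ[X]) + 2 * (C (1 / 2) * (1 - X)) = 1 := by
    have : (C (1 / 2) : ℝ[X]) * 2 = 1 := by
      rw [show (2 : ℝ[X]) = C 2 from rfl, ← C_mul]; norm_num
    linear_combination (1 - X : ℝ[X]) * this
  rcases h with ⟨i, hi⟩ | h
  · have h0 : ∏ i, (-1 + (m i : ℝ[X]) * 1) = 0 :=
      Finset.prod_eq_zero (Finset.mem_univ i) (by rw [hi]; simp)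
    rw [h0, ← Finset.mul_prod_erase _ (fun i => X + (m i : ℝ[X]) * (C (1 / 2) * (1 - X)))
      (Finset.mem_univ i), hi, Nat.cast_one, one_mul, hhalf]
    refine ⟨X ^ 1 * (C (1 / 2) * ∏ j ∈ Finset.univ.erase i,
      (X + (m j : ℝ[X]) * (C (1 / 2) * (1 - X)))), ?_, by ring⟩
    refine (nonnegCoeffs_X_pow 1).mul ((nonnegCoeffs_C (by norm_num)).mul
      (NonnegCoeffs.prod _ fun j _ => ?_))
    have := hm j
    interval_cases m j
    · simpa using nonnegCoeffs_X_pow 1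
    · rw [Nat.cast_one, one_mul, hhalf]
      refine (nonnegCoeffs_C (by norm_num)).mul (nonnegCoeffs_one.add ?_)
      simpa using nonnegCoeffs_X_pow 1
    · rw [Nat.cast_ofNat, hone]; exact nonnegCoeffs_one
  · refine ⟨X ^ (n + 1), nonnegCoeffs_X_pow _, ?_⟩
    simp only [h, Nat.cast_zero, zero_mul, add_zero, Finset.prod_const, Finset.card_univ,
      Fintype.card_fin, C_pow, C_neg, C_1]
    have h4 : ((-1 : ℝ[X]) ^ n) * (-1) ^ n = 1 := by rw [← mul_pow]; norm_num
    linear_combination (X : ℝ[X]) ^ (n + 2) * h4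

/-- The numerator of the cubical `h`-polynomial as a sum of contributions of the single faces. -/
theorem cubicalNumerator_fNum (hK : K.Finite) {n : ℕ} (hn : ∀ σ ∈ K, σ.Nonempty → dim σ ≤ n) :
    cubicalNumerator n (fNum K dim) = 1 + C ((-1) ^ n * -1) * X ^ (n + 2) +
      (X * ∑ ρ ∈ faceFinset hK, X ^ dim ρ * (C (1 / 2) * (1 - X)) ^ (n - dim ρ)
        + C ((-1) ^ n) * X ^ (n + 2) *
          ∑ ρ ∈ faceFinset hK, (-1 : ℝ[X]) ^ dim ρ * 1 ^ (n - dim ρ)) := by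
  have key := fun φ : ℕ → ℝ[X] => sum_faceFinset_dim hK hn φ
  rw [key fun k => X ^ k * (C (1 / 2) * (1 - X)) ^ (n - k), key fun k => (-1) ^ k * 1 ^ (n - k),
    cubicalNumerator, reducedEuler, Finset.mul_sum]
  have h1 : ∀ k, (fNum K dim k : ℝ[X]) * ((-1) ^ k * 1 ^ (n - k))
      = C ((-1) ^ k * (fNum K dim k : ℝ)) := by intro k; simp [mul_comm]
  simp only [h1]
  rw [← map_sum, mul_add, C_add, C_mul (a := (-1) ^ n) (b := Finset.sum _ _)]
  have h2 : ∀ k, X * ((fNum K dim k : ℝ[X]) * (X ^ k * (C (1 / 2) * (1 - X)) ^ (n - k)))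
      = (fNum K dim k : ℝ[X]) * X ^ (k + 1) * (C (1 / 2) * (1 - X)) ^ (n - k) := by intro k; ring
  simp only [h2]
  ring

/-- The facets of `τ` that lie in a member of `T` of smaller rank. -/
def earlierFacets (K : Set (Set V)) (dim : Set V → ℕ) (T : Finset (Set V)) (rank : Set V → ℝ)
    (τ : Set V) : Set (Set V) :=
  {R | IsFacetOf K dim τ R ∧ ∃ τ' ∈ T, rank τ' < rank τ ∧ R ⊆ τ'}

/-- Nonnegativity of the cubical `h`-vector from an ordering of the facets such that each facet `τ`
after the first meets the earlier ones in a union of facets of `τ`, and such that the collection of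
these facets of `τ` is either everything or contains a facet without its antipode. -/
theorem cubicalHPoly_nonneg (hK : K.Finite) (hc : IsCubical K dim) {n : ℕ} (T : Finset (Set V))
    (hTne : T.Nonempty) (hT : ∀ τ ∈ T, τ ∈ K ∧ τ.Nonempty ∧ dim τ = n)
    (hcov : ∀ σ ∈ K, σ.Nonempty → ∃ τ ∈ T, σ ⊆ τ) (rank : Set V → ℝ)
    (hinj : Set.InjOn rank (T : Set (Set V)))
    (hmeet : ∀ τ ∈ T, ∀ τ' ∈ T, rank τ' < rank τ → ∀ σ ∈ K, σ.Nonempty → σ ⊆ τ → σ ⊆ τ' →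
      ∃ R ∈ earlierFacets K dim T rank τ, σ ⊆ R)
    (hall : ∀ τ ∈ T, (∃ τ' ∈ T, rank τ' < rank τ) →
      AntipodallyClosed K dim τ (earlierFacets K dim T rank τ) →
        ∀ R, IsFacetOf K dim τ R → R ∈ earlierFacets K dim T rank τ) (j : ℕ) :
    0 ≤ (cubicalHPoly n (fNum K dim)).coeff j := by
  classical
  -- The faces of `τ` that lie in no earlier facet; these blocks partition the set of all faces.
  let block : Set V → Finset (Set V) := fun τ => (faceFinset hK).filter
    fun ρ => ρ ⊆ τ ∧ ∀ R ∈ earlierFacets K dim T rank τ, ¬ρ ⊆ R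
  have hblock : ∀ τ ∈ T, ∀ ρ, ρ ∈ block τ ↔ ρ ∈ faceFinset hK ∧ ρ ⊆ τ ∧
      ∀ τ' ∈ T, rank τ' < rank τ → ¬ρ ⊆ τ' := by
    intro τ hτ ρ
    simp only [block, Finset.mem_filter]
    refine and_congr_right fun hρ => and_congr_right fun hρτ => ?_
    rw [mem_faceFinset] at hρ
    constructor
    · intro h τ' hτ' hlt hρτ'
      obtain ⟨R, hR, hρR⟩ := hmeet τ hτ τ' hτ' hlt ρ hρ.1 hρ.2 hρτ hρτ'
      exact h R hR hρR
    · rintro h R ⟨-, τ', hτ', hlt, hRτ'⟩ hρR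
      exact h τ' hτ' hlt (hρR.trans hRτ')
  have hunion : faceFinset hK = T.biUnion block := by
    ext ρ
    rw [Finset.mem_biUnion]
    constructor
    · intro hρ
      obtain ⟨τ, hτ, hρτ⟩ := hcov ρ (mem_faceFinset.1 hρ).1 (mem_faceFinset.1 hρ).2
      obtain ⟨τ', hτ', hmin⟩ := Finset.exists_min_image (T.filter (ρ ⊆ ·)) rank
        ⟨τ, Finset.mem_filter.2 ⟨hτ, hρτ⟩⟩
      rw [Finset.mem_filter] at hτ'
      refine ⟨τ', hτ'.1, (hblock τ' hτ'.1 ρ).2 ⟨hρ, hτ'.2, fun τ'' hτ'' hlt h => ?_⟩⟩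
      exact absurd (hmin τ'' (Finset.mem_filter.2 ⟨hτ'', h⟩)) (not_le.2 hlt)
    · rintro ⟨τ, hτ, hρ⟩
      exact ((hblock τ hτ ρ).1 hρ).1
  have hdisj : (T : Set (Set V)).PairwiseDisjoint block := by
    intro τ hτ τ' hτ' hne
    refine Finset.disjoint_left.2 fun ρ hρ hρ' => ?_
    obtain ⟨-, h1, h2⟩ := (hblock τ hτ ρ).1 hρ
    obtain ⟨-, h3, h4⟩ := (hblock τ' hτ' ρ).1 hρ'
    rcases lt_trichotomy (rank τ) (rank τ') with h | h | h
    · exact h4 τ hτ h h1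
    · exact hne (hinj hτ hτ' h)
    · exact h2 τ' hτ' h h3
  have hdim : ∀ σ ∈ K, σ.Nonempty → dim σ ≤ n := by
    intro σ hσ hne
    obtain ⟨τ, hτ, hστ⟩ := hcov σ hσ hne
    rw [← (hT τ hτ).2.2]
    exact dim_le_of_subset hK hc hσ hne (hT τ hτ).1 hστ
  obtain ⟨τ₀, hτ₀, hmin⟩ := Finset.exists_min_image T rank hTne
  let contrib : Set V → ℝ[X] := fun τ =>
    X * ∑ ρ ∈ block τ, X ^ dim ρ * (C (1 / 2) * (1 - X)) ^ (n - dim ρ)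
      + C ((-1) ^ n) * X ^ (n + 2) * ∑ ρ ∈ block τ, (-1 : ℝ[X]) ^ dim ρ * 1 ^ (n - dim ρ)
  have hnum : cubicalNumerator n (fNum K dim)
      = (1 + C ((-1) ^ n * -1) * X ^ (n + 2) + contrib τ₀) + ∑ τ ∈ T.erase τ₀, contrib τ := by
    rw [cubicalNumerator_fNum hK hdim, hunion, Finset.sum_biUnion hdisj, Finset.sum_biUnion hdisj,
      Finset.mul_sum, Finset.mul_sum, ← Finset.sum_add_distrib, add_assoc _ (contrib τ₀),
      Finset.add_sum_erase T contrib hτ₀]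
  have hfac : ∀ τ ∈ T, ∃ m : Fin n → ℕ, (∀ i, m i ≤ 2) ∧
      contrib τ = X * ∏ i, (X + (m i : ℝ[X]) * (C (1 / 2) * (1 - X)))
        + C ((-1) ^ n) * X ^ (n + 2) * ∏ i, (-1 + (m i : ℝ[X]) * 1) ∧
      (earlierFacets K dim T rank τ = ∅ → ∀ i, m i = 2) ∧
      ((∀ i, m i ≠ 1) → AntipodallyClosed K dim τ (earlierFacets K dim T rank τ)) ∧
      ((∀ R, IsFacetOf K dim τ R → R ∈ earlierFacets K dim T rank τ) → ∀ i, m i = 0) := by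
    intro τ hτ
    obtain ⟨h1, h2, h3⟩ := hT τ hτ
    subst h3
    obtain ⟨m, hm, hsum, hrest⟩ := exists_block_factorization hK hc h1 h2
      (earlierFacets K dim T rank τ) fun R hR => hR.1
    exact ⟨m, hm, by simp only [contrib, block]; rw [hsum, hsum], hrest⟩
  have hothers : ∀ τ ∈ T.erase τ₀, ∃ g, NonnegCoeffs g ∧ contrib τ = (1 + X) * g := by
    intro τ hτ
    rw [Finset.mem_erase] at hτ
    obtain ⟨m, hm, hcon, -, h1, h2⟩ := hfac τ hτ.2
    have hlt : rank τ₀ < rank τ := lt_of_le_of_ne (hmin τ hτ.2) fun h =>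
      hτ.1 (hinj hτ.2 hτ₀ h.symm)
    rw [hcon]
    refine exists_block_contribution m hm ?_
    by_cases hex : ∃ i, m i = 1
    · exact Or.inl hex
    · push Not at hex
      exact Or.inr (h2 (hall τ hτ.2 ⟨τ₀, hτ₀, hlt⟩ (h1 hex)))
  -- The first block is the face poset of a whole cube.
  have hfirst : 1 + C ((-1) ^ n * -1) * X ^ (n + 2) + contrib τ₀ = (1 + X) * (1 : ℝ[X]) := by
    obtain ⟨m, -, hcon, h0, -⟩ := hfac τ₀ hτ₀
    have hm := h0 <| Set.eq_empty_of_forall_notMem <| by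
      rintro R ⟨-, τ', hτ', hlt, -⟩
      exact absurd (hmin τ' hτ') (not_le.2 hlt)
    have hone : (X : ℝ[X]) + 2 * (C (1 / 2) * (1 - X)) = 1 := by
      have : (C (1 / 2) : ℝ[X]) * 2 = 1 := by
        rw [show (2 : ℝ[X]) = C 2 from rfl, ← C_mul]; norm_num
      linear_combination (1 - X : ℝ[X]) * this
    rw [hcon]
    simp only [hm, Nat.cast_ofNat, hone, Finset.prod_const_one, mul_one]
    rw [show (-1 : ℝ[X]) + 2 = 1 by norm_num, Finset.prod_const_one, C_mul, C_neg, C_1]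
    ring
  have hg : ∀ τ, ∃ g, τ ∈ T.erase τ₀ → NonnegCoeffs g ∧ contrib τ = (1 + X) * g := by
    intro τ
    by_cases h : τ ∈ T.erase τ₀
    · obtain ⟨g, hg⟩ := hothers τ h
      exact ⟨g, fun _ => hg⟩
    · exact ⟨0, fun h' => absurd h' h⟩
  choose g hg using hg
  have hX : (1 + X : ℝ[X]) ≠ 0 := by
    intro h
    have := congrArg (eval 0) h
    simp at this
  have heq : cubicalHPoly n (fNum K dim) = 1 + ∑ τ ∈ T.erase τ₀, g τ := by
    apply mul_left_cancel₀ hX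
    rw [one_add_X_mul_cubicalHPoly, hnum, hfirst, mul_add, Finset.mul_sum,
      Finset.sum_congr rfl fun τ hτ => (hg τ hτ).2]
  rw [heq]
  exact (nonnegCoeffs_one.add (NonnegCoeffs.sum _ fun τ hτ => (hg τ hτ).1)) j

end Cubical

/-! ### Shellings of cubical complexes -/

section Shelling

variable {V : Type*} {K : Set (Set V)} {dim : Set V → ℕ}

/-- A face that is covered by faces of the complex lies in one of them. -/
def CoverProperty (K : Set (Set V)) : Prop :=
  ∀ σ ∈ K, σ.Nonempty → ∀ S ⊆ K, σ ⊆ ⋃₀ S → ∃ τ ∈ S, σ ⊆ τ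

theorem IsShelling.isPure {d : ℕ} {m : ℕ} {τ : Fin m → Set V} (h : IsShelling dim d K m τ) :
    IsPure K dim d ∧ Function.Injective τ ∧ Set.range τ = {σ | Maximal (· ∈ K) σ} := by
  cases d with
  | zero => exact h
  | succ d => exact ⟨h.1, h.2.1, h.2.2.1⟩

theorem exists_maximal_superset {S : Set (Set V)} (hS : S.Finite) {σ : Set V} (hσ : σ ∈ S) :
    ∃ τ, Maximal (· ∈ S) τ ∧ σ ⊆ τ := by
  obtain ⟨τ, h1, h2⟩ := hS.exists_le_maximal hσ
  exact ⟨τ, h2, h1⟩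

theorem isFacetOf_of_maximal_boundary (hK : K.Finite) {τ : Set V} {d : ℕ}
    (hd : dim τ = d + 1) {S : Set (Set V)} (hS : S ⊆ boundary K τ) (hp : IsPure S dim d)
    {σ : Set V} (hσ : σ ∈ S) : ∃ R ∈ S, IsFacetOf K dim τ R ∧ σ ⊆ R := by
  have hfin : S.Finite := hK.subset fun ρ hρ => (hS hρ).1
  obtain ⟨R, hR, hσR⟩ := exists_maximal_superset hfin hσ
  refine ⟨R, hR.1, ⟨(hS hR.1).1, ?_, (hS hR.1).2.1, by rw [hp.2 R hR, hd]⟩, hσR⟩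
  obtain ⟨ρ, hρ, hne⟩ := hp.1
  by_contra hcon
  rw [Set.not_nonempty_iff_eq_empty] at hcon
  have := hR.2 hρ (by rw [hcon]; exact Set.empty_subset _)
  rw [hcon] at this
  exact hne.ne_empty (Set.subset_empty_iff.1 this)

theorem maximal_boundary_iff (hK : K.Finite) (hc : IsCubical K dim) {τ : Set V} (hτ : τ ∈ K)
    {d : ℕ} (hd : dim τ = d + 1) (hp : IsPure (boundary K τ) dim d) (R : Set V) :
    Maximal (· ∈ boundary K τ) R ↔ IsFacetOf K dim τ R := by
  constructor
  · intro h
    obtain ⟨R', h1, h2, h3⟩ := isFacetOf_of_maximal_boundary hK hd subset_rfl hp h.1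
    rwa [h3.antisymm (h.2 h1 h3)]
  · intro h
    have hne : R ≠ τ := by rintro rfl; exact absurd h.2.2.2 (by omega)
    refine ⟨⟨h.1, h.2.2.1.ssubset_of_ne hne⟩, fun σ hσ hRσ => ?_⟩
    have hlt := dim_lt_of_ssubset hK hc hσ.1 (h.2.1.mono hRσ) hτ hσ.2
    exact (eq_of_subset_of_dim_le hK hc h.1 h.2.1 hσ.1 hRσ (by have := h.2.2.2; omega)).ge

theorem boundary_boundary {τ R : Set V} (h : R ⊆ τ) : boundary (boundary K τ) R = boundary K R := by
  ext σ
  exact ⟨fun hσ => ⟨hσ.1.1, hσ.2⟩, fun hσ => ⟨⟨hσ.1, hσ.2.trans_subset h⟩, hσ.2⟩⟩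

theorem subset_iUnion_iff (hU : CoverProperty K) {σ : Set V} (hσ : σ ∈ K) (hne : σ.Nonempty)
    {l : ℕ} {ρ : Fin l → Set V} (hρ : ∀ i, ρ i ∈ K) (j : Fin l) :
    (σ ⊆ ⋃ i : {i : Fin l // i < j}, ρ i) ↔ ∃ i < j, σ ⊆ ρ i := by
  constructor
  · intro h
    rw [← Set.sUnion_range] at h
    obtain ⟨_, ⟨i, rfl⟩, hi⟩ := hU σ hσ hne _ (by rintro _ ⟨i, rfl⟩; exact hρ i) h
    exact ⟨i, i.2, hi⟩
  · rintro ⟨i, hi, h⟩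
    exact h.trans (Set.subset_iUnion (fun i : {i : Fin l // i < j} => ρ i) ⟨i, hi⟩)

/-- A nonempty initial segment of a shelling of the boundary of a cube that contains the antipode of
each of its members contains all facets. By induction on the dimension: the last facet `R` of the
segment meets the previous ones in an initial segment of a shelling of the boundary of `R`, which is
antipodally closed as well. -/
theorem mem_initial_segment (hK : K.Finite) (hc : IsCubical K dim) (hU : CoverProperty K) (d : ℕ)
    {τ : Set V} (hτ : τ ∈ K) (hd : dim τ = d + 1) {l : ℕ} {ρ : Fin l → Set V}
    (hρ : IsShelling dim d (boundary K τ) l ρ) {r : ℕ}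
    (hA : AntipodallyClosed K dim τ (ρ '' {s | (s : ℕ) < r})) (hne : ∃ s : Fin l, (s : ℕ) < r)
    {R : Set V} (hR : IsFacetOf K dim τ R) : R ∈ ρ '' {s | (s : ℕ) < r} := by
  induction d generalizing τ l r R with
  | zero =>
    obtain ⟨hp, -, hrange⟩ := hρ.isPure
    have hfac : ∀ s, IsFacetOf K dim τ (ρ s) := fun s => by
      rw [← maximal_boundary_iff hK hc hτ hd hp]
      have : ρ s ∈ Set.range ρ := ⟨s, rfl⟩
      rwa [hrange] at this
    obtain ⟨s, hs⟩ := hne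
    have hsA : ρ s ∈ ρ '' {s | (s : ℕ) < r} := ⟨s, hs, rfl⟩
    refine mem_of_restrictFacets_eq_all hK hc hτ hsA ?_ hA ?_ hR
    · rintro _ ⟨s, -, rfl⟩; exact hfac s
    · intro G hG
      have h1 := hG.2.2.2
      have h2 := (hfac s).2.2.2
      omega
  | succ d ih =>
    obtain ⟨hp, hinj, hrange, -, hstep⟩ := hρ
    have hfac : ∀ s, IsFacetOf K dim τ (ρ s) := fun s => by
      rw [← maximal_boundary_iff hK hc hτ hd hp]
      have : ρ s ∈ Set.range ρ := ⟨s, rfl⟩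
      rwa [hrange] at this
    have hfacA : ∀ R' ∈ ρ '' {s | (s : ℕ) < r}, IsFacetOf K dim τ R' := by
      rintro _ ⟨s, -, rfl⟩; exact hfac s
    obtain ⟨s₀, hs₀, hmax⟩ := Finset.exists_max_image
      (Finset.univ.filter fun s : Fin l => (s : ℕ) < r) id (by simpa [Finset.Nonempty] using hne)
    simp only [Finset.mem_filter, Finset.mem_univ, true_and, id] at hs₀ hmax
    have hs₀A : ρ s₀ ∈ ρ '' {s | (s : ℕ) < r} := ⟨s₀, hs₀, rfl⟩
    have hpos : 0 < (s₀ : ℕ) := by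
      obtain ⟨R', hR', hcom⟩ := exists_antipode hK hc hτ (hfac s₀)
      obtain ⟨s, hs, rfl⟩ := hA _ hs₀A R' hR' hcom
      have hne : s ≠ s₀ := by
        rintro rfl
        exact hcom _ (hfac s).1 (hfac s).2.1 subset_rfl subset_rfl
      have := hmax s hs
      omega
    obtain ⟨hpure, l', ρ', hρ', r', hr'⟩ := hstep s₀ hpos
    rw [boundary_boundary (hfac s₀).2.2.1] at hpure hρ'
    have hdR : dim (ρ s₀) = d + 1 := by have := (hfac s₀).2.2.2; omega
    obtain ⟨hp', -, hrange'⟩ := hρ'.isPure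
    have hcov : ∀ G, IsFacetOf K dim (ρ s₀) G →
        ((G ⊆ ⋃ i : {i : Fin l // i < s₀}, ρ i) ↔ ∃ i < s₀, G ⊆ ρ i) := fun G hG =>
      subset_iUnion_iff hU hG.1 hG.2.1 (fun i => (hfac i).1) s₀
    have hseg : ρ' '' {s | (s : ℕ) < r'}
        = restrictFacets K dim (ρ s₀) (ρ '' {s | (s : ℕ) < r}) := by
      ext G
      constructor
      · rintro ⟨s, hs, rfl⟩
        have hG : IsFacetOf K dim (ρ s₀) (ρ' s) := by
          rw [← maximal_boundary_iff hK hc (hfac s₀).1 hdR hp']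
          have : ρ' s ∈ Set.range ρ' := ⟨s, rfl⟩
          rwa [hrange'] at this
        obtain ⟨i, hi, hGi⟩ := (hcov _ hG).1 ((hr' s).2 hs)
        refine ⟨hG, ρ i, ⟨i, ?_, rfl⟩, fun h => hi.ne (hinj h), hGi⟩
        exact lt_trans (Fin.lt_def.1 hi) hs₀
      · rintro ⟨hG, _, ⟨i, hi, rfl⟩, hne, hGi⟩
        have hi' : i < s₀ := lt_of_le_of_ne (hmax i hi) fun h => hne (by rw [h])
        have hmem : G ∈ Set.range ρ' := by
          rw [hrange']
          exact (maximal_boundary_iff hK hc (hfac s₀).1 hdR hp' G).2 hG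
        obtain ⟨s, rfl⟩ := hmem
        exact ⟨s, (hr' s).1 ((hcov _ hG).2 ⟨i, hi', hGi⟩), rfl⟩
    refine mem_of_restrictFacets_eq_all hK hc hτ hs₀A hfacA hA ?_ hR
    intro G hG
    rw [← hseg]
    refine ih (hfac s₀).1 hdR hρ' ?_ ?_ hG
    · rw [hseg]
      exact antipodallyClosed_restrictFacets hK hc hτ (hfac s₀) hfacA hA
    · obtain ⟨σ, hσ, -⟩ := hpure.1
      obtain ⟨M, hM, hMf, -⟩ := isFacetOf_of_maximal_boundary hK hdR (fun ρ hρ => hρ.1) hpure hσ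
      have hmem : M ∈ Set.range ρ' := by
        rw [hrange']
        exact (maximal_boundary_iff hK hc (hfac s₀).1 hdR hp' M).2 hMf
      obtain ⟨s, rfl⟩ := hmem
      exact ⟨s, (hr' s).1 hM.2⟩

/-- The order of a shelling satisfies the hypotheses of `cubicalHPoly_nonneg`; the condition on
antipodes is `mem_initial_segment`. -/
theorem cubicalHPoly_nonneg_of_isShelling (hK : K.Finite) (hc : IsCubical K dim)
    (hU : CoverProperty K) {n : ℕ} (hn : IsGreatest (dim '' {σ | σ ∈ K ∧ σ.Nonempty}) n)
    {d m : ℕ} {τ : Fin m → Set V} (h : IsShelling dim d K m τ) (j : ℕ) :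
    0 ≤ (cubicalHPoly n (fNum K dim)).coeff j := by
  classical
  obtain ⟨hp, hinj, hrange⟩ := h.isPure
  have hmax : ∀ i, Maximal (· ∈ K) (τ i) := fun i => by
    have : τ i ∈ Set.range τ := ⟨i, rfl⟩
    rwa [hrange] at this
  have hcov : ∀ σ ∈ K, ∃ i, σ ⊆ τ i := by
    intro σ hσ
    obtain ⟨M, hM, hσM⟩ := exists_maximal_superset hK hσ
    have : M ∈ Set.range τ := by rw [hrange]; exact hM
    obtain ⟨i, rfl⟩ := this
    exact ⟨i, hσM⟩
  have hne : ∀ i, (τ i).Nonempty := by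
    intro i
    obtain ⟨σ, hσ, hσne⟩ := hp.1
    by_contra hcon
    rw [Set.not_nonempty_iff_eq_empty] at hcon
    have := (hmax i).2 hσ (by rw [hcon]; exact Set.empty_subset _)
    rw [hcon] at this
    exact hσne.ne_empty (Set.subset_empty_iff.1 this)
  have hdim : ∀ i, dim (τ i) = d := fun i => hp.2 _ (hmax i)
  have hdn : d = n := by
    obtain ⟨σ, hσ, hσn⟩ := hn.1
    obtain ⟨i, hi⟩ := hcov σ hσ.1
    have h1 := dim_le_of_subset hK hc hσ.1 hσ.2 (hmax i).1 hi
    have h2 := hn.2 ⟨τ i, ⟨(hmax i).1, hne i⟩, rfl⟩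
    rw [hdim] at h1 h2
    omega
  subst hdn
  have hnotle : ∀ i i', i ≠ i' → ¬τ i ⊆ τ i' := fun i i' hii' hle =>
    hii' (hinj (hle.antisymm ((hmax i).2 (hmax i').1 hle)))
  let rank : Set V → ℝ := Function.extend τ (fun i => (i : ℝ)) 0
  have hrank : ∀ i, rank (τ i) = ((i : ℕ) : ℝ) := fun i => hinj.extend_apply _ _ i
  have hrlt : ∀ i i', rank (τ i) < rank (τ i') ↔ i < i' := by
    intro i i'
    rw [hrank, hrank, Nat.cast_lt, Fin.lt_def]
  have hearlier : ∀ (i : Fin m) R, R ∈ earlierFacets K dim (Finset.univ.image τ) rank (τ i) ↔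
      IsFacetOf K dim (τ i) R ∧ R ⊆ ⋃ i' : {i' : Fin m // i' < i}, τ i' := by
    intro i R
    refine and_congr_right fun hR => ?_
    rw [subset_iUnion_iff hU hR.1 hR.2.1 (fun i => (hmax i).1)]
    constructor
    · rintro ⟨_, hi', hlt, hsub⟩
      obtain ⟨i', -, rfl⟩ := Finset.mem_image.1 hi'
      exact ⟨i', (hrlt _ _).1 hlt, hsub⟩
    · rintro ⟨i', hlt, hsub⟩
      exact ⟨τ i', Finset.mem_image_of_mem _ (Finset.mem_univ _), (hrlt _ _).2 hlt, hsub⟩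
  refine cubicalHPoly_nonneg hK hc (Finset.univ.image τ) ?_ ?_ ?_ rank ?_ ?_ ?_ j
  · obtain ⟨σ, hσ, -⟩ := hp.1
    obtain ⟨i, -⟩ := hcov σ hσ
    exact ⟨τ i, Finset.mem_image_of_mem _ (Finset.mem_univ _)⟩
  · intro σ hσ
    obtain ⟨i, -, rfl⟩ := Finset.mem_image.1 hσ
    exact ⟨(hmax i).1, hne i, hdim i⟩
  · intro σ hσ _
    obtain ⟨i, hi⟩ := hcov σ hσ
    exact ⟨τ i, Finset.mem_image_of_mem _ (Finset.mem_univ _), hi⟩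
  · intro σ hσ σ' hσ' heq
    obtain ⟨i, -, rfl⟩ := Finset.mem_image.1 hσ
    obtain ⟨i', -, rfl⟩ := Finset.mem_image.1 hσ'
    rw [hrank, hrank, Nat.cast_inj] at heq
    rw [Fin.ext heq]
  · intro σ hσ σ' hσ' hlt ρ hρ hρne hρσ hρσ'
    obtain ⟨i, -, rfl⟩ := Finset.mem_image.1 hσ
    obtain ⟨i', -, rfl⟩ := Finset.mem_image.1 hσ'
    rw [hrlt] at hlt
    have hρne' : ρ ≠ τ i := by
      rintro rfl
      exact hnotle i i' hlt.ne' hρσ'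
    have hss := hρσ.ssubset_of_ne hρne'
    have hddim := hdim i
    cases d with
    | zero =>
      have := dim_lt_of_ssubset hK hc hρ hρne (hmax i).1 hss
      omega
    | succ d =>
      obtain ⟨hpure, -⟩ := h.2.2.2.2 i (by rw [Fin.lt_def] at hlt; omega)
      obtain ⟨M, hM, hMf, hρM⟩ := isFacetOf_of_maximal_boundary hK hddim (fun ρ hρ => hρ.1) hpure
        (σ := ρ) ⟨⟨hρ, hss⟩, hρσ'.trans (Set.subset_iUnion
          (fun i' : {i' : Fin m // i' < i} => τ i') ⟨i', hlt⟩)⟩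
      exact ⟨M, (hearlier i M).2 ⟨hMf, hM.2⟩, hρM⟩
  · rintro σ hσ ⟨σ', hσ', hlt⟩ hanti R hR
    obtain ⟨i, -, rfl⟩ := Finset.mem_image.1 hσ
    obtain ⟨i', -, rfl⟩ := Finset.mem_image.1 hσ'
    rw [hrlt, Fin.lt_def] at hlt
    have hddim := hdim i
    cases d with
    | zero =>
      have := hR.2.2.2
      omega
    | succ d =>
      obtain ⟨hpure, l, ρ, hρ, r, hr⟩ := h.2.2.2.2 i (by omega)
      obtain ⟨hp', -, hrange'⟩ := hρ.isPure
      have hfac : ∀ G, G ∈ Set.range ρ ↔ IsFacetOf K dim (τ i) G := by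
        intro G
        rw [hrange', ← maximal_boundary_iff hK hc (hmax i).1 hddim hp']
        rfl
      have hseg : earlierFacets K dim (Finset.univ.image τ) rank (τ i)
          = ρ '' {s | (s : ℕ) < r} := by
        ext G
        rw [hearlier]
        constructor
        · rintro ⟨hG, hGU⟩
          obtain ⟨s, rfl⟩ := (hfac G).2 hG
          exact ⟨s, (hr s).1 hGU, rfl⟩
        · rintro ⟨s, hs, rfl⟩
          exact ⟨(hfac _).1 ⟨s, rfl⟩, (hr s).2 hs⟩
      rw [hseg] at hanti ⊢
      refine mem_initial_segment hK hc hU d (hmax i).1 hddim hρ hanti ?_ hR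
      obtain ⟨σ, hσ, -⟩ := hpure.1
      obtain ⟨M, hM, hMf, -⟩ := isFacetOf_of_maximal_boundary hK hddim (fun ρ hρ => hρ.1) hpure hσ
      obtain ⟨s, rfl⟩ := (hfac M).2 hMf
      exact ⟨s, (hr s).1 hM.2⟩

end Shelling

/-! ### Covers of cells by cells -/

/-- A cell that contains the center of a cell `σ` contains `σ`, as the relative interiors of the cells
are disjoint. -/
theorem RegularCellComplex.coverProperty {X : Type*} [TopologicalSpace X]
    (L : RegularCellComplex X) : CoverProperty L.cells := by
  intro σ hσ hne S hS hcov
  let c : Metric.closedBall (0 : EuclideanSpace ℝ (Fin (L.dim σ))) 1 := ⟨0, by simp⟩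
  let x : X := L.homeo ⟨σ, hσ, hne⟩ c
  have hxσ : x ∈ σ := (L.homeo ⟨σ, hσ, hne⟩ c).2
  -- Unless the center `x` is in the relative interior of `τ`, it is in a smaller cell.
  have key : ∀ k, ∀ τ ∈ L.cells, {ρ | ρ ∈ L.cells ∧ ρ ⊆ τ}.ncard = k → x ∈ τ → σ ⊆ τ := by
    intro k
    induction k using Nat.strong_induction_on with
    | _ k ih =>
      intro τ hτ hk hx
      have hτne : τ.Nonempty := ⟨x, hx⟩
      obtain ⟨p, hp⟩ := (L.homeo ⟨τ, hτ, hτne⟩).surjective ⟨x, hx⟩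
      have hp' : (L.homeo ⟨τ, hτ, hτne⟩ p : X) = x := congrArg Subtype.val hp
      have hpn : ‖p.1‖ ≤ 1 := mem_closedBall_zero_iff.1 p.2
      rcases hpn.lt_or_eq with hlt | heq
      · obtain ⟨ρ, -, huniq⟩ := L.partition x
        have h1 := huniq ⟨σ, hσ, hne⟩ ⟨c, by simp [c], rfl⟩
        have h2 := huniq ⟨τ, hτ, hτne⟩ ⟨p, hlt, hp'⟩
        have h3 := congrArg Subtype.val (h1.trans h2.symm)
        exact h3.le
      · obtain ⟨S', hS', hbd⟩ := L.boundary_eq ⟨τ, hτ, hτne⟩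
        have hxb : x ∈ ⋃₀ S' := by
          rw [← hbd]
          exact ⟨p, heq, hp'⟩
        obtain ⟨ρ, hρS', hxρ⟩ := hxb
        have hρτ : ρ ⊆ τ := by
          intro y hy
          have : y ∈ ⋃₀ S' := ⟨ρ, hρS', hy⟩
          rw [← hbd] at this
          obtain ⟨q, -, rfl⟩ := this
          exact (L.homeo ⟨τ, hτ, hτne⟩ q).2
        have hne' : ρ ≠ τ := by
          rintro rfl
          let c' : Metric.closedBall (0 : EuclideanSpace ℝ (Fin (L.dim ρ))) 1 := ⟨0, by simp⟩
          have : (L.homeo ⟨ρ, hτ, hτne⟩ c' : X) ∈ ⋃₀ S' :=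
            ⟨ρ, hρS', (L.homeo ⟨ρ, hτ, hτne⟩ c').2⟩
          rw [← hbd] at this
          obtain ⟨q, hq, hqc⟩ := this
          have : q = c' := (L.homeo ⟨ρ, hτ, hτne⟩).injective (Subtype.ext hqc)
          rw [this] at hq
          simp [c'] at hq
        refine (ih _ ?_ ρ (hS' hρS') rfl hxρ).trans hρτ
        rw [← hk]
        refine Set.ncard_lt_ncard ?_ (L.finite_cells.subset fun _ h => h.1)
        refine ⟨fun a ha => ⟨ha.1, ha.2.trans hρτ⟩, fun hcon => ?_⟩
        exact hne' (hρτ.antisymm (hcon (a := τ) ⟨hτ, subset_rfl⟩).2)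
  obtain ⟨τ, hτ, hx⟩ := hcov hxσ
  exact ⟨τ, hτ, key _ τ (hS hτ) rfl hx⟩

/-! ### Faces of polytopes -/

section Polytope

variable {E : Type*} [NormedAddCommGroup E] [NormedSpace ℝ E]

/-- The affine function `b` is nonpositive on `P`, and `R` is its zero set in `P`. -/
def Supports (P R : Set E) (b : E →ᵃ[ℝ] ℝ) : Prop :=
  (∀ y ∈ P, b y ≤ 0) ∧ R = {y ∈ P | b y = 0}

theorem linear_sub (b : E →ᵃ[ℝ] ℝ) (x y : E) : b.linear (x - y) = b x - b y :=
  b.linearMap_vsub x y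

theorem mem_affineSpan_iff_sub_mem {P : Set E} {p x : E} (hp : p ∈ P) :
    x ∈ affineSpan ℝ P ↔ x - p ∈ vectorSpan ℝ P := by
  rw [← direction_affineSpan]
  exact (AffineSubspace.vsub_right_mem_direction_iff_mem (subset_affineSpan ℝ P hp) x).symm

theorem exists_supports {P R : Set E} (h : IsExposed ℝ P R) (hne : R.Nonempty) :
    ∃ b : E →ᵃ[ℝ] ℝ, Supports P R b := by
  obtain ⟨l, hl⟩ := h hne
  obtain ⟨x₀, hx₀⟩ := hne
  refine ⟨l.toLinearMap.toAffineMap - AffineMap.const ℝ E (l x₀), ?_, ?_⟩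
  · intro y hy
    have := hx₀
    rw [hl] at this
    simpa using this.2 y hy
  · have h0 := hx₀
    rw [hl] at h0
    rw [hl]
    ext x
    constructor
    · rintro ⟨hx, hmax⟩
      refine ⟨hx, ?_⟩
      have h1 := hmax x₀ h0.1
      have h2 := h0.2 x hx
      simp only [AffineMap.coe_sub, Pi.sub_apply, LinearMap.coe_toAffineMap,
        AffineMap.coe_const, Function.const_apply, ContinuousLinearMap.coe_coe]
      linarith
    · rintro ⟨hx, hx0⟩
      simp only [AffineMap.coe_sub, Pi.sub_apply, LinearMap.coe_toAffineMap,
        AffineMap.coe_const, Function.const_apply, ContinuousLinearMap.coe_coe] at hx0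
      exact ⟨hx, fun y hy => by have := h0.2 y hy; linarith⟩

theorem nonpos_of_mem_convexHull {S : Set E} {b : E →ᵃ[ℝ] ℝ} (hb : ∀ s ∈ S, b s ≤ 0) {x : E}
    (hx : x ∈ convexHull ℝ S) : b x ≤ 0 := by
  have hconv : Convex ℝ {y | b y ≤ 0} := by
    rw [convex_iff_forall_pos]
    intro y hy z hz α β hα hβ hαβ
    change b y ≤ 0 at hy
    change b z ≤ 0 at hz
    change b _ ≤ 0
    rw [Convex.combo_affine_apply hαβ, smul_eq_mul, smul_eq_mul]
    nlinarith
  exact convexHull_min hb hconv hx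

theorem zero_of_mem_convexHull {S : Set E} {b : E →ᵃ[ℝ] ℝ} (hb : ∀ s ∈ S, b s = 0) {x : E}
    (hx : x ∈ convexHull ℝ S) : b x = 0 := by
  refine le_antisymm (nonpos_of_mem_convexHull (fun s hs => (hb s hs).le) hx) ?_
  have := nonpos_of_mem_convexHull (b := -b) (fun s hs => by simp [hb s hs]) hx
  simpa using this

theorem zeros_convexHull {S : Set E} {b : E →ᵃ[ℝ] ℝ} (hb : ∀ s ∈ S, b s ≤ 0) :
    {x ∈ convexHull ℝ S | b x = 0} = convexHull ℝ {s ∈ S | b s = 0} := by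
  apply Set.Subset.antisymm
  · have hconv : Convex ℝ {y | b y < 0 ∨ b y = 0 ∧ y ∈ convexHull ℝ {s ∈ S | b s = 0}} := by
      rw [convex_iff_forall_pos]
      intro y hy z hz α β hα hβ hαβ
      change _ ∨ _
      rw [Convex.combo_affine_apply hαβ, smul_eq_mul, smul_eq_mul]
      rcases hy with hy | ⟨hy, hy'⟩ <;> rcases hz with hz | ⟨hz, hz'⟩
      · left; nlinarith
      · left; rw [hz]; nlinarith
      · left; rw [hy]; nlinarith
      · right
        exact ⟨by rw [hy, hz]; ring, convex_convexHull ℝ _ hy' hz' hα.le hβ.le hαβ⟩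
    have hsub : S ⊆ {y | b y < 0 ∨ b y = 0 ∧ y ∈ convexHull ℝ {s ∈ S | b s = 0}} := by
      intro s hs
      rcases (hb s hs).lt_or_eq with h | h
      · exact Or.inl h
      · exact Or.inr ⟨h, subset_convexHull ℝ _ ⟨hs, h⟩⟩
    rintro x ⟨hx, hx0⟩
    rcases convexHull_min hsub hconv hx with h | h
    · exact absurd hx0 h.ne
    · exact h.2
  · intro x hx
    exact ⟨convexHull_mono (fun s hs => hs.1) hx, zero_of_mem_convexHull (fun s hs => hs.2) hx⟩

theorem IsPolytope.exists_of_isExposed {P R : Set E} (hP : IsPolytope P) (h : IsExposed ℝ P R) :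
    IsPolytope R := by
  classical
  rcases R.eq_empty_or_nonempty with rfl | hne
  · exact ⟨∅, by simp⟩
  obtain ⟨S, rfl⟩ := hP
  obtain ⟨b, hb1, rfl⟩ := exists_supports h hne
  refine ⟨S.filter fun s => b s = 0, ?_⟩
  rw [zeros_convexHull fun s hs => hb1 s (subset_convexHull ℝ _ hs)]
  simp

theorem IsPolytope.finite_faces {P : Set E} (hP : IsPolytope P) : (polytopeFaces P).Finite := by
  classical
  obtain ⟨S, rfl⟩ := hP
  refine (S.powerset.finite_toSet.image fun T : Finset E => convexHull ℝ (T : Set E)).subset ?_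
  intro R hR
  rcases R.eq_empty_or_nonempty with rfl | hne
  · exact ⟨∅, by simp, by simp⟩
  obtain ⟨b, hb1, rfl⟩ := exists_supports hR hne
  refine ⟨S.filter fun s => b s = 0,
    Finset.mem_coe.2 (Finset.mem_powerset.2 (Finset.filter_subset _ _)), ?_⟩
  rw [zeros_convexHull fun s hs => hb1 s (subset_convexHull ℝ _ hs)]
  simp

theorem vectorSpan_le_ker {R : Set E} {b : E →ᵃ[ℝ] ℝ} (h : ∀ y ∈ R, b y = 0) :
    vectorSpan ℝ R ≤ LinearMap.ker b.linear := by
  rw [vectorSpan, Submodule.span_le]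
  rintro _ ⟨x, hx, y, hy, rfl⟩
  change b.linear (x - y) = 0
  rw [linear_sub, h x hx, h y hy, sub_zero]

theorem zero_of_mem_affineSpan {R : Set E} {b : E →ᵃ[ℝ] ℝ} (h : ∀ y ∈ R, b y = 0) {x : E}
    (hx : x ∈ affineSpan ℝ R) : b x = 0 := by
  obtain ⟨r, hr⟩ : R.Nonempty := by
    rw [← affineSpan_nonempty (k := ℝ)]; exact ⟨x, hx⟩
  have h1 := vectorSpan_le_ker h ((mem_affineSpan_iff_sub_mem hr).1 hx)
  rw [LinearMap.mem_ker, linear_sub, h r hr, sub_zero] at h1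
  exact h1

theorem reflect_mem_affineSpan {P : Set E} {r p : E} (hr : r ∈ P) (hp : p ∈ P) :
    r + (r - p) ∈ affineSpan ℝ P := by
  rw [mem_affineSpan_iff_sub_mem hr, add_sub_cancel_left]
  exact vsub_mem_vectorSpan ℝ hr hp

theorem apply_reflect (b : E →ᵃ[ℝ] ℝ) (r p : E) : b (r + (r - p)) = 2 * b r - b p := by
  have h1 := linear_sub b (r + (r - p)) r
  rw [add_sub_cancel_left, linear_sub] at h1
  linarith

/-- A point of a polytope that lies on no proper face. -/
theorem exists_interior_point {P : Set E} (hP : IsPolytope P) (hne : P.Nonempty) :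
    ∃ p ∈ P, ∀ b : E →ᵃ[ℝ] ℝ, (∀ y ∈ P, b y ≤ 0) → b p = 0 → ∀ y ∈ P, b y = 0 := by
  obtain ⟨S, rfl⟩ := hP
  rw [convexHull_nonempty_iff, Finset.coe_nonempty] at hne
  have hcard : (0 : ℝ) < S.card := by exact_mod_cast hne.card_pos
  have hsum : ∑ _s ∈ S, (S.card : ℝ)⁻¹ = 1 := by
    rw [Finset.sum_const, nsmul_eq_mul, mul_inv_cancel₀ hcard.ne']
  refine ⟨∑ s ∈ S, (S.card : ℝ)⁻¹ • s, (convex_convexHull ℝ _).sum_mem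
    (fun _ _ => (inv_pos.2 hcard).le) hsum fun s hs => subset_convexHull ℝ _ hs, ?_⟩
  intro b hb h0 y hy
  have hbp : b (∑ s ∈ S, (S.card : ℝ)⁻¹ • s) = ∑ s ∈ S, (S.card : ℝ)⁻¹ * b s := by
    have hdec : ∀ z, b z = b.linear z + b 0 := fun z => by
      have := linear_sub b z 0
      rw [sub_zero] at this
      linarith
    rw [hdec, map_sum]
    simp only [map_smul, smul_eq_mul]
    have hs : ∑ s ∈ S, (S.card : ℝ)⁻¹ * b s
        = ∑ s ∈ S, ((S.card : ℝ)⁻¹ * b.linear s + (S.card : ℝ)⁻¹ * b 0) :=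
      Finset.sum_congr rfl fun s _ => by rw [hdec s, mul_add]
    rw [hs, Finset.sum_add_distrib, ← Finset.sum_mul, hsum, one_mul]
  rw [hbp, Finset.sum_eq_zero_iff_of_nonpos] at h0
  · refine zero_of_mem_convexHull (fun s hs => ?_) hy
    have := h0 s hs
    exact (mul_eq_zero.1 this).resolve_left (inv_pos.2 hcard).ne'
  · intro s hs
    exact mul_nonpos_of_nonneg_of_nonpos (inv_pos.2 hcard).le (hb s (subset_convexHull ℝ _ hs))

variable [FiniteDimensional ℝ E]

theorem Supports.isExposed {P R : Set E} {b : E →ᵃ[ℝ] ℝ} (h : Supports P R b) :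
    IsExposed ℝ P R := by
  rintro ⟨x₀, hx₀⟩
  refine ⟨b.linear.toContinuousLinearMap, ?_⟩
  have hl : ∀ x y, b.linear y ≤ b.linear x ↔ b y ≤ b x := by
    intro x y
    have := linear_sub b x y
    rw [map_sub] at this
    constructor <;> intro <;> linarith
  rw [h.2] at hx₀ ⊢
  ext x
  simp only [LinearMap.coe_toContinuousLinearMap', hl]
  constructor
  · rintro ⟨hx, hx0⟩
    exact ⟨hx, fun y hy => by rw [hx0]; exact h.1 y hy⟩
  · rintro ⟨hx, hmax⟩
    exact ⟨hx, le_antisymm (h.1 x hx) (by have := hmax x₀ hx₀.1; rwa [hx₀.2] at this)⟩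

/-- A face of a face of a polytope is a face. -/
theorem IsPolytope.isExposed_trans {P F G : Set E} (hP : IsPolytope P) (hF : IsExposed ℝ P F)
    (hG : IsExposed ℝ F G) : IsExposed ℝ P G := by
  rcases G.eq_empty_or_nonempty with rfl | hne
  · exact isExposed_empty
  obtain ⟨S, rfl⟩ := hP
  obtain ⟨b, hb, rfl⟩ := exists_supports hF (hne.mono hG.subset)
  obtain ⟨b', hb', rfl⟩ := exists_supports hG hne
  have hbS : ∀ s ∈ S, b s ≤ 0 := fun s hs => hb s (subset_convexHull ℝ _ hs)
  have hF' := zeros_convexHull (S := (S : Set E)) (b := b) hbS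
  have hbS' : ∀ s ∈ S, b s = 0 → b' s ≤ 0 := fun s hs h0 =>
    hb' s ⟨subset_convexHull ℝ _ hs, h0⟩
  -- For large `N`, the function `N * b + b'` is negative at the vertices outside of `F`.
  have hN : ∀ᶠ N : ℝ in Filter.atTop, ∀ s ∈ S, b s < 0 → N * b s + b' s < 0 := by
    rw [Filter.eventually_all_finset]
    intro s _
    by_cases hs : b s < 0
    · have := (Filter.tendsto_atBot_add_const_right Filter.atTop (b' s)
        (Filter.tendsto_id.atTop_mul_const_of_neg hs)).eventually_lt_atBot 0
      exact this.mono fun N h _ => h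
    · exact Filter.Eventually.of_forall fun N h => absurd h hs
  obtain ⟨N, hN⟩ := hN.exists
  have hval : ∀ x, (N • b + b') x = N * b x + b' x := fun x => by simp
  have hle : ∀ s ∈ (S : Set E), (N • b + b') s ≤ 0 := by
    intro s hs
    rw [hval]
    rcases (hbS s hs).lt_or_eq with h | h
    · exact (hN s hs h).le
    · rw [h, mul_zero, zero_add]; exact hbS' s hs h
  refine Supports.isExposed (b := N • b + b') ⟨fun y hy => nonpos_of_mem_convexHull hle hy, ?_⟩
  rw [zeros_convexHull hle, hF', zeros_convexHull]
  · congr 1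
    ext s
    constructor
    · rintro ⟨⟨hs, h0⟩, h0'⟩
      exact ⟨hs, by rw [hval, h0, h0']; ring⟩
    · rintro ⟨hs, h0⟩
      rw [hval] at h0
      rcases (hbS s hs).lt_or_eq with h | h
      · exact absurd h0 (hN s hs h).ne
      · rw [h] at h0
        exact ⟨⟨hs, h⟩, by linarith⟩
  · rintro s ⟨hs, h0⟩
    exact hbS' s hs h0

/-! ### Dimensions of faces -/

theorem affineDim_lt {P R : Set E} (hRP : R ⊆ P) (hne : R.Nonempty) {b : E →ᵃ[ℝ] ℝ}
    (hR : ∀ y ∈ R, b y = 0) {x : E} (hx : x ∈ affineSpan ℝ P) (hbx : b x ≠ 0) :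
    affineDim R < affineDim P := by
  obtain ⟨r, hr⟩ := hne
  refine Submodule.finrank_lt_finrank_of_lt (lt_of_le_of_ne (vectorSpan_mono ℝ hRP) fun h => ?_)
  have h1 := (mem_affineSpan_iff_sub_mem (hRP hr)).1 hx
  rw [← h] at h1
  have h2 := vectorSpan_le_ker hR h1
  rw [LinearMap.mem_ker, linear_sub, hR r hr, sub_zero] at h2
  exact hbx h2

/-- The affine span of a facet is cut out by its supporting function. -/
theorem mem_affineSpan_facet {P R : Set E} {b : E →ᵃ[ℝ] ℝ} (h : Supports P R b) (hne : R.Nonempty)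
    (hd : affineDim R + 1 = affineDim P) {x : E} (hx : x ∈ affineSpan ℝ P) (hbx : b x = 0) :
    x ∈ affineSpan ℝ R := by
  obtain ⟨r, hr⟩ := hne
  have hsub : R ⊆ P := by rw [h.2]; exact fun y hy => hy.1
  have hR0 : ∀ y ∈ R, b y = 0 := fun y hy => by rw [h.2] at hy; exact hy.2
  have hRP : R ≠ P := by rintro rfl; omega
  obtain ⟨p, hp, hpR⟩ := Set.exists_of_ssubset (hsub.ssubset_of_ne hRP)
  have hle : vectorSpan ℝ R ≤ vectorSpan ℝ P ⊓ LinearMap.ker b.linear :=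
    le_inf (vectorSpan_mono ℝ hsub) (vectorSpan_le_ker hR0)
  have hlt : vectorSpan ℝ P ⊓ LinearMap.ker b.linear < vectorSpan ℝ P := by
    refine lt_of_le_of_ne inf_le_left fun heq => hpR ?_
    have h1 : p - r ∈ vectorSpan ℝ P := vsub_mem_vectorSpan ℝ hp (hsub hr)
    rw [← heq] at h1
    have h2 : p - r ∈ LinearMap.ker b.linear := h1.2
    rw [LinearMap.mem_ker, linear_sub, hR0 r hr, sub_zero] at h2
    rw [h.2]; exact ⟨hp, h2⟩
  have hlt' := Submodule.finrank_lt_finrank_of_lt hlt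
  have heq := Submodule.eq_of_le_of_finrank_le hle (by
    change affineDim R + 1 = Module.finrank ℝ (vectorSpan ℝ P) at hd
    change _ ≤ affineDim R
    omega)
  rw [mem_affineSpan_iff_sub_mem hr, heq]
  refine ⟨(mem_affineSpan_iff_sub_mem (hsub hr)).1 hx, ?_⟩
  change x - r ∈ LinearMap.ker b.linear
  rw [LinearMap.mem_ker, linear_sub, hbx, hR0 r hr, sub_zero]

/-- Two supporting functions of a facet are proportional on the affine span of the polytope. -/
theorem exists_pos_mul_eq {P R : Set E} {b b' : E →ᵃ[ℝ] ℝ} (h : Supports P R b)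
    (h' : Supports P R b') (hne : R.Nonempty) (hd : affineDim R + 1 = affineDim P) :
    ∃ c : ℝ, 0 < c ∧ ∀ x ∈ affineSpan ℝ P, b' x = c * b x := by
  obtain ⟨r, hr⟩ := hne
  have hsub : R ⊆ P := by rw [h.2]; exact fun y hy => hy.1
  have hR0 : ∀ y ∈ R, b y = 0 := fun y hy => by rw [h.2] at hy; exact hy.2
  have hR0' : ∀ y ∈ R, b' y = 0 := fun y hy => by rw [h'.2] at hy; exact hy.2
  have hRP : R ≠ P := by rintro rfl; omega
  obtain ⟨p, hp, hpR⟩ := Set.exists_of_ssubset (hsub.ssubset_of_ne hRP)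
  have hbp : b p < 0 := lt_of_le_of_ne (h.1 p hp) fun h0 => hpR (by rw [h.2]; exact ⟨hp, h0⟩)
  have hbp' : b' p < 0 := lt_of_le_of_ne (h'.1 p hp) fun h0 => hpR (by rw [h'.2]; exact ⟨hp, h0⟩)
  refine ⟨b' p / b p, div_pos_of_neg_of_neg hbp' hbp, fun x hx => ?_⟩
  set y : E := x - (b x / b p) • (p - r) with hy
  have hlin : ∀ d : E →ᵃ[ℝ] ℝ, d r = 0 → d y = d x - b x / b p * d p := by
    intro d hd
    have h2 := linear_sub d y x
    have h3 := linear_sub d p r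
    rw [hy, sub_sub_cancel_left, map_neg, map_smul, h3, hd, smul_eq_mul] at h2
    rw [hy]
    linarith
  have hby : b y = 0 := by
    rw [hlin b (hR0 r hr), div_mul_cancel₀ _ hbp.ne, sub_self]
  have hyP : y ∈ affineSpan ℝ P := by
    rw [mem_affineSpan_iff_sub_mem (hsub hr)] at hx ⊢
    have : y - r = (x - r) - (b x / b p) • (p - r) := by rw [hy]; abel
    rw [this]
    exact Submodule.sub_mem _ hx (Submodule.smul_mem _ _ (vsub_mem_vectorSpan ℝ hp (hsub hr)))
  have hyR := mem_affineSpan_facet h ⟨r, hr⟩ hd hyP hby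
  have hby' := zero_of_mem_affineSpan hR0' hyR
  rw [hlin b' (hR0' r hr)] at hby'
  field_simp at hby' ⊢
  linarith

/-! ### Existence of facets -/

theorem exists_linear_of_not_le {W V : Submodule ℝ E} (h : ¬V ≤ W) :
    ∃ φ : E →ₗ[ℝ] ℝ, (∀ w ∈ W, φ w = 0) ∧ ∃ v ∈ V, φ v ≠ 0 := by
  obtain ⟨v, hv, hvW⟩ := SetLike.not_le_iff_exists.1 h
  obtain ⟨φ, h1, h2⟩ := Submodule.exists_dual_map_eq_bot_of_notMem hvW inferInstance
  refine ⟨φ, fun w hw => ?_, v, hv, h1⟩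
  have : φ w ∈ Submodule.map φ W := ⟨w, hw, rfl⟩
  rw [h2] at this
  exact this

/-- A valid inequality of a polytope that is violated at a point `x` of its affine span can be
rotated, while keeping the points of the polytope where it is tight, to one that is violated at `x`
and defines a facet. -/
theorem exists_facet_of_pos {P : Set E} (hP : IsPolytope P) {b₀ : E →ᵃ[ℝ] ℝ}
    (hb₀ : ∀ y ∈ P, b₀ y ≤ 0) {x : E} (hx : x ∈ affineSpan ℝ P) (hbx : 0 < b₀ x) :
    ∃ (b : E →ᵃ[ℝ] ℝ) (R : Set E), Supports P R b ∧ 0 < b x ∧ (∀ y ∈ P, b₀ y = 0 → y ∈ R) ∧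
      R.Nonempty ∧ affineDim R + 1 = affineDim P := by
  classical
  obtain ⟨S, rfl⟩ := hP
  have hSP := subset_convexHull ℝ (S : Set E)
  obtain ⟨p₀, hp₀⟩ : (convexHull ℝ (S : Set E)).Nonempty := by
    rw [← affineSpan_nonempty (k := ℝ)]; exact ⟨x, hx⟩
  suffices H : ∀ k, ∀ b : E →ᵃ[ℝ] ℝ, (∀ s ∈ S, b s ≤ 0) → 0 < b x → (∀ s ∈ S, b₀ s = 0 → b s = 0) →
      S.card - (S.filter fun s => b s = 0).card = k → ∃ (b : E →ᵃ[ℝ] ℝ) (R : Set E),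
      Supports (convexHull ℝ (S : Set E)) R b ∧ 0 < b x ∧
      (∀ y ∈ convexHull ℝ (S : Set E), b₀ y = 0 → y ∈ R) ∧
      R.Nonempty ∧ affineDim R + 1 = affineDim (convexHull ℝ (S : Set E)) from
    H _ b₀ (fun s hs => hb₀ s (hSP hs)) hbx (fun _ _ h => h) rfl
  intro k
  induction k using Nat.strong_induction_on with
  | _ k ih =>
    intro b hbS hbx hb₀b hk
    have hbP : ∀ y ∈ convexHull ℝ (S : Set E), b y ≤ 0 := fun y hy =>
      nonpos_of_mem_convexHull hbS hy
    set A : Set E := {s ∈ (S : Set E) | b s = 0} with hA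
    have hAP : A ⊆ convexHull ℝ (S : Set E) := fun s hs => hSP hs.1
    by_cases hW : vectorSpan ℝ (convexHull ℝ (S : Set E)) ≤ vectorSpan ℝ (insert x A)
    · refine ⟨b, {y ∈ convexHull ℝ (S : Set E) | b y = 0}, ⟨hbP, rfl⟩, hbx, ?_, ?_⟩
      · intro y hy hy0
        have : y ∈ convexHull ℝ {s ∈ (S : Set E) | b₀ s = 0} := by
          rw [← zeros_convexHull fun s hs => hb₀ s (hSP hs)]; exact ⟨hy, hy0⟩
        exact ⟨hy, zero_of_mem_convexHull (fun s hs => hb₀b s hs.1 hs.2) this⟩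
      · have hAne : A.Nonempty := by
          by_contra hcon
          rw [Set.not_nonempty_iff_eq_empty] at hcon
          rw [hcon, insert_empty_eq, vectorSpan_singleton, le_bot_iff] at hW
          have h1 := (mem_affineSpan_iff_sub_mem hp₀).1 hx
          rw [hW, Submodule.mem_bot, sub_eq_zero] at h1
          rw [h1] at hbx
          exact absurd (hbP _ hp₀) (not_le.2 hbx)
        rw [zeros_convexHull hbS]
        have hRne : (convexHull ℝ A).Nonempty := convexHull_nonempty_iff.2 hAne
        refine ⟨hRne, ?_⟩
        have h1 : affineDim (convexHull ℝ A) < affineDim (convexHull ℝ (S : Set E)) :=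
          affineDim_lt (convexHull_mono fun s hs => hs.1) hRne
            (fun y hy => zero_of_mem_convexHull (fun s hs => hs.2) hy) hx hbx.ne'
        have h2 : vectorSpan ℝ (convexHull ℝ A) = vectorSpan ℝ A := by
          rw [← direction_affineSpan, affineSpan_convexHull, direction_affineSpan]
        have h3 := finrank_vectorSpan_insert_le_set ℝ A x
        have h4 := Submodule.finrank_mono hW
        have h5 : affineDim (convexHull ℝ A) = Module.finrank ℝ (vectorSpan ℝ A) := by
          rw [affineDim, h2]
        change affineDim (convexHull ℝ (S : Set E)) ≤ _ at h4
        change affineDim (convexHull ℝ A) + 1 = _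
        omega
    · obtain ⟨φ, hφ, v, hv, hφv⟩ := exists_linear_of_not_le hW
      have hφA : ∀ s ∈ A, φ (s - x) = 0 := fun s hs =>
        hφ _ (vsub_mem_vectorSpan ℝ (Set.mem_insert_of_mem x hs) (Set.mem_insert x A))
      -- Orient `φ` such that it is positive somewhere.
      obtain ⟨ψ, hψA, s₁, hs₁, hψs₁⟩ : ∃ ψ : E →ₗ[ℝ] ℝ, (∀ s ∈ A, ψ (s - x) = 0) ∧
          ∃ s ∈ S, 0 < ψ (s - x) := by
        by_contra hcon
        push Not at hcon
        have h1 := hcon φ hφA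
        have h2 := hcon (-φ) fun s hs => by simp only [LinearMap.neg_apply, hφA s hs, neg_zero]
        have h3 : ∀ s ∈ (S : Set E), φ.toAffineMap s - φ x = 0 := by
          intro s hs
          have a1 := h1 s hs
          have a2 := h2 s hs
          rw [LinearMap.neg_apply] at a2
          rw [LinearMap.coe_toAffineMap, ← map_sub]
          linarith
        have h4 : ∀ s ∈ (S : Set E), (φ.toAffineMap - AffineMap.const ℝ E (φ x)) s = 0 := h3
        have h5 := vectorSpan_le_ker (fun y hy => zero_of_mem_convexHull h4 hy) hv
        rw [LinearMap.mem_ker, AffineMap.sub_linear, AffineMap.const_linear, sub_zero] at h5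
        exact hφv h5
      obtain ⟨s₂, hs₂, hmin⟩ := Finset.exists_min_image (S.filter fun s => 0 < ψ (s - x))
        (fun s => -b s / ψ (s - x)) ⟨s₁, Finset.mem_filter.2 ⟨hs₁, hψs₁⟩⟩
      rw [Finset.mem_filter] at hs₂
      set c : ℝ := -b s₂ / ψ (s₂ - x) with hc
      have hc0 : 0 ≤ c := div_nonneg (by have := hbS s₂ hs₂.1; linarith) hs₂.2.le
      set b' : E →ᵃ[ℝ] ℝ := b + c • (ψ.toAffineMap - AffineMap.const ℝ E (ψ x)) with hb'
      have hval : ∀ y, b' y = b y + c * ψ (y - x) := fun y => by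
        rw [map_sub]; simp [hb']
      have hA' : ∀ s ∈ S, b s = 0 → b' s = 0 := by
        intro s hs h0
        rw [hval, h0, hψA s ⟨hs, h0⟩]; ring
      refine ih _ ?_ b' ?_ ?_ (fun s hs h => hA' s hs (hb₀b s hs h)) rfl
      · rw [← hk]
        refine Nat.sub_lt_sub_left (Finset.card_lt_card ?_) (Finset.card_lt_card ?_)
        · refine Finset.filter_ssubset.2 ⟨s₂, hs₂.1, fun h0 => ?_⟩
          exact hs₂.2.ne' (hψA s₂ ⟨hs₂.1, h0⟩)
        · refine (Finset.ssubset_iff_of_subset fun s hs => ?_).2 ⟨s₂, ?_, ?_⟩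
          · rw [Finset.mem_filter] at hs ⊢
            exact ⟨hs.1, hA' s hs.1 hs.2⟩
          · rw [Finset.mem_filter, hval, hc, div_mul_cancel₀ _ hs₂.2.ne']
            exact ⟨hs₂.1, by ring⟩
          · rw [Finset.mem_filter]
            exact fun h => hs₂.2.ne' (hψA s₂ h)
      · intro s hs
        rw [hval]
        rcases le_or_gt (ψ (s - x)) 0 with h | h
        · have := hbS s hs
          nlinarith
        · have := hmin s (Finset.mem_filter.2 ⟨hs, h⟩)
          rw [le_div_iff₀ h] at this
          linarith
      · rw [hval, sub_self, map_zero, mul_zero, add_zero]; exact hbx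

/-- Every proper face of a polytope lies in a facet. -/
theorem exists_facet_superset {P R : Set E} (hP : IsPolytope P) (hR : IsExposed ℝ P R)
    (hne : R.Nonempty) (hRP : R ≠ P) :
    ∃ F, IsExposed ℝ P F ∧ R ⊆ F ∧ affineDim F + 1 = affineDim P := by
  obtain ⟨b₀, hb₀⟩ := exists_supports hR hne
  obtain ⟨p, hp, hpR⟩ := Set.exists_of_ssubset (hR.subset.ssubset_of_ne hRP)
  obtain ⟨r, hr⟩ := hne
  have hr0 : b₀ r = 0 := by rw [hb₀.2] at hr; exact hr.2
  have hp0 : b₀ p < 0 := lt_of_le_of_ne (hb₀.1 p hp) fun h0 => hpR (by rw [hb₀.2]; exact ⟨hp, h0⟩)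
  obtain ⟨b, F, hF, -, hsub, -, hd⟩ := exists_facet_of_pos hP hb₀.1
    (reflect_mem_affineSpan (hR.subset hr) hp) (by rw [apply_reflect]; linarith)
  exact ⟨F, hF.isExposed, fun y hy => hsub y (hR.subset hy) (by rw [hb₀.2] at hy; exact hy.2), hd⟩

/-- A face properly contained in a face `F` lies in a facet that does not contain `F`. -/
theorem exists_facet_superset_not_superset {P F R : Set E} (hP : IsPolytope P)
    (hF : IsExposed ℝ P F) (hR : IsExposed ℝ P R) (hne : R.Nonempty) (hRF : R ⊂ F) :
    ∃ F', IsExposed ℝ P F' ∧ R ⊆ F' ∧ affineDim F' + 1 = affineDim P ∧ ¬F ⊆ F' := by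
  obtain ⟨b₀, hb₀⟩ := exists_supports hR hne
  obtain ⟨f, hf, hfR⟩ := Set.exists_of_ssubset hRF
  obtain ⟨r, hr⟩ := hne
  have hr0 : b₀ r = 0 := by rw [hb₀.2] at hr; exact hr.2
  have hf0 : b₀ f < 0 := lt_of_le_of_ne (hb₀.1 f (hF.subset hf)) fun h0 =>
    hfR (by rw [hb₀.2]; exact ⟨hF.subset hf, h0⟩)
  obtain ⟨b, F', hF', hb, hsub, -, hd⟩ := exists_facet_of_pos hP hb₀.1
    (reflect_mem_affineSpan (hR.subset hr) (hF.subset hf)) (by rw [apply_reflect]; linarith)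
  have hRF' : R ⊆ F' := fun y hy => hsub y (hR.subset hy) (by rw [hb₀.2] at hy; exact hy.2)
  refine ⟨F', hF'.isExposed, hRF', hd, fun hcon => ?_⟩
  have h1 := hcon hf
  have h2 := hRF' hr
  rw [hF'.2] at h1 h2
  rw [apply_reflect, h1.2, h2.2] at hb
  simp at hb

/-- A point of the affine span outside of a polytope violates a facet inequality. -/
theorem exists_facet_separating {P : Set E} (hP : IsPolytope P) {x : E}
    (hx : x ∈ affineSpan ℝ P) (hxP : x ∉ P) :
    ∃ (b : E →ᵃ[ℝ] ℝ) (R : Set E), Supports P R b ∧ 0 < b x ∧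
      R.Nonempty ∧ affineDim R + 1 = affineDim P := by
  have hP' := hP
  obtain ⟨S, rfl⟩ := hP'
  obtain ⟨l, u, h1, h2⟩ := geometric_hahn_banach_closed_point (convex_convexHull ℝ _)
    (S.finite_toSet.isClosed_convexHull ℝ) hxP
  obtain ⟨b, R, hR, hb, -, hne, hd⟩ := exists_facet_of_pos hP
    (b₀ := l.toLinearMap.toAffineMap - AffineMap.const ℝ E u)
    (fun y hy => by have := h1 y hy; simp; linarith) hx (by simpa using h2)
  exact ⟨b, R, hR, hb, hne, hd⟩

end Polytope

/-! ### Boundary complexes of cubical polytopes -/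

section CubicalPolytope

variable {E : Type*} [NormedAddCommGroup E] [NormedSpace ℝ E] {Q : Set E}

theorem finite_boundary_polytopeFaces (hQ : IsPolytope Q) :
    (boundary (polytopeFaces Q) Q).Finite :=
  hQ.finite_faces.subset fun _ h => h.1

theorem isExposed_of_mem_boundary {P G : Set E} (hP : P ∈ boundary (polytopeFaces Q) Q)
    (hG : G ∈ boundary (polytopeFaces Q) Q) (h : G ⊆ P) : IsExposed ℝ P G :=
  IsExposed.mono hG.1 hP.2.1 h

theorem inter_mem_boundary {P P' : Set E} (hP : P ∈ boundary (polytopeFaces Q) Q)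
    (hP' : P' ∈ boundary (polytopeFaces Q) Q) : P ∩ P' ∈ boundary (polytopeFaces Q) Q :=
  ⟨IsExposed.inter hP.1 hP'.1, Set.inter_subset_left.trans_ssubset hP.2⟩

theorem isPolytope_of_mem_boundary (hQ : IsPolytope Q) {P : Set E}
    (hP : P ∈ boundary (polytopeFaces Q) Q) : IsPolytope P := hQ.exists_of_isExposed hP.1

theorem Supports.neg_of_isFacetOf {P R : Set E} {b : E →ᵃ[ℝ] ℝ} (h : Supports P R b)
    (hd : affineDim R + 1 = affineDim P) {p : E} (hp : p ∈ P)
    (hint : ∀ b : E →ᵃ[ℝ] ℝ, (∀ y ∈ P, b y ≤ 0) → b p = 0 → ∀ y ∈ P, b y = 0) : b p < 0 := by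
  refine lt_of_le_of_ne (h.1 p hp) fun h0 => ?_
  have hRP : R = P := by
    rw [h.2]
    ext y
    exact ⟨fun hy => hy.1, fun hy => ⟨hy, hint b h.1 h0 y hy⟩⟩
  rw [hRP] at hd
  omega

theorem exists_supports_of_isFacetOf {P R : Set E} (hP : P ∈ boundary (polytopeFaces Q) Q)
    (hR : IsFacetOf (boundary (polytopeFaces Q) Q) affineDim P R) : ∃ b, Supports P R b :=
  exists_supports (isExposed_of_mem_boundary hP hR.1 hR.2.2.1) hR.2.1

/-- If a facet `G` of a face `F` lies in another face `F'`, then it is the intersection of the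
two. -/
theorem eq_inter_of_isFacetOf (hQ : IsCubicalPolytope Q) {F F' G : Set E}
    (hF : F ∈ boundary (polytopeFaces Q) Q) (hF' : F' ∈ boundary (polytopeFaces Q) Q)
    (hFF' : ¬F ⊆ F') (hG : IsFacetOf (boundary (polytopeFaces Q) Q) affineDim F G)
    (hGF' : G ⊆ F') : G = F ∩ F' := by
  have hfin := finite_boundary_polytopeFaces hQ.1
  have hsub : G ⊆ F ∩ F' := Set.subset_inter hG.2.2.1 hGF'
  have hlt := dim_lt_of_ssubset hfin hQ.2 (inter_mem_boundary hF hF') (hG.2.1.mono hsub) hF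
    (Set.inter_subset_left.ssubset_of_ne fun h => hFF' (Set.inter_eq_left.1 h))
  have hd := hG.2.2.2
  exact eq_of_subset_of_dim_le hfin hQ.2 hG.1 hG.2.1 (inter_mem_boundary hF hF') hsub (by omega)

/-- If a facet of a face `F` of `P` lies in a face `F'` of `P` that does not contain `F`, then a
supporting function of `F'` is a supporting function of this facet. -/
theorem Supports.restrict (hQ : IsCubicalPolytope Q) {P F F' G : Set E} {b : E →ᵃ[ℝ] ℝ}
    (hF : F ∈ boundary (polytopeFaces Q) Q) (hF' : F' ∈ boundary (polytopeFaces Q) Q)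
    (hFP : F ⊆ P) (hFF' : ¬F ⊆ F')
    (hG : IsFacetOf (boundary (polytopeFaces Q) Q) affineDim F G) (hGF' : G ⊆ F')
    (h : Supports P F' b) : Supports F G b := by
  refine ⟨fun y hy => h.1 y (hFP hy), ?_⟩
  rw [eq_inter_of_isFacetOf hQ hF hF' hFF' hG hGF', h.2]
  ext y
  exact ⟨fun hy => ⟨hy.1, hy.2.2⟩, fun hy => ⟨hy.1, hFP hy.1, hy.2⟩⟩

variable [FiniteDimensional ℝ E]

theorem mem_boundary_of_isExposed (hQ : IsPolytope Q) {P G : Set E}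
    (hP : P ∈ boundary (polytopeFaces Q) Q) (hG : IsExposed ℝ P G) :
    G ∈ boundary (polytopeFaces Q) Q :=
  ⟨hQ.isExposed_trans hP.1 hG, hG.subset.trans_ssubset hP.2⟩

theorem Supports.isFacetOf (hQ : IsPolytope Q) {P R : Set E} {b : E →ᵃ[ℝ] ℝ}
    (hP : P ∈ boundary (polytopeFaces Q) Q) (h : Supports P R b) (hne : R.Nonempty)
    (hd : affineDim R + 1 = affineDim P) :
    IsFacetOf (boundary (polytopeFaces Q) Q) affineDim P R :=
  ⟨mem_boundary_of_isExposed hQ hP h.isExposed, hne, h.isExposed.subset, hd⟩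

/-- The facets of a combinatorial cube `P` that are visible from a point `x` of its affine span
are not a nonempty antipodally closed collection. A facet whose
hyperplane contains `x` may be counted as visible or not.

When `x` moves straight towards the interior of `P`, it reaches the hyperplane of some facet `R₀` in
`A` while all other members of `A` are still weakly visible. By induction there it sees no facet of
`R₀`, so it lies in `R₀`; as the antipode of `R₀` is weakly visible too, the point lies in both. -/
theorem eq_empty_of_visible (hQ : IsCubicalPolytope Q) (k : ℕ) {P : Set E}
    (hP : P ∈ boundary (polytopeFaces Q) Q) (hne : P.Nonempty) (hk : affineDim P = k)
    {A : Set (Set E)} (hAf : ∀ R ∈ A, IsFacetOf (boundary (polytopeFaces Q) Q) affineDim P R)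
    (hA : AntipodallyClosed (boundary (polytopeFaces Q) Q) affineDim P A) {x : E}
    (hx : x ∈ affineSpan ℝ P)
    (hvis : ∀ R b, IsFacetOf (boundary (polytopeFaces Q) Q) affineDim P R → Supports P R b →
      (R ∈ A → 0 ≤ b x) ∧ (R ∉ A → b x ≤ 0)) : A = ∅ := by
  induction k generalizing P A x with
  | zero =>
    refine Set.eq_empty_of_forall_notMem fun R hR => ?_
    have := (hAf R hR).2.2.2
    omega
  | succ k ih =>
    have hfin := finite_boundary_polytopeFaces hQ.1
    by_contra hAne
    rw [← Ne, ← Set.nonempty_iff_ne_empty] at hAne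
    obtain ⟨p, hp, hint⟩ := exists_interior_point (isPolytope_of_mem_boundary hQ.1 hP) hne
    have hex : ∀ R, ∃ b, IsFacetOf (boundary (polytopeFaces Q) Q) affineDim P R →
        Supports P R b := by
      intro R
      by_cases hR : IsFacetOf (boundary (polytopeFaces Q) Q) affineDim P R
      · obtain ⟨b, hb⟩ := exists_supports_of_isFacetOf hP hR
        exact ⟨b, fun _ => hb⟩
      · exact ⟨0, fun h => absurd h hR⟩
    choose b hb using hex
    have hbp : ∀ R, IsFacetOf (boundary (polytopeFaces Q) Q) affineDim P R → b R p < 0 :=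
      fun R hR => (hb R hR).neg_of_isFacetOf hR.2.2.2 hp hint
    obtain ⟨R₀, hR₀A, hmin⟩ := Set.exists_min_image A (fun R => b R x / (b R x - b R p))
      (hfin.subset fun R hR => (hAf R hR).1) hAne
    have hR₀ := hAf R₀ hR₀A
    set t : ℝ := b R₀ x / (b R₀ x - b R₀ p) with ht
    have hx₀ := (hvis R₀ _ hR₀ (hb R₀ hR₀)).1 hR₀A
    have hp₀ := hbp R₀ hR₀
    have ht0 : 0 ≤ t := div_nonneg hx₀ (by linarith)
    have ht1 : t ≤ 1 := (div_le_one (by linarith)).2 (by linarith)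
    set y : E := AffineMap.lineMap x p t with hy
    have hby : ∀ R, b R y = b R x - t * (b R x - b R p) := by
      intro R
      rw [hy, AffineMap.apply_lineMap, AffineMap.lineMap_apply, vsub_eq_sub, vadd_eq_add,
        smul_eq_mul]
      ring
    have hyP : y ∈ affineSpan ℝ P := AffineMap.lineMap_mem t hx (subset_affineSpan ℝ P hp)
    have hy₀ : b R₀ y = 0 := by
      rw [hby, ht, div_mul_cancel₀ _ (by linarith), sub_self]
    have hyA : ∀ R ∈ A, 0 ≤ b R y := by
      intro R hR
      have h1 := (hvis R _ (hAf R hR) (hb R (hAf R hR))).1 hR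
      have h2 := hbp R (hAf R hR)
      have h3 := hmin R hR
      rw [le_div_iff₀ (by linarith)] at h3
      rw [hby]
      linarith
    have hyA' : ∀ R, IsFacetOf (boundary (polytopeFaces Q) Q) affineDim P R → R ∉ A →
        b R y ≤ 0 := by
      intro R hR hRA
      have h1 := (hvis R _ hR (hb R hR)).2 hRA
      have h2 := hbp R hR
      rw [hby]
      nlinarith
    have hyR₀ := mem_affineSpan_facet (hb R₀ hR₀) hR₀.2.1 hR₀.2.2.2 hyP hy₀
    have hnot : ∀ R, IsFacetOf (boundary (polytopeFaces Q) Q) affineDim P R → R ≠ R₀ →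
        ¬R₀ ⊆ R := fun R hR hne h => hne
      (eq_of_subset_of_dim_le hfin hQ.2 hR₀.1 hR₀.2.1 hR.1 h
        (by have := hR.2.2.2; have := hR₀.2.2.2; omega)).symm
    have hsign : ∀ G c, IsFacetOf (boundary (polytopeFaces Q) Q) affineDim R₀ G →
        Supports R₀ G c → ∀ R, IsFacetOf (boundary (polytopeFaces Q) Q) affineDim P R → R ≠ R₀ →
        G ⊆ R → (0 ≤ b R y → 0 ≤ c y) ∧ (b R y ≤ 0 → c y ≤ 0) := by
      intro G c hG hc R hR hne hGR
      have h1 := (hb R hR).restrict hQ hR₀.1 hR.1 hR₀.2.2.1 (hnot R hR hne) hG hGR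
      obtain ⟨a, ha, h2⟩ := exists_pos_mul_eq h1 hc hG.2.1 hG.2.2.2
      rw [h2 y hyR₀]
      exact ⟨fun h => mul_nonneg ha.le h, fun h => mul_nonpos_of_nonneg_of_nonpos ha.le h⟩
    have hvis' : ∀ G c, IsFacetOf (boundary (polytopeFaces Q) Q) affineDim R₀ G →
        Supports R₀ G c →
        (G ∈ restrictFacets (boundary (polytopeFaces Q) Q) affineDim R₀ A → 0 ≤ c y) ∧
        (G ∉ restrictFacets (boundary (polytopeFaces Q) Q) affineDim R₀ A → c y ≤ 0) := by
      intro G c hG hc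
      constructor
      · rintro ⟨-, R, hR, hne, hGR⟩
        exact (hsign G c hG hc R (hAf R hR) hne hGR).1 (hyA R hR)
      · intro hGA
        obtain ⟨R, hR, hne, hGR⟩ := exists_second_facet hfin hQ.2 hP hR₀ hG
        exact (hsign G c hG hc R hR hne hGR).2
          (hyA' R hR fun h => hGA ⟨hG, R, h, hne, hGR⟩)
    have hempty := ih hR₀.1 hR₀.2.1 (by have := hR₀.2.2.2; omega) (fun G hG => hG.1)
      (antipodallyClosed_restrictFacets hfin hQ.2 hP hR₀ hAf hA) hyR₀ hvis'
    have hyR₀' : y ∈ R₀ := by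
      by_contra hcon
      obtain ⟨c, G, hc, hcy, hGne, hGd⟩ := exists_facet_separating
        (isPolytope_of_mem_boundary hQ.1 hR₀.1) hyR₀ hcon
      have := (hvis' G c (hc.isFacetOf hQ.1 hR₀.1 hGne hGd) hc).2 (by rw [hempty]; simp)
      linarith
    obtain ⟨R₁, hR₁, hno⟩ := exists_antipode hfin hQ.2 hP hR₀
    have hy₁ : y ∈ R₁ := by
      have h1 := hb R₁ hR₁
      rw [h1.2]
      have hyP' := hR₀.2.2.1 hyR₀'
      exact ⟨hyP', le_antisymm (h1.1 y hyP') (hyA R₁ (hA R₀ hR₀A R₁ hR₁ hno))⟩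
    exact hno _ (inter_mem_boundary hR₀.1 hR₁.1) ⟨y, hyR₀', hy₁⟩ Set.inter_subset_left
      Set.inter_subset_right

end CubicalPolytope

/-! ### Line shellings of cubical polytopes -/

section LineShelling

variable {E : Type*} [NormedAddCommGroup E] [NormedSpace ℝ E]

/-- The supporting functions of finitely many facets, normalised to be `-1` at an interior point
`p`, and a direction `u` in which their slopes are nonzero and pairwise different. -/
theorem exists_generic_direction {P : Set E} (hP : IsPolytope P) (hne : P.Nonempty)
    (T : Finset (Set E))
    (hT : ∀ F ∈ T, IsExposed ℝ P F ∧ F.Nonempty ∧ affineDim F + 1 = affineDim P) :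
    ∃ p ∈ P, ∃ β : Set E → E →ᵃ[ℝ] ℝ, (∀ F ∈ T, Supports P F (β F) ∧ β F p = -1) ∧
      ∃ u ∈ vectorSpan ℝ P, (∀ F ∈ T, (β F).linear u ≠ 0) ∧
        ∀ F ∈ T, ∀ F' ∈ T, (β F).linear u = (β F').linear u → F = F' := by
  obtain ⟨p, hp, hint⟩ := exists_interior_point hP hne
  have hex : ∀ F, ∃ b : E →ᵃ[ℝ] ℝ, F ∈ T → Supports P F b ∧ b p = -1 := by
    intro F
    by_cases hF : F ∈ T
    · obtain ⟨h1, h2, h3⟩ := hT F hF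
      obtain ⟨b, hb⟩ := exists_supports h1 h2
      have hbp := hb.neg_of_isFacetOf h3 hp hint
      have hc : 0 < -(b p)⁻¹ := neg_pos.2 (inv_lt_zero.2 hbp)
      have hval : ∀ y, (-(b p)⁻¹ • b) y = -(b p)⁻¹ * b y := fun y => by simp
      refine ⟨-(b p)⁻¹ • b, fun _ => ⟨⟨fun y hy => ?_, ?_⟩, ?_⟩⟩
      · rw [hval]; exact mul_nonpos_of_nonneg_of_nonpos hc.le (hb.1 y hy)
      · rw [hb.2]
        ext y
        simp only [Set.mem_ofPred_eq, hval, mul_eq_zero, hc.ne', false_or]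
      · rw [hval, neg_mul, inv_mul_cancel₀ hbp.ne]
    · exact ⟨0, fun h => absurd h hF⟩
  choose β hβ using hex
  refine ⟨p, hp, β, hβ, ?_⟩
  -- On `P`, a function with zero slope in all directions is constant.
  have hconst : ∀ f : E →ₗ[ℝ] ℝ, (∀ v ∈ vectorSpan ℝ P, f v = 0) → ∀ y ∈ P, f (y - p) = 0 :=
    fun f hf y hy => hf _ (vsub_mem_vectorSpan ℝ hy hp)
  obtain ⟨u, hu, hne⟩ := Module.Dual.exists_forall_mem_ne_zero_of_forall_exists
    (ι := {F // F ∈ T} ⊕ {F : {F // F ∈ T} × {F // F ∈ T} // F.1 ≠ F.2}) (vectorSpan ℝ P)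
    (Sum.elim (fun F => (β F.1).linear)
      fun F => (β F.1.1.1).linear - (β F.1.2.1).linear) (by
    rintro (⟨F, hF⟩ | ⟨⟨⟨F, hF⟩, ⟨F', hF'⟩⟩, hne⟩)
    · by_contra! hcon
      obtain ⟨y, hy⟩ := (hT F hF).2.1
      have h1 := hβ F hF
      have h2 := hy
      rw [h1.1.2] at h2
      have h3 := hconst (β F).linear hcon y h2.1
      rw [linear_sub, h2.2, h1.2] at h3
      norm_num at h3
    · by_contra! hcon
      refine hne (Subtype.ext ?_)
      have h1 := hβ F hF
      have h2 := hβ F' hF'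
      have h3 : ∀ y ∈ P, β F y = β F' y := by
        intro y hy
        have h4 := hconst ((β F).linear - (β F').linear) hcon y hy
        rw [LinearMap.sub_apply, linear_sub, linear_sub, h1.2, h2.2] at h4
        linarith
      change F = F'
      rw [h1.1.2, h2.1.2]
      ext y
      exact ⟨fun hy => ⟨hy.1, by rw [← h3 y hy.1]; exact hy.2⟩,
        fun hy => ⟨hy.1, by rw [h3 y hy.1]; exact hy.2⟩⟩)
  refine ⟨u, hu, fun F hF => hne (Sum.inl ⟨F, hF⟩), fun F hF F' hF' h => ?_⟩
  by_contra hFF'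
  refine hne (Sum.inr ⟨(⟨F, hF⟩, ⟨F', hF'⟩), fun h => hFF' (congrArg Subtype.val h)⟩) ?_
  change (β F).linear u - (β F').linear u = 0
  rw [h, sub_self]

variable [FiniteDimensional ℝ E]

theorem exists_facet {P : Set E} (hP : IsPolytope P) (hd : affineDim P ≠ 0) :
    ∃ F, IsExposed ℝ P F ∧ F.Nonempty ∧ affineDim F + 1 = affineDim P := by
  have hne : P.Nonempty := by
    by_contra h
    rw [Set.not_nonempty_iff_eq_empty] at h
    rw [h, affineDim, vectorSpan_empty, finrank_bot] at hd
    exact hd rfl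
  obtain ⟨p, hp⟩ := hne
  have hV : ¬vectorSpan ℝ P ≤ ⊥ := by
    rw [le_bot_iff]
    intro h
    rw [affineDim, h, finrank_bot] at hd
    exact hd rfl
  obtain ⟨φ, -, v, hv, hφv⟩ := exists_linear_of_not_le hV
  have hP' := hP
  obtain ⟨S, rfl⟩ := hP'
  obtain ⟨M, hM⟩ := (S.image φ).exists_le
  set b₀ : E →ᵃ[ℝ] ℝ := φ.toAffineMap - AffineMap.const ℝ E M with hb₀
  have hval : ∀ y, b₀ y = φ y - M := fun y => by simp [hb₀]
  have hle : ∀ y ∈ convexHull ℝ (S : Set E), b₀ y ≤ 0 := fun y hy =>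
    nonpos_of_mem_convexHull (fun s hs => by
      rw [hval]; have := hM _ (Finset.mem_image_of_mem φ hs); linarith) hy
  obtain ⟨b, F, hF, -, -, hFne, hFd⟩ := exists_facet_of_pos hP hle
    (x := p + ((1 - b₀ p) / φ v) • v) (by
      rw [mem_affineSpan_iff_sub_mem hp, add_sub_cancel_left]
      exact Submodule.smul_mem _ _ hv) (by
      rw [hval, hval, map_add, map_smul, smul_eq_mul, div_mul_cancel₀ _ hφv]
      linarith)
  exact ⟨F, hF.isExposed, hFne, hFd⟩

/-- The boundary complex of a cubical polytope of dimension `n + 1` has dimension `n` and a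
nonnegative cubical `h`-vector. The facets are ordered as they appear on a line through an interior
point, first from this point to infinity and then from infinity back to the point. -/
theorem cubicalHPoly_boundary_nonneg {Q : Set E} (hQ : IsCubicalPolytope Q) {n : ℕ}
    (hn : affineDim Q = n + 1) :
    IsGreatest (affineDim '' {σ | σ ∈ boundary (polytopeFaces Q) Q ∧ σ.Nonempty}) n ∧
      ∀ j, 0 ≤ (cubicalHPoly n (fNum (boundary (polytopeFaces Q) Q) affineDim)).coeff j := by
  classical
  set K := boundary (polytopeFaces Q) Q with hK
  have hfin : K.Finite := finite_boundary_polytopeFaces hQ.1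
  have hc : IsCubical K affineDim := hQ.2
  have hmemK : ∀ F, IsExposed ℝ Q F → affineDim F + 1 = affineDim Q → F ∈ K := fun F hF hd =>
    ⟨hF, hF.subset.ssubset_of_ne fun h => by rw [h] at hd; omega⟩
  set T : Finset (Set E) := hfin.toFinset.filter fun F => F.Nonempty ∧ affineDim F = n with hT
  have hmemT : ∀ F, F ∈ T ↔ F ∈ K ∧ F.Nonempty ∧ affineDim F = n := by
    intro F; rw [hT, Finset.mem_filter, Set.Finite.mem_toFinset]
  obtain ⟨F₀, hF₀, hF₀ne, hF₀d⟩ := exists_facet hQ.1 (by omega)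
  have hF₀T : F₀ ∈ T := (hmemT F₀).2 ⟨hmemK F₀ hF₀ hF₀d, hF₀ne, by omega⟩
  have hQne : Q.Nonempty := hF₀ne.mono hF₀.subset
  have hcov : ∀ σ ∈ K, σ.Nonempty → ∃ τ ∈ T, σ ⊆ τ := by
    intro σ hσ hne
    obtain ⟨F, hF, hsub, hd⟩ := exists_facet_superset hQ.1 hσ.1 hne hσ.2.ne
    exact ⟨F, (hmemT F).2 ⟨hmemK F hF hd, hne.mono hsub, by omega⟩, hsub⟩
  refine ⟨⟨⟨F₀, ⟨((hmemT F₀).1 hF₀T).1, hF₀ne⟩, ((hmemT F₀).1 hF₀T).2.2⟩, ?_⟩, ?_⟩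
  · rintro _ ⟨σ, ⟨hσ, hne⟩, rfl⟩
    obtain ⟨τ, hτ, hsub⟩ := hcov σ hσ hne
    rw [hmemT] at hτ
    have := dim_le_of_subset hfin hc hσ hne hτ.1 hsub
    omega
  obtain ⟨p, hp, β, hβ, u, hu, hu0, huinj⟩ := exists_generic_direction hQ.1 hQne T fun F hF => by
    rw [hmemT] at hF
    exact ⟨hF.1.1, hF.2.1, by omega⟩
  -- The function of `F` vanishes on the line `p + s • u` at `s = 1 / (β F).linear u`.
  have hnot : ∀ F ∈ T, ∀ F' ∈ T, F ≠ F' → ¬F ⊆ F' := by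
    intro F hF F' hF' hne h
    rw [hmemT] at hF hF'
    exact hne (eq_of_subset_of_dim_le hfin hc hF.1 hF.2.1 hF'.1 h (by omega))
  -- Supporting functions of facets of `F` come from those of the neighbouring facets of `Q`.
  have hprop : ∀ F ∈ T, ∀ F' ∈ T, F ≠ F' → ∀ R b, IsFacetOf K affineDim F R → Supports F R b →
      R ⊆ F' → ∃ c : ℝ, 0 < c ∧ ∀ x ∈ affineSpan ℝ F, b x = c * β F' x := by
    intro F hF F' hF' hne R b hR hb hsub
    have hFK := ((hmemT F).1 hF).1
    have h1 := (hβ F' hF').1.restrict hQ hFK ((hmemT F').1 hF').1 hFK.2.1 (hnot F hF F' hF' hne)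
      hR hsub
    exact exists_pos_mul_eq h1 hb hR.2.1 hR.2.2.2
  have hneigh : ∀ F ∈ T, ∀ R, IsFacetOf K affineDim F R → ∃ F' ∈ T, F ≠ F' ∧ R ⊆ F' := by
    intro F hF R hR
    obtain ⟨F', hF', hsub, hd, hFF'⟩ := exists_facet_superset_not_superset hQ.1
      ((hmemT F).1 hF).1.1 hR.1.1 hR.2.1 (hR.2.2.1.ssubset_of_ne fun h => by
        have := hR.2.2.2; rw [h] at this; omega)
    exact ⟨F', (hmemT F').2 ⟨hmemK F' hF' hd, hR.2.1.mono hsub, by omega⟩,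
      fun h => hFF' (h ▸ subset_rfl), hsub⟩
  have hspan : ∀ F ∈ T, ∀ x ∈ affineSpan ℝ Q, β F x = 0 → x ∈ affineSpan ℝ F := by
    intro F hF x hx h0
    have h1 := (hmemT F).1 hF
    exact mem_affineSpan_facet (hβ F hF).1 h1.2.1 (by omega) hx h0
  refine cubicalHPoly_nonneg hfin hc T ⟨F₀, hF₀T⟩ (fun F hF => (hmemT F).1 hF) hcov
    (fun F => -(β F).linear u) (fun F hF F' hF' h => huinj F hF F' hF' (neg_injective h)) ?_ ?_
  · intro F hF F' hF' hlt σ hσ hσne hσF hσF'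
    have hlt' : (β F).linear u < (β F').linear u := by linarith
    obtain ⟨g, hg⟩ := hσne
    have hFK := (hmemT F).1 hF
    have hzero : ∀ H ∈ T, g ∈ H → β H g = 0 := fun H hH hgH => by
      rw [(hβ H hH).1.2] at hgH; exact hgH.2
    have hgQ : g ∈ Q := hFK.1.2.1 (hσF hg)
    -- Move from `g` inside the hyperplane of `F` towards the hyperplanes met earlier.
    set x : E := g + (u - (β F).linear u • (g - p)) with hx
    have hval : ∀ H ∈ T, g ∈ H → β H x = (β H).linear u - (β F).linear u := by
      intro H hH hgH
      have h1 := linear_sub (β H) x g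
      rw [hx, add_sub_cancel_left, map_sub, map_smul, linear_sub, hzero H hH hgH, (hβ H hH).2,
        smul_eq_mul] at h1
      rw [hx]
      linarith
    have hxQ : x ∈ affineSpan ℝ Q := by
      rw [mem_affineSpan_iff_sub_mem hgQ, hx, add_sub_cancel_left]
      exact Submodule.sub_mem _ hu (Submodule.smul_mem _ _ (vsub_mem_vectorSpan ℝ hgQ hp))
    have hxF := hspan F hF x hxQ (by rw [hval F hF (hσF hg), sub_self])
    obtain ⟨b, R, hbR, hbx, hsub, hRne, hRd⟩ := exists_facet_of_pos
      (isPolytope_of_mem_boundary hQ.1 hFK.1) (fun y hy => (hβ F' hF').1.1 y (hFK.1.2.1 hy)) hxF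
      (by rw [hval F' hF' (hσF' hg)]; linarith)
    have hR := hbR.isFacetOf hQ.1 hFK.1 hRne hRd
    have hσR : σ ⊆ R := fun y hy => hsub y (hσF hy) (by
      have := hσF' hy
      rw [(hβ F' hF').1.2] at this
      exact this.2)
    obtain ⟨F₁, hF₁, hne₁, hsub₁⟩ := hneigh F hF R hR
    obtain ⟨c, hc0, hc⟩ := hprop F hF F₁ hF₁ hne₁ R b hR hbR hsub₁
    rw [hc x hxF, hval F₁ hF₁ (hsub₁ (hσR hg))] at hbx
    have := pos_of_mul_pos_right hbx hc0.le
    exact ⟨R, ⟨hR, F₁, hF₁, by linarith, hsub₁⟩, hσR⟩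
  · rintro F hF ⟨F', hF', hlt⟩ hA
    set A := earlierFacets K affineDim T (fun F => -(β F).linear u) F with hAdef
    have hFK := (hmemT F).1 hF
    have ha := hu0 F hF
    set a := (β F).linear u with hadef
    set x : E := p + a⁻¹ • u with hx
    have hval : ∀ H ∈ T, β H x = ((β H).linear u - a) / a := by
      intro H hH
      have h1 := linear_sub (β H) x p
      rw [hx, add_sub_cancel_left, map_smul, smul_eq_mul, (hβ H hH).2] at h1
      rw [hx, sub_div, div_self ha, div_eq_inv_mul]
      linarith
    have hxF : x ∈ affineSpan ℝ F := hspan F hF x (by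
      rw [mem_affineSpan_iff_sub_mem hp, hx, add_sub_cancel_left]
      exact Submodule.smul_mem _ _ hu) (by rw [hval F hF, ← hadef, sub_self, zero_div])
    have hearlier : ∀ R ∈ A, ∀ b, Supports F R b → ∃ r s : ℝ, 0 < r ∧ 0 < s ∧ b x = r * (s / a) := by
      rintro R ⟨hR, H, hH, hHlt, hsub⟩ b hb
      have hHlt' : a < (β H).linear u := by rw [hadef]; linarith
      obtain ⟨c, hc0, hc⟩ := hprop F hF H hH (by rintro rfl; exact lt_irrefl _ hHlt) R b hR hb hsub
      exact ⟨c, (β H).linear u - a, hc0, by linarith, by rw [hc x hxF, hval H hH]⟩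
    have hlater : ∀ R b, IsFacetOf K affineDim F R → Supports F R b → R ∉ A →
        ∃ r s : ℝ, 0 < r ∧ s ≤ 0 ∧ b x = r * (s / a) := by
      intro R b hR hb hRA
      obtain ⟨H, hH, hne, hsub⟩ := hneigh F hF R hR
      obtain ⟨c, hc0, hc⟩ := hprop F hF H hH hne R b hR hb hsub
      refine ⟨c, (β H).linear u - a, hc0, ?_, by rw [hc x hxF, hval H hH]⟩
      by_contra! hcon
      exact hRA ⟨hR, H, hH, by rw [hadef] at hcon; linarith, hsub⟩
    rcases lt_or_gt_of_ne ha with ha | ha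
    · -- The facets that are not in `A` are those weakly visible from `x`.
      have hempty := eq_empty_of_visible hQ _ hFK.1 hFK.2.1 rfl
        (A := {R | IsFacetOf K affineDim F R ∧ R ∉ A}) (fun R hR => hR.1)
        (fun R hR R' hR' hno => ⟨hR', fun h => hR.2
          (hA R' h R hR.1 fun ρ hρ hne h1 h2 => hno ρ hρ hne h2 h1)⟩) hxF (by
        intro R b hR hb
        constructor
        · rintro ⟨-, hRA⟩
          obtain ⟨r, s, hr, hs, h⟩ := hlater R b hR hb hRA
          rw [h]
          exact mul_nonneg hr.le (div_nonneg_of_nonpos hs ha.le)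
        · intro hRA
          have hRA' : R ∈ A := by
            by_contra h
            exact hRA ⟨hR, h⟩
          obtain ⟨r, s, hr, hs, h⟩ := hearlier R hRA' b hb
          rw [h]
          exact mul_nonpos_of_nonneg_of_nonpos hr.le (div_nonpos_of_nonneg_of_nonpos hs.le ha.le))
      intro R hR
      by_contra hRA
      exact Set.eq_empty_iff_forall_notMem.1 hempty R ⟨hR, hRA⟩
    · -- The facets in `A` are those visible from `x`; there are none, so `x` lies in `F`.
      have hvis : ∀ R b, IsFacetOf K affineDim F R → Supports F R b →
          (R ∈ A → 0 ≤ b x) ∧ (R ∉ A → b x ≤ 0) := by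
        intro R b hR hb
        constructor
        · intro hRA
          obtain ⟨r, s, hr, hs, h⟩ := hearlier R hRA b hb
          rw [h]
          exact mul_nonneg hr.le (div_nonneg hs.le ha.le)
        · intro hRA
          obtain ⟨r, s, hr, hs, h⟩ := hlater R b hR hb hRA
          rw [h]
          exact mul_nonpos_of_nonneg_of_nonpos hr.le (div_nonpos_of_nonpos_of_nonneg hs ha.le)
      have hempty := eq_empty_of_visible hQ _ hFK.1 hFK.2.1 rfl (fun R hR => hR.1) hA hxF hvis
      exfalso
      have hxF' : x ∈ F := by
        by_contra hcon
        obtain ⟨b, R, hb, hbx, hRne, hRd⟩ := exists_facet_separating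
          (isPolytope_of_mem_boundary hQ.1 hFK.1) hxF hcon
        have := (hvis R b (hb.isFacetOf hQ.1 hFK.1 hRne hRd) hb).2 (by rw [hempty]; simp)
        linarith
      have h1 := (hβ F' hF').1.1 x (hFK.1.2.1 hxF')
      have hlt' : a < (β F').linear u := by rw [hadef]; linarith
      rw [hval F' hF'] at h1
      have h2 : 0 < ((β F').linear u - a) / a := div_pos (by linarith) ha
      linarith

end LineShelling

/-! ### Coning off the boundary complex -/

section Cone

variable {V : Type*}

open Classical in
theorem sum_chainFinset_insert {D : Finset (Set V)} {τ : Set V} (hτ : ∀ σ ∈ D, σ ⊂ τ)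
    {M : Type*} [AddCommMonoid M] (w : ℕ → M) :
    ∑ c ∈ chainFinset (insert τ D), w c.card
      = ∑ c ∈ chainFinset D, (w c.card + w (c.card + 1)) := by
  rw [← Finset.sum_filter_not_add_sum_filter (chainFinset (insert τ D)) (fun c => τ ∈ c),
    Finset.sum_add_distrib]
  congr 1
  · refine Finset.sum_congr ?_ fun _ _ => rfl
    ext c
    rw [Finset.mem_filter, mem_chainFinset, mem_chainFinset]
    constructor
    · rintro ⟨⟨h1, h2⟩, h3⟩
      exact ⟨(Finset.subset_insert_iff_of_notMem h3).1 h1, h2⟩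
    · rintro ⟨h1, h2⟩
      exact ⟨⟨h1.trans (Finset.subset_insert _ _), h2⟩, fun h => (hτ τ (h1 h)).2 subset_rfl⟩
  · have h1 : (chainFinset (insert τ D)).filter (fun c => τ ∈ c)
        = topChainFinset (insert τ D) τ := by
      refine Finset.filter_congr fun c hc => ⟨fun h => ⟨h, fun σ hσ => ?_⟩, fun h => h.1⟩
      rcases Finset.mem_insert.1 ((mem_chainFinset.1 hc).1 hσ) with rfl | h
      · exact subset_rfl
      · exact (hτ σ h).1
    have h2 : (insert τ D).filter (· ⊂ τ) = D := by
      rw [Finset.filter_insert, if_neg (fun h => h.2 subset_rfl), Finset.filter_true_of_mem hτ]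
    rw [h1, sum_topChainFinset (Finset.mem_insert_self τ D), h2]

/-- Adding a face that contains all other faces does not change the `h`-polynomial of the
barycentric subdivision. -/
theorem hPoly_sd_insert {K : Set (Set V)} (hK : K.Finite) {τ : Set V} (hne : τ.Nonempty)
    (hτ : ∀ σ ∈ K, σ ⊂ τ) : hPoly (sd (insert τ K)) = hPoly (sd K) := by
  classical
  have hK' : (insert τ K).Finite := hK.insert τ
  have hτ' : ∀ σ ∈ faceFinset hK, σ ⊂ τ := fun σ hσ => hτ σ (mem_faceFinset.1 hσ).1
  have hface : faceFinset hK' = insert τ (faceFinset hK) := by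
    ext σ
    simp only [mem_faceFinset, Finset.mem_insert, Set.mem_insert_iff]
    constructor
    · rintro ⟨rfl | h, h'⟩
      · exact Or.inl rfl
      · exact Or.inr ⟨h, h'⟩
    · rintro (rfl | h)
      · exact ⟨Or.inl rfl, hne⟩
      · exact ⟨Or.inr h.1, h.2⟩
  have hdim : dimSucc (sd (insert τ K)) = dimSucc (sd K) + 1 := by
    apply le_antisymm
    · refine csSup_le ⟨_, {τ}, ⟨by simp, by simpa using hne, by simp⟩, rfl⟩ ?_
      rintro _ ⟨c, hc, rfl⟩
      have hc' := mem_chainFinset.1 ((mem_sd_faces (hK := hK')).1 hc).1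
      have h1 : c.erase τ ∈ chainFinset (faceFinset hK) := by
        rw [mem_chainFinset]
        refine ⟨?_, hc'.2.mono (by simp)⟩
        rw [← Finset.subset_insert_iff, ← hface]
        exact hc'.1
      have h2 := card_le_dimSucc hK h1
      have h3 := Finset.pred_card_le_card_erase (s := c) (a := τ)
      omega
    · have hex : ∃ c ∈ chainFinset (faceFinset hK), c.card = dimSucc (sd K) := by
        rcases (sd K).faces.eq_empty_or_nonempty with h | h
        · exact ⟨∅, by simp [mem_chainFinset], by simp [dimSucc, h]⟩
        · obtain ⟨c, hc, hcard⟩ := Nat.sSup_mem (h.image Finset.card)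
            ⟨dimSucc (sd K), by
              rintro _ ⟨c, hc, rfl⟩
              exact card_le_dimSucc hK ((mem_sd_faces (hK := hK)).1 hc).1⟩
          exact ⟨c, ((mem_sd_faces (hK := hK)).1 hc).1, hcard⟩
      obtain ⟨c, hc, hcard⟩ := hex
      rw [mem_chainFinset] at hc
      have h1 : insert τ c ∈ chainFinset (faceFinset hK') := by
        rw [mem_chainFinset, hface, Finset.coe_insert]
        exact ⟨Finset.insert_subset_insert _ hc.1,
          hc.2.insert fun σ hσ _ => Or.inr (hτ' σ (hc.1 hσ)).1⟩
      have h2 := card_le_dimSucc hK' h1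
      rwa [Finset.card_insert_of_notMem fun h => (hτ' τ (hc.1 h)).2 subset_rfl, hcard] at h2
  rw [hPoly_sd hK', hPoly_sd hK, hface, hdim,
    sum_chainFinset_insert hτ' fun i => X ^ i * (1 - X) ^ (dimSucc (sd K) + 1 - i)]
  refine Finset.sum_congr rfl fun c hc => ?_
  obtain ⟨j, hj⟩ := Nat.exists_eq_add_of_le (card_le_dimSucc hK hc)
  rw [hj, Nat.add_sub_cancel_left, Nat.add_sub_add_right, Nat.add_sub_cancel_left,
    add_assoc, Nat.add_sub_cancel_left]
  ring

end Cone

theorem hPoly_sd_polytopeFaces {E : Type*} [NormedAddCommGroup E] [NormedSpace ℝ E] {Q : Set E}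
    (hQ : IsPolytope Q) (hne : Q.Nonempty) :
    hPoly (sd (polytopeFaces Q)) = hPoly (sd (boundary (polytopeFaces Q) Q)) := by
  rw [← hPoly_sd_insert (finite_boundary_polytopeFaces hQ) hne fun σ hσ => hσ.2]
  congr 2
  ext σ
  rw [Set.mem_insert_iff]
  constructor
  · intro h
    by_cases hσ : σ = Q
    · exact Or.inl hσ
    · exact Or.inr ⟨h, IsExposed.subset h |>.ssubset_of_ne hσ⟩
  · rintro (rfl | h)
    · exact IsExposed.refl _
    · exact h.1

end CubicalSubdivision

end

theorem corollary3p5 (n : ℕ) :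
    -- cubical complexes with nonnegative cubical `h`-vector
    (∀ (X : Type*) [TopologicalSpace X] [T2Space X] (L : RegularCellComplex X),
      L.HasDim n → IsCubical L.cells L.dim → (∀ k ≤ n + 1, 0 ≤ L.cubicalH n k) →
        RealRooted (hPoly (sd L.cells)) ∧ Interlaces (eulerianB n) (hPoly (sd L.cells))) ∧
    -- shellable cubical complexes
    (∀ (X : Type*) [TopologicalSpace X] [T2Space X] (L : RegularCellComplex X),
      L.HasDim n → IsCubical L.cells L.dim → IsShellable L.cells L.dim →
        RealRooted (hPoly (sd L.cells)) ∧ Interlaces (eulerianB n) (hPoly (sd L.cells))) ∧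
    -- cubical polytopes
    (∀ (d : ℕ) (Q : Set (EuclideanSpace ℝ (Fin d))),
      IsCubicalPolytope Q → affineDim Q = n + 1 →
        RealRooted (hPoly (sd (polytopeFaces Q))) ∧
          Interlaces (eulerianB n) (hPoly (sd (polytopeFaces Q)))) := by
  refine ⟨fun X _ _ L hdim hcub hnn => interlaces_hPoly_sd L.finite_cells hcub hdim hnn,
    fun X _ _ L hdim hcub hsh => ?_, fun d Q hQ hd => ?_⟩
  · obtain ⟨d, m, τ, hτ⟩ := hsh
    exact interlaces_hPoly_sd L.finite_cells hcub hdim fun k _ =>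
      cubicalHPoly_nonneg_of_isShelling L.finite_cells hcub L.coverProperty hdim hτ k
  · have hne : Q.Nonempty := by
      rw [Set.nonempty_iff_ne_empty]
      rintro rfl
      rw [affineDim, vectorSpan_empty, finrank_bot] at hd
      omega
    obtain ⟨hn, hnn⟩ := cubicalHPoly_boundary_nonneg hQ hd
    rw [hPoly_sd_polytopeFaces hQ.1 hne]
    exact interlaces_hPoly_sd (finite_boundary_polytopeFaces hQ.1) hQ.2 hn fun k _ => hnn k
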